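/- All matroids are on finite ground sets. A series-parallel matroid is a matroid obtained from a single loop or a single coloop by a finite (possibly empty) sequence of series and parallel extensions. Here $M'$ is a parallel extension of $M$ if some element $e$ of $M'$ lies in a circuit of size $2$ of $M'$ and $M'\setminus e=M$; it is a series extension of $M$ if some element $e$ of $M'$ lies in a cocircuit of size $2$ of $M'$ and $M'/e=M$. A matroid is quasi series-parallel if all its connected components are series-parallel, and it is simple if it has no loops and no circuits of size $2$. For an integer $k\ge 0$, let $E_k$ be the number of simple series-parallel matroids of rank $k+1$ on the ground set $[2k]=\{1,\dots,2k\}$. **Proposition.** For every integer $k\ge 0$, the number of simple quasi series-parallel matroids of rank $k+1$ on $[2k]$ is equal to $$E_k+\frac12\sum_{a=0}^{k-1}\binom{2k}{2a+1}(2a-1)!!\,(2k-2a-3)!!\,(2a+1)^{a-1}(2k-2a-1)^{k-a-2},$$ where $(-1)!!=1$. Moreover, for $k\ge 1$, the Kazhdan–Lusztig polynomial $P_{\mathsf K_{2k+1}}(t)$ of the braid matroid $\mathsf K_{2k+1}$ (the cycle matroid of the complete graph on $2k+1$ vertices) has degree $k-1$, and its leading coefficient is this same number. Here the Kazhdan–Lusztig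 polynomials $P_M(t)\in\mathbb Z[t]$ of loopless matroids $M$ are the unique polynomials such that $P_M=1$ if $\operatorname{rk}M=0$; $\deg P_M<\frac12\operatorname{rk}M$ if $\operatorname{rk}M>0$; and, for every $M$, the polynomial $\sum_F t^{\operatorname{rk}F}P_{M/F}(t)$, summed over all flats $F$ of $M$, is palindromic of degree $\operatorname{rk}M$. -/

import Mathlib

open scoped Matroid

namespace SPMatroid

universe u

section SeriesParallel

variable {α : Type u}

/-- `M'` is a parallel extension of `M`: some element `e` of `M'` lies in a two-element circuit
of `M'` and deleting it gives `M`. -/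
def IsParallelExtension (M M' : Matroid α) : Prop :=
  ∃ e ∈ M'.E, (∃ C, M'.IsCircuit C ∧ C.encard = 2 ∧ e ∈ C) ∧ M' ＼ {e} = M

/-- `M'` is a series extension of `M`: some element `e` of `M'` lies in a two-element cocircuit
of `M'` and contracting it gives `M`. -/
def IsSeriesExtension (M M' : Matroid α) : Prop :=
  ∃ e ∈ M'.E, (∃ C, M'.IsCocircuit C ∧ C.encard = 2 ∧ e ∈ C) ∧ M' ／ {e} = M

/-- Series-parallel matroids: those obtained from a single loop or a single coloop by a finite,
possibly empty, sequence of series and parallel extensions. -/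
inductive IsSeriesParallel : Matroid α → Prop
  | loop (e : α) : IsSeriesParallel (Matroid.loopyOn {e})
  | coloop (e : α) : IsSeriesParallel (Matroid.freeOn {e})
  | parallel {M M' : Matroid α} :
      IsSeriesParallel M → IsParallelExtension M M' → IsSeriesParallel M'
  | series {M M' : Matroid α} :
      IsSeriesParallel M → IsSeriesExtension M M' → IsSeriesParallel M'

/-- The connected component of the element `e` of `M`: the element `e` itself, and all elements
that lie in a common circuit with `e`. -/
def component (M : Matroid α) (e : α) : Set α :=
  {f | f = e ∨ ∃ C, M.IsCircuit C ∧ e ∈ C ∧ f ∈ C}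

/-- A matroid is quasi series-parallel if all its connected components are series-parallel. -/
def IsQuasiSeriesParallel (M : Matroid α) : Prop :=
  ∀ e ∈ M.E, IsSeriesParallel (M ↾ component M e)

/-- A matroid is simple if it has no loops and no circuits of size two. -/
def IsSimple (M : Matroid α) : Prop :=
  M.Loopless ∧ ∀ C, M.IsCircuit C → C.encard ≠ 2

end SeriesParallel

/-- The set `𝒮(n, r)` of simple quasi series-parallel matroids of rank `r` on the ground set `[n]`
(taken to be `Fin n`). -/
def simpleQuasiSP (n r : ℕ) : Set (Matroid (Fin n)) :=
  {M | M.E = Set.univ ∧ M.eRank = (r : ℕ∞) ∧ IsSimple M ∧ IsQuasiSeriesParallel M}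

/-- The set of simple series-parallel matroids of rank `r` on the ground set `[n]`. -/
def simpleSP (n r : ℕ) : Set (Matroid (Fin n)) :=
  {M | M.E = Set.univ ∧ M.eRank = (r : ℕ∞) ∧ IsSimple M ∧ IsSeriesParallel M}

/-- The number `E_k` of simple series-parallel matroids of rank `k + 1` on `[2k]`. -/
noncomputable def E (k : ℕ) : ℕ := (simpleSP (2 * k) (k + 1)).ncard

section CycleMatroid

variable {V : Type u}

theorem forest_augment [Finite V] {I J : Set (Sym2 V)}
    (hJE : ∀ e ∈ J, ¬ e.IsDiag)
    (hI : (SimpleGraph.fromEdgeSet I).IsAcyclic) (hJ : (SimpleGraph.fromEdgeSet J).IsAcyclic)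
    (hlt : I.ncard < J.ncard) :
    ∃ e ∈ J, e ∉ I ∧ (SimpleGraph.fromEdgeSet (insert e I)).IsAcyclic := by
  classical
  by_contra! hno
  have hne : J.Nonempty := by
    rw [Set.nonempty_iff_ne_empty]
    rintro rfl
    simp at hlt
  have : Nonempty V := by
    obtain ⟨e, -⟩ := hne
    induction e with
    | _ x y => exact ⟨x⟩
  have hreach : ∀ x y, s(x, y) ∈ J → (SimpleGraph.fromEdgeSet I).Reachable x y := by
    intro x y hxy
    by_contra hnr
    have hxI : s(x, y) ∉ I := by
      intro h
      apply hnr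
      apply SimpleGraph.Adj.reachable
      rw [SimpleGraph.fromEdgeSet_adj]
      exact ⟨h, fun h' => hJE _ hxy (by simpa using h')⟩
    refine hno _ hxy hxI ?_
    have h1 := hI.sup_edge_of_not_reachable hnr
    have h2 : SimpleGraph.fromEdgeSet (insert s(x, y) I)
        = SimpleGraph.fromEdgeSet I ⊔ SimpleGraph.edge x y := by
      rw [SimpleGraph.edge, ← SimpleGraph.fromEdgeSet_union, Set.union_comm]
      rfl
    rwa [h2]
  obtain ⟨T, hJT, -, hT⟩ := (SimpleGraph.connected_top (V := V)).exists_isTree_le_of_le_of_isAcyclic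
    (le_top (a := SimpleGraph.fromEdgeSet J)) hJ
  have hJsub : J ⊆ T.edgeSet := by
    intro e he
    have : e ∈ (SimpleGraph.fromEdgeSet J).edgeSet := by
      rw [SimpleGraph.edgeSet_fromEdgeSet]
      exact ⟨he, by simpa using hJE e he⟩
    exact SimpleGraph.edgeSet_mono hJT this
  let K := SimpleGraph.fromEdgeSet (I ∪ (T.edgeSet \ J))
  have hIK : SimpleGraph.fromEdgeSet I ≤ K := SimpleGraph.fromEdgeSet_mono Set.subset_union_left
  have hstep : ∀ x y, T.Adj x y → K.Reachable x y := by
    intro x y hxy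
    by_cases h : s(x, y) ∈ J
    · exact (hreach x y h).mono hIK
    · apply SimpleGraph.Adj.reachable
      rw [SimpleGraph.fromEdgeSet_adj]
      exact ⟨Or.inr ⟨hxy, h⟩, hxy.ne⟩
  have hwalk : ∀ x y, T.Walk x y → K.Reachable x y := by
    intro x y w
    induction w with
    | nil => exact SimpleGraph.Reachable.refl _
    | cons h _ ih => exact (hstep _ _ h).trans ih
  have hK : K.Connected := by
    refine ⟨fun x y => ?_⟩
    obtain ⟨w⟩ := hT.connected.preconnected x y
    exact hwalk x y w
  have h1 := hK.card_vert_le_card_edgeSet_add_one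
  have h2 := (SimpleGraph.isTree_iff_connected_and_card.1 hT).2
  have h3 : Nat.card K.edgeSet ≤ I.ncard + (T.edgeSet \ J).ncard := by
    rw [Nat.card_coe_set_eq]
    refine le_trans (Set.ncard_le_ncard ?_ (Set.toFinite _)) (Set.ncard_union_le _ _)
    rw [SimpleGraph.edgeSet_fromEdgeSet]
    exact Set.sdiff_subset
  have h4 := Set.ncard_sdiff_add_ncard_of_subset hJsub (Set.toFinite _)
  rw [Nat.card_coe_set_eq] at h2
  omega

/-- The cycle matroid of a finite simple graph: its elements are the edges, and a set of edges is
independent if it contains no cycle. -/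
def cycleMatroid [Finite V] (G : SimpleGraph V) : Matroid (Sym2 V) :=
  (IndepMatroid.ofFinite (E := G.edgeSet) (Set.toFinite _)
    (fun I => I ⊆ G.edgeSet ∧ (SimpleGraph.fromEdgeSet I).IsAcyclic)
    ⟨Set.empty_subset _, by
      rw [SimpleGraph.fromEdgeSet_empty]; exact SimpleGraph.isAcyclic_bot⟩
    (fun _ _ hJ hIJ =>
      ⟨hIJ.trans hJ.1, hJ.2.anti (SimpleGraph.fromEdgeSet_mono hIJ)⟩)
    (fun I J hI hJ hlt => by
      obtain ⟨e, heJ, heI, h⟩ := forest_augment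
        (fun e he => G.not_isDiag_of_mem_edgeSet (hJ.1 he)) hI.2 hJ.2 hlt
      exact ⟨e, heJ, heI, Set.insert_subset (hJ.1 heJ) hI.1, h⟩)
    (fun _ hI => hI.1)).matroid

/-- The braid matroid `K_n`: the cycle matroid of the complete graph on `n` vertices. -/
def braidMatroid (n : ℕ) : Matroid (Sym2 (Fin n)) := cycleMatroid (⊤ : SimpleGraph (Fin n))

end CycleMatroid

section KazhdanLusztig

open Polynomial

variable {α : Type u}

/-- The polynomial of degree less than `r / 2` that makes `q` palindromic with respect to
degree `r` when it is added to `q`. -/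
noncomputable def palindromicCorrection (r : ℕ) (q : ℤ[X]) : ℤ[X] :=
  ∑ i ∈ (Finset.range r).filter (fun i => 2 * i < r), C (q.coeff (r - i) - q.coeff i) * X ^ i

open Classical in
/-- The Kazhdan-Lusztig polynomial of a loopless matroid on a finite ground set, by recursion on
the size of the ground set. In rank zero it is `1`; in positive rank `r` it is the polynomial of
degree less than `r / 2` for which `∑ t ^ rk(F) P_{M / F}`, over all flats `F` (the empty one
included), is palindromic of degree `r`: see `klPoly_degree`, `natDegree_zPoly` and
`zPoly_palindromic`. -/
noncomputable def klPoly (M : Matroid α) : ℤ[X] :=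
  if M.eRank = 0 then 1
  else palindromicCorrection M.eRank.toNat
    (∑ᶠ F : {F : Set α // M.IsFlat F ∧ F.Nonempty ∧ M.E.Finite},
      X ^ (M.eRk F.1).toNat * klPoly (M ／ F.1))
termination_by M.E.ncard
decreasing_by
  obtain ⟨hF, ⟨x, hx⟩, hfin⟩ := F.2
  exact Set.ncard_lt_ncard
    ⟨Set.sdiff_subset, fun h => (h (hF.subset_ground hx)).2 hx⟩ hfin

/-- The `Z`-polynomial of a loopless matroid on a finite ground set. -/
noncomputable def zPoly (M : Matroid α) : ℤ[X] :=
  ∑ᶠ F : {F : Set α // M.IsFlat F}, X ^ (M.eRk F.1).toNat * klPoly (M ／ F.1)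

theorem coeff_palindromicCorrection (r : ℕ) (q : ℤ[X]) (i : ℕ) :
    (palindromicCorrection r q).coeff i = if 2 * i < r then q.coeff (r - i) - q.coeff i else 0 := by
  unfold palindromicCorrection
  rw [finsetSum_coeff]
  simp only [coeff_C_mul, coeff_X_pow, mul_ite, mul_one, mul_zero, Finset.sum_ite_eq,
    Finset.mem_filter, Finset.mem_range]
  by_cases h : 2 * i < r
  · rw [if_pos h, if_pos ⟨by omega, h⟩]
  · rw [if_neg h, if_neg (fun h' => h h'.2)]

theorem klPoly_of_eRank_eq_zero (M : Matroid α) (h : M.eRank = 0) : klPoly M = 1 := by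
  rw [klPoly, if_pos h]

theorem coeff_klPoly_eq_zero (M : Matroid α) (h : M.eRank ≠ 0) (i : ℕ)
    (hi : M.eRank.toNat ≤ 2 * i) : (klPoly M).coeff i = 0 := by
  rw [klPoly, if_neg h, coeff_palindromicCorrection, if_neg (by omega)]

theorem toNat_eRank_pos (M : Matroid α) [M.Finite] (h : M.eRank ≠ 0) : 0 < M.eRank.toNat := by
  rw [Nat.pos_iff_ne_zero, Ne, ENat.toNat_eq_zero]
  rintro (h' | h')
  · exact h h'
  · exact M.eRank_ne_top_iff.2 inferInstance h'

theorem klPoly_degree (M : Matroid α) [M.Finite] (h : M.eRank ≠ 0) :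
    2 * (klPoly M).natDegree < M.eRank.toNat := by
  have hr := toNat_eRank_pos M h
  by_contra! hle
  have h0 := coeff_klPoly_eq_zero M h _ hle
  rw [coeff_natDegree, leadingCoeff_eq_zero] at h0
  rw [h0, natDegree_zero] at hle
  omega

theorem toNat_eRk_add_eRank_contract (M : Matroid α) [M.Finite] {F : Set α} (hF : F ⊆ M.E) :
    (M.eRk F).toNat + (M ／ F).eRank.toNat = M.eRank.toNat := by
  obtain ⟨I, hI⟩ := M.exists_isBasis F
  obtain ⟨B, hB, hIB⟩ := hI.indep.exists_isBase_superset
  have h1 := hI.contract_sdiff_isBasis_sdiff hB.isBasis_ground hIB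
  have h2 : (M ／ F).IsBase (B \ I) := by
    rw [hI.contract_eq_contract_delete, Matroid.delete_isBase_iff, Matroid.contract_ground]
    have : (M.E \ I) \ (F \ I) = M.E \ F := by
      ext x
      have hx : x ∈ I → x ∈ F := fun hx => hI.subset hx
      simp only [Set.mem_sdiff]
      tauto
    rwa [this]
  rw [← hI.encard_eq_eRk, ← h2.encard_eq_eRank, ← hB.encard_eq_eRank]
  have hBf : B.Finite := M.ground_finite.subset hB.subset_ground
  have := Set.ncard_sdiff_add_ncard_of_subset hIB hBf
  simp only [← Set.ncard_def]
  omega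

theorem zPoly_eq (M : Matroid α) [M.Finite] [M.Loopless] (h : M.eRank ≠ 0) :
    ∃ q : ℤ[X], klPoly M = palindromicCorrection M.eRank.toNat q ∧ zPoly M = klPoly M + q ∧
      q.natDegree ≤ M.eRank.toNat ∧ q.coeff M.eRank.toNat = 1 := by
  classical
  set t : Set α → ℤ[X] := fun F => X ^ (M.eRk F).toNat * klPoly (M ／ F) with ht
  set s : Set (Set α) := {F | M.IsFlat F ∧ F.Nonempty} with hs
  have hfin : ∀ u : Set (Set α), (∀ F ∈ u, M.IsFlat F) → u.Finite := fun u hu =>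
    M.ground_finite.finite_subsets.subset fun F hF => (hu F hF).subset_ground
  have hsfin : s.Finite := hfin s fun F hF => hF.1
  have hE : M.E ∈ hsfin.toFinset := by
    rw [Set.Finite.mem_toFinset]
    refine ⟨M.ground_isFlat, ?_⟩
    rw [Set.nonempty_iff_ne_empty]
    intro h0
    apply h
    have := M.eRank_le_encard_ground
    rw [h0, Set.encard_empty] at this
    exact le_antisymm this bot_le
  have hinst : ∀ F, (M ／ F).Finite := fun F => ⟨M.ground_finite.subset Set.sdiff_subset⟩
  have hdeg : ∀ F, (klPoly (M ／ F)).natDegree ≤ (M ／ F).eRank.toNat := by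
    intro F
    have := hinst F
    by_cases h0 : (M ／ F).eRank = 0
    · rw [klPoly_of_eRank_eq_zero _ h0, natDegree_one]
      exact Nat.zero_le _
    · have := klPoly_degree (M ／ F) h0
      omega
  refine ⟨∑ᶠ F ∈ s, t F, ?_, ?_, ?_, ?_⟩
  · rw [klPoly, if_neg h]
    congr 1
    refine (finsum_subtype_eq_finsum_cond (f := t)
      (fun F => M.IsFlat F ∧ F.Nonempty ∧ M.E.Finite)).trans ?_
    refine finsum_congr fun F => ?_
    have : (M.IsFlat F ∧ F.Nonempty ∧ M.E.Finite) ↔ F ∈ s :=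
      ⟨fun h => ⟨h.1, h.2.1⟩, fun h => ⟨h.1, h.2, M.ground_finite⟩⟩
    simp only [this]
  · have h0 : (∅ : Set α) ∉ s := fun h0 => Set.not_nonempty_empty h0.2
    have h1 : {F | M.IsFlat F} = insert ∅ s := by
      ext F
      simp only [hs, Set.mem_ofPred_eq, Set.mem_insert_iff]
      constructor
      · intro hF
        rcases F.eq_empty_or_nonempty with hF' | hF'
        · exact Or.inl hF'
        · exact Or.inr ⟨hF, hF'⟩
      · rintro (rfl | hF)
        · have h2 := M.isFlat_closure (X := ∅)
          rwa [← Matroid.loops, M.loops_eq_empty] at h2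
        · exact hF.1
    have h2 : zPoly M = ∑ᶠ F ∈ {F | M.IsFlat F}, t F :=
      finsum_subtype_eq_finsum_cond (f := t) (fun F => M.IsFlat F)
    rw [h2, h1, finsum_mem_insert _ h0 hsfin]
    simp only [ht, Matroid.eRk_empty, ENat.toNat_zero, pow_zero, one_mul, Matroid.contract_empty]
  · rw [finsum_mem_eq_finite_toFinset_sum _ hsfin]
    refine natDegree_sum_le_of_forall_le _ _ fun F hF => ?_
    rw [Set.Finite.mem_toFinset] at hF
    have h1 := toNat_eRk_add_eRank_contract M hF.1.subset_ground
    refine natDegree_mul_le.trans ?_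
    rw [natDegree_X_pow, ← h1]
    exact Nat.add_le_add_left (hdeg F) _
  · rw [finsum_mem_eq_finite_toFinset_sum _ hsfin, finsetSum_coeff, Finset.sum_eq_single_of_mem _ hE]
    · have h0 : (M ／ M.E).eRank = 0 := by
        have := (M ／ M.E).eRank_le_encard_ground
        rw [Matroid.contract_ground, Set.sdiff_self, Set.encard_empty] at this
        exact le_antisymm this bot_le
      simp only [ht]
      rw [klPoly_of_eRank_eq_zero _ h0, Matroid.eRk_ground, mul_one, coeff_X_pow_self]
    · intro F hF hne
      rw [Set.Finite.mem_toFinset] at hF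
      have := hinst F
      have h1 := toNat_eRk_add_eRank_contract M hF.1.subset_ground
      have h2 : (M ／ F).eRank ≠ 0 := by
        intro h0
        obtain ⟨e, heE, heF⟩ : ∃ e ∈ M.E, e ∉ F := by
          by_contra! hall
          exact hne (hF.1.subset_ground.antisymm hall)
        obtain ⟨I, hI⟩ := M.exists_isBasis F hF.1.subset_ground
        have heI : e ∉ M.closure I := by
          rwa [hI.closure_eq_closure, hF.1.closure]
        have h3 := (hI.indep.notMem_closure_iff heE).1 heI
        have h4 := M.eRk_le_eRank (insert e I)
        rw [h3.1.eRk_eq_encard, Set.encard_insert_of_notMem h3.2, hI.encard_eq_eRk] at h4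
        have h5 := ENat.toNat_le_toNat h4 (M.eRank_ne_top_iff.2 inferInstance)
        rw [ENat.toNat_add (Matroid.eRk_ne_top_iff.2 (M.isRkFinite_set F)) (by simp)] at h5
        rw [h0] at h1
        simp only [ENat.toNat_zero, ENat.toNat_one] at h1 h5
        omega
      simp only [ht]
      rw [← h1, add_comm, coeff_X_pow_mul]
      exact coeff_klPoly_eq_zero _ h2 _ (by omega)

theorem zPoly_of_eRank_eq_zero (M : Matroid α) [M.Loopless] (h : M.eRank = 0) : zPoly M = 1 := by
  have hE : M.E = ∅ := by
    rw [← M.eRk_ground, Matroid.eRk_eq_zero_iff, M.loops_eq_empty] at h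
    exact Set.subset_empty_iff.1 h
  have hflat : ∀ F, M.IsFlat F ↔ F = ∅ := by
    intro F
    constructor
    · intro hF
      exact Set.subset_empty_iff.1 (hE ▸ hF.subset_ground)
    · rintro rfl
      exact hE ▸ M.ground_isFlat
  have h2 : zPoly M = ∑ᶠ (F : Set α) (_ : M.IsFlat F), X ^ (M.eRk F).toNat * klPoly (M ／ F) :=
    finsum_subtype_eq_finsum_cond (f := fun F => X ^ (M.eRk F).toNat * klPoly (M ／ F))
      (fun F => M.IsFlat F)
  rw [h2]
  simp only [hflat, finsum_cond_eq_left, Matroid.eRk_empty, ENat.toNat_zero, pow_zero, one_mul,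
    Matroid.contract_empty, klPoly_of_eRank_eq_zero M h]

theorem natDegree_zPoly (M : Matroid α) [M.Finite] [M.Loopless] :
    (zPoly M).natDegree = M.eRank.toNat := by
  by_cases h : M.eRank = 0
  · rw [zPoly_of_eRank_eq_zero M h, h, natDegree_one, ENat.toNat_zero]
  obtain ⟨q, -, hz, hq, hq1⟩ := zPoly_eq M h
  have hd := klPoly_degree M h
  refine natDegree_eq_of_le_of_coeff_ne_zero ?_ ?_
  · rw [hz]
    exact (natDegree_add_le _ _).trans (max_le (by omega) hq)
  · rw [hz, coeff_add, hq1, coeff_klPoly_eq_zero M h _ (by omega)]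
    norm_num

theorem zPoly_palindromic (M : Matroid α) [M.Finite] [M.Loopless] :
    (zPoly M).reverse = zPoly M := by
  by_cases h : M.eRank = 0
  · rw [zPoly_of_eRank_eq_zero M h, ← C_1, reverse_C]
  obtain ⟨q, hp, hz, hq, hq1⟩ := zPoly_eq M h
  ext i
  rw [coeff_reverse, natDegree_zPoly]
  by_cases hi : i ≤ M.eRank.toNat
  · rw [revAt_le hi, hz, coeff_add, coeff_add, hp, coeff_palindromicCorrection,
      coeff_palindromicCorrection]
    rcases lt_trichotomy (2 * i) M.eRank.toNat with h1 | h1 | h1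
    · rw [if_neg (by omega), if_pos h1]
      ring
    · simp only [show M.eRank.toNat - i = i by omega, sub_self, ite_self]
    · rw [if_pos (by omega), if_neg (by omega), Nat.sub_sub_self hi]
      ring
  · rw [revAt_eq_self_of_lt (by omega)]

end KazhdanLusztig

end SPMatroid

/-! On a finite type, the quasi series-parallel matroids are those that reduce to the empty matroid
by removing loops, coloops and one element of a parallel or series pair
(`isQuasiSeriesParallel_iff`). This class is closed under duality and minors. In a nonempty simple
member the outermost reduction must remove a coloop or an element of a series pair, and induction
gives at most `2 r - 1` elements in rank `r` (`IsSPReducible.ncard_add_one_le`).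

The count. Rank `k + 1` on `2 k` elements is one element below this bound. Ranks add over a
separator, so a disconnected matroid of this kind has exactly two components and both attain the
bound (`IsTight`); the connected ones are counted by `E k`. The disconnected ones therefore number
half the sum, over all subsets `S`, of the products of the numbers of tight matroids on `S` and on
its complement. A tight matroid with at least two elements has a series pair `{e, f}` in a triangle
`{e, f, g}`, and deleting the pair leaves a tight matroid. Hence it is built from a tree of
triangles. The tree consists of the three-element circuits (`IsTriangleTree.mem_iff`), and it
determines the flats (`IsTriangleTree.isFlat_iff`). Deleting a root from a rooted forest of triples
gives a recurrence, solved in `card_forests`; on `2 j + 1` points there are `(2 j - 1)‼ (2 j + 1) ^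
(j - 1)` trees.

The Kazhdan–Lusztig polynomial. A reducible matroid on `[m]` amounts to a partition of `[m]` with an
added point `none`, whose class holds the loops, together with a simple reducible matroid on the
other classes. Let `Q_m` be the sum of `#𝒮(m, r) X ^ (m - r)` over `r` (`simplePoly`). The sum of `X
^ (m + 1 - b) Q_{b - 1}` over the partitions of `m + 1` points, where `b` is the number of blocks,
then counts all reducible matroids on `[m]` by corank, and duality makes it palindromic. The flats
of the braid matroid on `m + 1` vertices are the partitions of the vertices, so this is the defining
sum of the Kazhdan–Lusztig polynomials with `Q` in place of `P`, and the bound `2 r - 1` is the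
degree condition. Thus `Q_m` is the polynomial sought (`klPoly_braidMatroid`), and for `m = 2 k` its
coefficient at `k - 1` counts matroids of rank `k + 1`. -/

open scoped Matroid

namespace SPMatroid

open Matroid Set

/-! ### Reducible matroids: duality, relabelling and minors. -/

section Reducible

variable {α β : Type*} {M : Matroid α} {e f : α}

/-- Matroids that can be reduced to the empty matroid by removing loops and coloops, deleting an
element of a parallel pair, and contracting an element of a series pair. -/
inductive IsSPReducible : Matroid α → Prop
  | empty : IsSPReducible (emptyOn α)
  | loop {M : Matroid α} {e : α} : M.IsLoop e → IsSPReducible (M ＼ {e}) → IsSPReducible M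
  | coloop {M : Matroid α} {e : α} : M.IsColoop e → IsSPReducible (M ／ {e}) → IsSPReducible M
  | parallel {M : Matroid α} {e f : α} : e ≠ f → M.IsCircuit {e, f} → IsSPReducible (M ＼ {e}) →
      IsSPReducible M
  | series {M : Matroid α} {e f : α} : e ≠ f → M.IsCocircuit {e, f} → IsSPReducible (M ／ {e}) →
      IsSPReducible M

theorem IsSPReducible.dual (h : IsSPReducible M) : IsSPReducible M✶ := by
  induction h with
  | empty => rw [emptyOn_dual_eq]; exact .empty
  | loop he _ ih => exact .coloop he.dual_isColoop (by rwa [dual_delete] at ih)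
  | coloop he _ ih => exact .loop he.dual_isLoop (by rwa [dual_contract] at ih)
  | parallel hne hC _ ih => exact .series hne hC.isCocircuit (by rwa [dual_delete] at ih)
  | series hne hC _ ih => exact .parallel hne hC.isCircuit (by rwa [dual_contract] at ih)

theorem IsSPReducible.dual_iff : IsSPReducible M✶ ↔ IsSPReducible M :=
  ⟨fun h => by simpa using h.dual, .dual⟩

theorem isCircuit_map {g : α → β} (hg : InjOn g M.E) {C : Set α} (hC : M.IsCircuit C) :
    (M.map g hg).IsCircuit (g '' C) := by
  rw [isCircuit_iff, map_dep_iff]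
  refine ⟨⟨C, hC.dep, rfl⟩, fun D hD hDC => ?_⟩
  obtain ⟨D₀, hD₀, rfl⟩ := map_dep_iff.1 hD
  rw [hC.eq_of_dep_subset hD₀ ((hg.image_subset_image_iff hD₀.subset_ground hC.subset_ground).1 hDC)]

theorem map_delete_singleton {g : α → β} (hg : InjOn g M.E) (he : e ∈ M.E) :
    (M.map g hg) ＼ {g e} = (M ＼ {e}).map g (hg.mono sdiff_subset) := by
  refine ext_indep ?_ fun I hI => ?_
  · simp only [delete_ground, map_ground]
    rw [hg.image_sdiff_subset (by simpa using he), image_singleton]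
  · simp only [delete_indep_iff, map_indep_iff, disjoint_singleton_right]
    constructor
    · rintro ⟨⟨J, hJ, rfl⟩, h⟩
      exact ⟨J, ⟨hJ, fun h' => h (mem_image_of_mem _ h')⟩, rfl⟩
    · rintro ⟨J, ⟨hJ, h⟩, rfl⟩
      refine ⟨⟨J, hJ, rfl⟩, ?_⟩
      rintro ⟨x, hx, hxe⟩
      exact h (hg (hJ.subset_ground hx) he hxe ▸ hx)

theorem map_contract_singleton {g : α → β} (hg : InjOn g M.E) (he : e ∈ M.E) :
    (M.map g hg) ／ {g e} = (M ／ {e}).map g (hg.mono sdiff_subset) := by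
  rw [← dual_inj, dual_contract, map_dual, map_dual, map_delete_singleton (M := M✶) hg he]
  simp only [dual_contract]

theorem IsSPReducible.map (h : IsSPReducible M) (g : α → β) (hg : InjOn g M.E) :
    IsSPReducible (M.map g hg) := by
  induction h with
  | empty => rw [map_emptyOn]; exact .empty
  | @loop M e he _ ih =>
    refine .loop (e := g e) ((map_isLoop_iff he.mem_ground).2 he) ?_
    rw [map_delete_singleton hg he.mem_ground]
    exact ih _
  | @coloop M e he _ ih =>
    refine .coloop (e := g e) ?_ ?_
    · rw [← dual_isLoop_iff_isColoop, map_dual]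
      exact (map_isLoop_iff (M := M✶) he.mem_ground).2 he
    · rw [map_contract_singleton hg he.mem_ground]
      exact ih _
  | @parallel M e f hne hC _ ih =>
    have he := hC.subset_ground (mem_insert _ _)
    have hf := hC.subset_ground (mem_insert_of_mem _ rfl)
    refine .parallel (e := g e) (f := g f) (hg.ne he hf hne) ?_ ?_
    · rw [← image_pair]
      exact isCircuit_map hg hC
    · rw [map_delete_singleton hg he]
      exact ih _
  | @series M e f hne hC _ ih =>
    have he := hC.subset_ground (mem_insert _ _)
    have hf := hC.subset_ground (mem_insert_of_mem _ rfl)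
    refine .series (e := g e) (f := g f) (hg.ne he hf hne) ?_ ?_
    · rw [← image_pair, isCocircuit_def, map_dual]
      exact isCircuit_map (M := M✶) hg hC
    · rw [map_contract_singleton hg he]
      exact ih _

theorem mem_closure_iff_of_pair (hne : e ≠ f) (hC : M.IsCircuit {e, f}) (X : Set α) :
    e ∈ M.closure X ↔ f ∈ M.closure X := by
  have he := hC.isNonloop_of_mem (nontrivial_pair hne) (mem_insert _ _)
  have h := (he.closure_eq_closure_iff_isCircuit_of_ne hne).2 hC
  have h1 : ∀ x ∈ ({e, f} : Set α), x ∈ M.closure X ↔ M.closure {x} ⊆ M.closure X := fun x hx =>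
    by rw [closure_subset_closure_iff_subset_closure (by simpa using hC.subset_ground hx),
      singleton_subset_iff]
  rw [h1 e (by simp), h1 f (by simp), h]

/-- Parallel elements lie in the same closures, so one can replace the other in any independent set.
-/
theorem delete_eq_map_swap [DecidableEq α] (hne : e ≠ f) (hC : M.IsCircuit {e, f}) :
    M ＼ {f} = (M ＼ {e}).map (Equiv.swap e f) (Equiv.injective _).injOn := by
  have he := hC.subset_ground (mem_insert _ _)
  have hf := hC.subset_ground (mem_insert_of_mem _ rfl)
  have hins : ∀ J : Set α, e ∉ J → f ∉ J → (M.Indep (insert e J) ↔ M.Indep (insert f J)) := by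
    intro J he' hf'
    rw [insert_indep_iff, insert_indep_iff, mem_sdiff, mem_sdiff,
      mem_closure_iff_of_pair hne hC]
    simp [he', hf', he, hf]
  rw [← mapEquiv_eq_map]
  have himg : ∀ I : Set α, f ∉ I → e ∈ I →
      (Equiv.swap e f) '' I = insert f (I \ {e}) := by
    intro I hfI heI
    ext x
    simp only [mem_image_equiv, Equiv.symm_swap, mem_insert_iff, mem_sdiff, mem_singleton_iff]
    rcases eq_or_ne x e with rfl | hx
    · simp [hfI, hne]
    rcases eq_or_ne x f with rfl | hx'
    · simp [heI]
    · simp [Equiv.swap_apply_of_ne_of_ne hx hx', hx, hx']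
  have himg' : ∀ I : Set α, f ∉ I → e ∉ I → (Equiv.swap e f) '' I = I := by
    intro I hfI heI
    ext x
    simp only [mem_image_equiv, Equiv.symm_swap]
    rcases eq_or_ne x e with rfl | hx
    · simp [hfI, heI]
    rcases eq_or_ne x f with rfl | hx'
    · simp [heI, hfI]
    · simp [Equiv.swap_apply_of_ne_of_ne hx hx']
  refine ext_indep ?_ fun I hI => ?_
  · simp only [delete_ground, mapEquiv_ground_eq]
    ext x
    simp only [mem_image_equiv, Equiv.symm_swap, mem_sdiff, mem_singleton_iff]
    rcases eq_or_ne x e with rfl | hx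
    · simp [hne, hne.symm, he, hf]
    rcases eq_or_ne x f with rfl | hx'
    · simp
    · simp [Equiv.swap_apply_of_ne_of_ne hx hx', hx, hx']
  · have hfI : f ∉ I := fun h => (hI h).2 rfl
    rw [mapEquiv_indep_iff, delete_indep_iff, delete_indep_iff, disjoint_singleton_right,
      disjoint_singleton_right, Equiv.symm_swap]
    by_cases heI : e ∈ I
    · rw [himg I hfI heI, ← hins _ (by simp) (by simp [hfI]), insert_sdiff_self_of_mem heI]
      simp [hfI, hne]
    · rw [himg' I hfI heI]
      simp [hfI, heI]

theorem IsSPReducible.delete_of_parallel (hne : e ≠ f) (hC : M.IsCircuit {e, f})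
    (h : IsSPReducible (M ＼ {e})) : IsSPReducible (M ＼ {f}) := by
  classical
  rw [delete_eq_map_swap hne hC]
  exact h.map _ _

theorem isLoop_contract_of_parallel (hne : e ≠ f) (hC : M.IsCircuit {e, f}) :
    (M ／ {f}).IsLoop e := by
  rw [contract_isLoop_iff_mem_closure, mem_closure_iff_of_pair hne hC]
  exact ⟨M.mem_closure_self f (hC.subset_ground (by simp)), by simpa using hne⟩

/-- Removing `x` commutes with the outermost reduction step, so induction applies unless `x` takes
part in that step. Loops and parallel pairs are treated directly; coloops and series pairs follow by
passing to the dual. In a parallel pair, contracting one element makes the other a loop, and the two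
deletions agree up to renaming. -/
theorem IsSPReducible.minor_aux (h : IsSPReducible M) (x : α) (hx : x ∈ M.E) :
    IsSPReducible (M ＼ {x}) ∧ IsSPReducible (M ／ {x}) := by
  suffices H : ∀ {M : Matroid α} {e f : α}, e ≠ f → M.IsCircuit {e, f} → IsSPReducible (M ＼ {e}) →
      (∀ x ∈ (M ＼ {e}).E, IsSPReducible (M ＼ {e} ＼ {x}) ∧ IsSPReducible (M ＼ {e} ／ {x})) →
      ∀ x ∈ M.E, IsSPReducible (M ＼ {x}) ∧ IsSPReducible (M ／ {x}) by
    have HL : ∀ {M : Matroid α} {e : α}, M.IsLoop e → IsSPReducible (M ＼ {e}) →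
      (∀ x ∈ (M ＼ {e}).E, IsSPReducible (M ＼ {e} ＼ {x}) ∧ IsSPReducible (M ＼ {e} ／ {x})) →
      ∀ x ∈ M.E, IsSPReducible (M ＼ {x}) ∧ IsSPReducible (M ／ {x}) := by
      intro M e he hM ih x hx
      rcases eq_or_ne x e with rfl | hxe
      · refine ⟨hM, ?_⟩
        rwa [contract_eq_delete_of_subset_loops (singleton_subset_iff.2 he)]
      · obtain ⟨h1, h2⟩ := ih x ⟨hx, hxe⟩
        refine ⟨.loop (e := e) ?_ ?_, .loop (e := e) ?_ ?_⟩
        · simp [he, hxe.symm]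
        · rwa [delete_comm]
        · simp [he.mem_closure, hxe.symm]
        · rwa [contract_delete_comm _ (by simpa using hxe)]
    induction h generalizing x with
    | empty => simp at hx
    | loop he hM ih => exact HL he hM ih x hx
    | @coloop M e he hM ih =>
      have := HL (M := M✶) (e := e) he (by rw [← dual_contract]; exact hM.dual) ?_ x hx
      · rw [← dual_contract, ← dual_delete, IsSPReducible.dual_iff, IsSPReducible.dual_iff] at this
        exact this.symm
      · intro x hx
        have := ih x hx
        rw [← IsSPReducible.dual_iff, ← IsSPReducible.dual_iff (M := M ／ {e} ／ {x}), dual_delete,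
          dual_contract, dual_contract, dual_contract, and_comm] at this
        exact this
    | parallel hne hC hM ih => exact H hne hC hM ih x hx
    | @series M e f hne hC hM ih =>
      have := H (M := M✶) (e := e) hne hC (by rw [← dual_contract]; exact hM.dual) ?_ x hx
      · rw [← dual_contract, ← dual_delete, IsSPReducible.dual_iff, IsSPReducible.dual_iff] at this
        exact this.symm
      · intro x hx
        have := ih x hx
        rw [← IsSPReducible.dual_iff, ← IsSPReducible.dual_iff (M := M ／ {e} ／ {x}), dual_delete,
          dual_contract, dual_contract, dual_contract, and_comm] at this
        exact this
  intro M e f hne hC hM ih x hx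
  have he := hC.subset_ground (mem_insert _ _)
  have hf := hC.subset_ground (mem_insert_of_mem _ rfl)
  have hef := isLoop_contract_of_parallel hne hC
  have hfe := isLoop_contract_of_parallel hne.symm (by rwa [pair_comm])
  rcases eq_or_ne x e with rfl | hxe
  · refine ⟨hM, .loop hfe ?_⟩
    -- The loop `f` of `M ／ {e}` is contracted instead of deleted, and then `e`, a loop of `M ／
    -- {f}`, is deleted instead of contracted. What remains is a contraction of `M ＼ {e}`.
    rw [← contract_eq_delete_of_subset_loops (singleton_subset_iff.2 hfe), contract_comm,
      contract_eq_delete_of_subset_loops (singleton_subset_iff.2 hef),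
      contract_delete_comm _ (by simpa using hne.symm)]
    exact (ih f ⟨hf, hne.symm⟩).2
  obtain ⟨h1, h2⟩ := ih x ⟨hx, hxe⟩
  rcases eq_or_ne x f with rfl | hxf
  · refine ⟨hM.delete_of_parallel hne hC, .loop hef ?_⟩
    rwa [contract_delete_comm _ (by simpa using hxe)]
  refine ⟨.parallel (e := e) (f := f) hne ?_ (by rwa [delete_comm]), ?_⟩
  · rw [delete_isCircuit_iff]
    exact ⟨hC, by simp [hxe, hxf]⟩
  have h3 : IsSPReducible (M ／ {x} ＼ {e}) := by rwa [contract_delete_comm _ (by simpa using hxe)]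
  -- After contracting `x` the pair `{e, f}` is still parallel, unless `x` spans it and `e` becomes
  -- a loop.
  by_cases hl : e ∈ M.closure {x}
  · exact .loop (e := e) (contract_isLoop_iff_mem_closure.2 ⟨hl, hxe.symm⟩) h3
  · refine .parallel (e := e) (f := f) hne ?_ h3
    have hn : (M ／ {x}).IsNonloop e := contract_isNonloop_iff.2 ⟨he, hl⟩
    rw [← hn.closure_eq_closure_iff_isCircuit_of_ne hne, contract_closure_eq, contract_closure_eq]
    have hn' := hC.isNonloop_of_mem (nontrivial_pair hne) (mem_insert _ _)
    rw [closure_union_congr_left ((hn'.closure_eq_closure_iff_isCircuit_of_ne hne).2 hC)]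

theorem IsSPReducible.delete_singleton (h : IsSPReducible M) (x : α) : IsSPReducible (M ＼ {x}) := by
  by_cases hx : x ∈ M.E
  · exact (h.minor_aux x hx).1
  · rwa [deleteElem_eq_self hx]

theorem IsSPReducible.delete (h : IsSPReducible M) {X : Set α} (hX : X.Finite) :
    IsSPReducible (M ＼ X) := by
  induction X, hX using Set.Finite.induction_on with
  | empty => simpa
  | @insert x X _ _ ih =>
    rw [← union_singleton, ← delete_delete]
    exact ih.delete_singleton x

theorem IsSPReducible.restrict [M.Finite] (h : IsSPReducible M) {X : Set α} (hX : X ⊆ M.E) :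
    IsSPReducible (M ↾ X) := by
  rw [← delete_compl hX]
  exact h.delete (M.ground_finite.subset sdiff_subset)

/-- A matroid is reducible if all elements outside of a reducible restriction are loops or parallel
to an element of that restriction. -/
theorem IsSPReducible.of_restrict [M.Finite] {R : Set α} (hR : R ⊆ M.E)
    (h : IsSPReducible (M ↾ R)) (hp : ∀ e ∈ M.E \ R, M.IsLoop e ∨ ∃ f ∈ R, M.IsCircuit {e, f}) :
    IsSPReducible M := by
  suffices H : ∀ X : Set α, X.Finite → Disjoint X R → X ⊆ M.E → IsSPReducible (M ↾ (R ∪ X)) by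
    have := H (M.E \ R) (M.ground_finite.subset sdiff_subset) disjoint_sdiff_left sdiff_subset
    rwa [union_sdiff_cancel hR, restrict_ground_eq_self] at this
  intro X hX
  induction X, hX using Set.Finite.induction_on with
  | empty => simpa
  | @insert x X hxX _ ih =>
    intro hd hE
    rw [insert_subset_iff] at hE
    rw [disjoint_insert_left] at hd
    have hs : R ∪ insert x X ⊆ M.E := union_subset hR (insert_subset hE.1 hE.2)
    have hdel : (M ↾ (R ∪ insert x X)) ＼ {x} = M ↾ (R ∪ X) := by
      rw [delete_eq_restrict, restrict_ground_eq, restrict_restrict_eq _ sdiff_subset]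
      congr 1
      ext y
      simp only [mem_sdiff, mem_union, mem_insert_iff, mem_singleton_iff]
      constructor
      · rintro ⟨h | h | h, h'⟩
        · exact Or.inl h
        · exact absurd h h'
        · exact Or.inr h
      · rintro (h | h)
        · exact ⟨Or.inl h, fun h' => hd.1 (h' ▸ h)⟩
        · exact ⟨Or.inr (Or.inr h), fun h' => hxX (h' ▸ h)⟩
    have ih' := ih hd.2 hE.2
    rw [← hdel] at ih'
    rcases hp x ⟨hE.1, hd.1⟩ with hl | ⟨f, hf, hC⟩
    · exact .loop (restrict_isLoop_iff.2 ⟨by simp, Or.inl hl⟩) ih'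
    · refine .parallel (e := x) (f := f) (fun h => hd.1 (h ▸ hf)) ?_ ih'
      exact hC.isCircuit_restrict_of_subset (by simp [insert_subset_iff, hf])

end Reducible

/-! ### Separators, components, and quasi series-parallel as reducible. -/

section Components

variable {α : Type*} {M : Matroid α} {e f : α} {S : Set α}

theorem isParallelExtension_iff {N : Matroid α} :
    IsParallelExtension M N ↔ ∃ e f, e ≠ f ∧ N.IsCircuit {e, f} ∧ N ＼ {e} = M := by
  constructor
  · rintro ⟨e, -, ⟨C, hC, h2, heC⟩, h⟩
    obtain ⟨x, y, hxy, rfl⟩ := encard_eq_two.1 h2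
    rcases heC with rfl | rfl
    · exact ⟨e, y, hxy, hC, h⟩
    · exact ⟨e, x, hxy.symm, by rwa [pair_comm], h⟩
  · rintro ⟨e, f, hne, hC, h⟩
    exact ⟨e, hC.subset_ground (by simp), ⟨_, hC, encard_pair hne, by simp⟩, h⟩

theorem isSeriesExtension_iff_dual {N : Matroid α} :
    IsSeriesExtension M N ↔ IsParallelExtension M✶ N✶ := by
  unfold IsSeriesExtension IsParallelExtension
  simp only [dual_ground, ← isCocircuit_def, ← dual_contract, dual_inj]

theorem IsSeriesParallel.dual (h : IsSeriesParallel M) : IsSeriesParallel M✶ := by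
  induction h with
  | loop e => rw [loopyOn_dual_eq]; exact .coloop e
  | coloop e => rw [freeOn_dual_eq]; exact .loop e
  | parallel _ h ih => exact .series ih (by rwa [isSeriesExtension_iff_dual, dual_dual, dual_dual])
  | series _ h ih => exact .parallel ih (isSeriesExtension_iff_dual.1 h)

theorem IsSeriesParallel.finite (h : IsSeriesParallel M) : M.Finite := by
  constructor
  induction h with
  | loop e => simp
  | coloop e => simp
  | parallel _ h ih =>
    obtain ⟨e, he, -, rfl⟩ := h
    exact (ih.insert e).subset (by simp)
  | series _ h ih =>
    obtain ⟨e, he, -, rfl⟩ := h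
    exact (ih.insert e).subset (by simp)

/-- Transitivity of lying in a common circuit, by induction on the size of `C ∪ D`. Eliminating a
common element `x` both ways gives circuits `C'` through `e` and `D'` through `f` that avoid `x`. If
`C'` contains `C \ D`, it meets `D'` and their union misses `x`. Otherwise `C'` and `D` have a
smaller union, and they meet because `C'` cannot lie properly inside `C`. -/
theorem exists_isCircuit_of_inter_nonempty [M.Finite] {C D : Set α} (hC : M.IsCircuit C)
    (hD : M.IsCircuit D) (he : e ∈ C) (hf : f ∈ D) (hCD : (C ∩ D).Nonempty) :
    ∃ K, M.IsCircuit K ∧ e ∈ K ∧ f ∈ K := by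
  have hfin : ∀ X Y, M.IsCircuit X → M.IsCircuit Y → (X ∪ Y).Finite := fun X Y hX hY =>
    M.ground_finite.subset (union_subset hX.subset_ground hY.subset_ground)
  induction hn : (C ∪ D).ncard using Nat.strong_induction_on generalizing C D with
  | _ n ih =>
    subst hn
    by_cases heD : e ∈ D
    · exact ⟨D, hD, heD, hf⟩
    by_cases hfC : f ∈ C
    · exact ⟨C, hC, he, hfC⟩
    obtain ⟨x, hxC, hxD⟩ := hCD
    obtain ⟨C', hC's, hC', heC'⟩ := hC.strong_elimination hD hxC hxD he heD
    obtain ⟨D', hD's, hD', hfD'⟩ := hD.strong_elimination hC hxD hxC hf hfC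
    have h1 : ∃ y ∈ C', y ∈ D := by
      by_contra! hno
      refine hC.not_ssubset hC' ⟨fun z hz => (hC's hz).1.resolve_right (hno z hz), fun h => ?_⟩
      exact (hC's (h hxC)).2 rfl
    by_cases h2 : C \ D ⊆ C'
    · have h3 : ∃ y ∈ D', y ∈ C \ D := by
        by_contra! hno
        refine hD.not_ssubset hD' ⟨fun z hz => ?_, fun h => (hD's (h hxD)).2 rfl⟩
        by_contra hzD
        exact hno z hz ⟨(hD's hz).1.resolve_left hzD, hzD⟩
      obtain ⟨y, hyD', hy⟩ := h3
      refine ih _ (ncard_lt_ncard ?_ (hfin C D hC hD)) hC' hD' heC' hfD' ⟨y, h2 hy, hyD'⟩ rfl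
      refine ⟨union_subset (hC's.trans sdiff_subset) ?_, fun h => ?_⟩
      · exact hD's.trans (sdiff_subset.trans (union_comm D C).subset)
      · rcases h (Or.inl hxC) with h | h
        · exact (hC's h).2 rfl
        · exact (hD's h).2 rfl
    · obtain ⟨z, hz, hzC'⟩ := not_subset.1 h2
      obtain ⟨y, hyC', hyD⟩ := h1
      refine ih _ (ncard_lt_ncard ?_ (hfin C D hC hD)) hC' hD heC' hf ⟨y, hyC', hyD⟩ rfl
      refine ⟨union_subset (hC's.trans sdiff_subset) subset_union_right, fun h => ?_⟩
      rcases h (Or.inl hz.1) with h | h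
      · exact hzC' h
      · exact hz.2 h

/-- A separator of `M` is a set of elements such that no circuit meets it and its complement. -/
def IsSeparator (M : Matroid α) (S : Set α) : Prop :=
  S ⊆ M.E ∧ ∀ C, M.IsCircuit C → C ⊆ S ∨ Disjoint C S

theorem IsSeparator.compl (h : IsSeparator M S) : IsSeparator M (M.E \ S) := by
  refine ⟨sdiff_subset, fun C hC => ?_⟩
  rcases h.2 C hC with h | h
  · exact Or.inr (disjoint_sdiff_right.mono_left h)
  · exact Or.inl (subset_sdiff.2 ⟨hC.subset_ground, h⟩)

/-- A circuit in the union of a basis of `S` and an independent set outside `S` would have to lie in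
one of the two. -/
theorem IsSeparator.contract_eq_delete (h : IsSeparator M S) : M ／ S = M ＼ S := by
  obtain ⟨J, hJ⟩ := M.exists_isBasis S h.1
  refine ext_indep rfl fun I hI => ?_
  have hd : Disjoint S I := disjoint_sdiff_right.mono_right hI
  rw [hJ.contract_indep_iff, delete_indep_iff, and_iff_left hd, and_iff_left hd.symm]
  refine ⟨fun h => h.subset subset_union_left, fun hI' => ?_⟩
  by_contra hdep
  rw [not_indep_iff (union_subset hI'.subset_ground hJ.indep.subset_ground)] at hdep
  obtain ⟨C, hCs, hC⟩ := hdep.exists_isCircuit_subset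
  rcases h.2 C hC with h | h
  · refine hC.not_indep (hJ.indep.subset fun x hx => (hCs hx).resolve_left fun hxI => ?_)
    exact hd.le_bot ⟨h hx, hxI⟩
  · refine hC.not_indep (hI'.subset fun x hx => (hCs hx).resolve_right fun hxJ => ?_)
    exact h.le_bot ⟨hx, hJ.subset hxJ⟩

/-- The set `K \ {e}` is coindependent, so some circuit meets it in `f` alone. A circuit never meets
a cocircuit in a single element, so this circuit also contains `e`. -/
theorem exists_isCircuit_of_isCocircuit {K : Set α} (hK : M.IsCocircuit K) (he : e ∈ K)
    (hf : f ∈ K) (hne : e ≠ f) : ∃ C, M.IsCircuit C ∧ C ∩ K = {e, f} := by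
  obtain ⟨C, hC, hCK⟩ := (hK.isCircuit.sdiff_singleton_indep he).exists_isCocircuit_inter_eq_mem
    (e := f) ⟨hf, hne.symm⟩
  rw [dual_isCocircuit_iff] at hC
  have hfC : f ∈ C ∩ (K \ {e}) := hCK ▸ rfl
  refine ⟨C, hC, Subset.antisymm (fun x hx => ?_) ?_⟩
  · rcases eq_or_ne x e with rfl | hxe
    · exact Or.inl rfl
    · have : x ∈ C ∩ (K \ {e}) := ⟨hx.1, hx.2, hxe⟩
      exact Or.inr (hCK ▸ this)
  · rintro x (rfl | rfl)
    · refine ⟨?_, he⟩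
      by_contra heC
      apply hC.inter_isCocircuit_ne_singleton hK (e := f)
      rw [← hCK]
      ext y
      simp only [mem_inter_iff, mem_sdiff, mem_singleton_iff]
      exact ⟨fun h => ⟨h.1, h.2, fun h' => heC (h' ▸ h.1)⟩, fun h => ⟨h.1, h.2.1⟩⟩
    · exact ⟨hfC.1, hf⟩

/-- If a cocircuit crossed `S`, a circuit through one of its elements on each side would cross `S`
as well. -/
theorem IsSeparator.dual (h : IsSeparator M S) : IsSeparator M✶ S := by
  refine ⟨h.1, fun K hK => ?_⟩
  by_contra! hno
  obtain ⟨x, hxK, hxS⟩ := not_subset.1 hno.1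
  obtain ⟨y, hyK, hyS⟩ := not_disjoint_iff.1 hno.2
  obtain ⟨C, hC, hCK⟩ := exists_isCircuit_of_isCocircuit (M := M) hK hxK hyK
    (fun h => hxS (h ▸ hyS))
  have h1 : x ∈ C ∩ K := hCK ▸ (by simp)
  have h2 : y ∈ C ∩ K := hCK ▸ (by simp)
  rcases h.2 C hC with h | h
  · exact hxS (h h1.1)
  · exact h.le_bot ⟨h2.1, hyS⟩

theorem IsSeparator.restrict_dual (h : IsSeparator M S) : (M ↾ S)✶ = M✶ ↾ S := by
  rw [← delete_compl h.1, dual_delete]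
  have h1 := h.dual.compl.contract_eq_delete
  rw [delete_compl (M := M✶) h.1] at h1
  exact h1

theorem mem_component_self (M : Matroid α) (e : α) : e ∈ component M e := Or.inl rfl

theorem component_subset_ground (he : e ∈ M.E) : component M e ⊆ M.E := by
  rintro f (rfl | ⟨C, hC, -, hf⟩)
  · exact he
  · exact hC.subset_ground hf

theorem mem_component_comm : f ∈ component M e ↔ e ∈ component M f := by
  unfold component
  simp only [Set.mem_ofPred_eq]
  constructor
  all_goals
    rintro (rfl | ⟨C, hC, h1, h2⟩)
    · exact Or.inl rfl
    · exact Or.inr ⟨C, hC, h2, h1⟩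

theorem component_isSeparator [M.Finite] (he : e ∈ M.E) : IsSeparator M (component M e) := by
  refine ⟨component_subset_ground he, fun C hC => ?_⟩
  by_cases h : Disjoint C (component M e)
  · exact Or.inr h
  obtain ⟨x, hxC, hx⟩ := not_disjoint_iff.1 h
  refine Or.inl fun y hy => ?_
  rcases hx with rfl | ⟨D, hD, heD, hxD⟩
  · exact Or.inr ⟨C, hC, hxC, hy⟩
  · exact Or.inr (exists_isCircuit_of_inter_nonempty hD hC heD hy ⟨x, hxD, hxC⟩)

theorem component_subset_of_isSeparator (h : IsSeparator M S) (he : e ∈ S) :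
    component M e ⊆ S := by
  rintro f (rfl | ⟨C, hC, heC, hf⟩)
  · exact he
  · rcases h.2 C hC with h | h
    · exact h hf
    · exact (h.le_bot ⟨heC, he⟩).elim

theorem component_eq_of_mem [M.Finite] (he : e ∈ M.E) (hf : f ∈ component M e) :
    component M f = component M e :=
  Subset.antisymm (component_subset_of_isSeparator (component_isSeparator he) hf)
    (component_subset_of_isSeparator
      (component_isSeparator (component_subset_ground he hf)) (mem_component_comm.1 hf))

theorem component_dual (M : Matroid α) (e : α) : component M✶ e = component M e := by
  have H : ∀ M : Matroid α, component M✶ e ⊆ component M e := by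
    rintro M f (rfl | ⟨K, hK, heK, hfK⟩)
    · exact Or.inl rfl
    · rcases eq_or_ne e f with rfl | hne
      · exact Or.inl rfl
      obtain ⟨C, hC, hCK⟩ := exists_isCircuit_of_isCocircuit (M := M) hK heK hfK hne
      refine Or.inr ⟨C, hC, ?_, ?_⟩
      · exact (hCK ▸ (by simp) : e ∈ C ∩ K).1
      · exact (hCK ▸ (by simp) : f ∈ C ∩ K).1
  refine (H M).antisymm ?_
  simpa using H M✶

theorem component_delete_of_notMem {X : Set α} (h : Disjoint (component M e) X) :
    component (M ＼ X) e = component M e := by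
  ext f
  unfold component
  simp only [Set.mem_ofPred_eq, delete_isCircuit_iff]
  refine or_congr_right ⟨fun ⟨C, hC, h⟩ => ⟨C, hC.1, h⟩, fun ⟨C, hC, heC, hf⟩ => ?_⟩
  refine ⟨C, ⟨hC, ?_⟩, heC, hf⟩
  exact h.mono_left fun x hx => Or.inr ⟨C, hC, heC, hx⟩

/-- The only circuit through both `e` and `f` is the pair itself, so all others through `f` survive
the deletion of `e`. -/
theorem component_of_parallel (hne : e ≠ f) (hC : M.IsCircuit {e, f}) :
    component M f = insert e (component (M ＼ {e}) f) := by
  ext x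
  unfold component
  simp only [Set.mem_ofPred_eq, delete_isCircuit_iff, mem_insert_iff, disjoint_singleton_right]
  constructor
  · rintro (rfl | ⟨D, hD, hfD, hx⟩)
    · exact Or.inr (Or.inl rfl)
    · by_cases heD : e ∈ D
      · have := hD.eq_of_superset_isCircuit hC (by simp [insert_subset_iff, heD, hfD])
        subst this
        rcases hx with rfl | rfl
        · exact Or.inl rfl
        · exact Or.inr (Or.inl rfl)
      · exact Or.inr (Or.inr ⟨D, ⟨hD, heD⟩, hfD, hx⟩)
  · rintro (rfl | rfl | ⟨D, ⟨hD, -⟩, h⟩)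
    · exact Or.inr ⟨_, hC, by simp, by simp⟩
    · exact Or.inl rfl
    · exact Or.inr ⟨D, hD, h⟩

/-- Connectedness. A parallel extension adds its new element to the component of the partner, and
series extensions follow because a matroid and its dual have the same components. -/
theorem IsSeriesParallel.component_eq (h : IsSeriesParallel M) :
    M.E.Nonempty ∧ ∀ e ∈ M.E, component M e = M.E := by
  induction h with
  | loop e =>
    refine ⟨by simp, fun x hx => (component_subset_ground hx).antisymm fun y hy => ?_⟩
    rw [loopyOn_ground, mem_singleton_iff] at hx hy
    rw [hx, hy]
    exact mem_component_self _ _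
  | coloop e =>
    refine ⟨by simp, fun x hx => (component_subset_ground hx).antisymm fun y hy => ?_⟩
    rw [freeOn_ground, mem_singleton_iff] at hx hy
    rw [hx, hy]
    exact mem_component_self _ _
  | @parallel M M' hM h ih =>
    have := (hM.parallel h).finite
    obtain ⟨e, f, hne, hC, rfl⟩ := isParallelExtension_iff.1 h
    have hf : f ∈ M'.E := hC.subset_ground (by simp)
    have he : e ∈ M'.E := hC.subset_ground (by simp)
    have h1 := component_of_parallel hne hC
    rw [ih.2 f ⟨hf, hne.symm⟩, delete_ground, insert_sdiff_singleton, insert_eq_of_mem he] at h1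
    refine ⟨⟨e, he⟩, fun x hx => ?_⟩
    rw [component_eq_of_mem hf (h1 ▸ hx), h1]
  | @series M M' hM h ih =>
    have := (hM.series h).dual.finite
    obtain ⟨e, f, hne, hC, h⟩ := isParallelExtension_iff.1 (isSeriesExtension_iff_dual.1 h)
    have hf : f ∈ M'✶.E := hC.subset_ground (by simp)
    have he : e ∈ M'✶.E := hC.subset_ground (by simp)
    have h1 := component_of_parallel hne hC
    have h2 : f ∈ (M'✶ ＼ {e}).E := ⟨hf, hne.symm⟩
    rw [h, component_dual M f, ih.2 f (by rwa [h] at h2), ← dual_ground, ← h, delete_ground,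
      insert_sdiff_singleton, insert_eq_of_mem he] at h1
    refine ⟨⟨e, he⟩, fun x hx => ?_⟩
    rw [← component_dual, component_eq_of_mem hf (h1 ▸ hx), h1, dual_ground]

theorem IsQuasiSeriesParallel.dual [M.Finite] (h : IsQuasiSeriesParallel M) :
    IsQuasiSeriesParallel M✶ := by
  intro e he
  rw [component_dual, ← (component_isSeparator (M := M) he).restrict_dual]
  exact (h e he).dual

/-- The component of `f` undergoes a parallel extension by `e`; every other component is unchanged.
-/
theorem IsQuasiSeriesParallel.of_parallel [M.Finite] (hne : e ≠ f) (hC : M.IsCircuit {e, f})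
    (h : IsQuasiSeriesParallel (M ＼ {e})) : IsQuasiSeriesParallel M := by
  have hf : f ∈ M.E := hC.subset_ground (by simp)
  intro x hx
  by_cases hxf : x ∈ component M f
  · rw [component_eq_of_mem hf hxf]
    have h1 := h f ⟨hf, hne.symm⟩
    have hef : e ∈ component M f := Or.inr ⟨_, hC, by simp, by simp⟩
    refine h1.parallel (isParallelExtension_iff.2 ⟨e, f, hne, ?_, ?_⟩)
    · refine hC.isCircuit_restrict_of_subset ?_
      simp [insert_subset_iff, hef, mem_component_self]
    · have he' : e ∉ component (M ＼ {e}) f := fun h' =>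
        (component_subset_ground (M := M ＼ {e}) ⟨hf, hne.symm⟩ h').2 rfl
      rw [component_of_parallel hne hC, delete_eq_restrict, restrict_ground_eq,
        restrict_restrict_eq _ sdiff_subset, insert_sdiff_self_of_notMem he',
        delete_eq_restrict, restrict_restrict_eq]
      exact component_subset_ground (M := M ＼ {e}) ⟨hf, hne.symm⟩
  · have hxe : e ∉ component M x := by
      intro h'
      have hfe : e ∈ component M f := Or.inr ⟨_, hC, by simp, by simp⟩
      have := component_eq_of_mem hx h'
      rw [component_eq_of_mem hf hfe] at this
      exact hxf (this ▸ mem_component_self M x)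
    have hx' : x ∈ (M ＼ {e}).E := ⟨hx, fun h' => hxe (h' ▸ mem_component_self M x)⟩
    have h1 := h x hx'
    rw [component_delete_of_notMem (by simpa using hxe), delete_eq_restrict,
      restrict_restrict_eq] at h1
    · exact h1
    · exact subset_sdiff_singleton (component_subset_ground hx) hxe

theorem IsQuasiSeriesParallel.of_loop [M.Finite] (he : M.IsLoop e)
    (h : IsQuasiSeriesParallel (M ＼ {e})) : IsQuasiSeriesParallel M := by
  intro x hx
  rcases eq_or_ne x e with rfl | hxe
  · have : component M x = {x} := by
      refine Subset.antisymm ?_ (by simp [mem_component_self])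
      rintro y (rfl | ⟨C, hC, hxC, hy⟩)
      · rfl
      · rwa [he.eq_of_isCircuit_mem hC hxC] at hy
    rw [this, restrict_subset_loops_eq (singleton_subset_iff.2 he)]
    exact .loop x
  · have hex : e ∉ component M x := by
      rintro (rfl | ⟨C, hC, hxC, hy⟩)
      · exact hxe rfl
      · rw [he.eq_of_isCircuit_mem hC hy] at hxC
        exact hxe hxC
    have h1 := h x ⟨hx, hxe⟩
    rw [component_delete_of_notMem (by simpa using hex), delete_eq_restrict,
      restrict_restrict_eq] at h1
    · exact h1
    · exact subset_sdiff_singleton (component_subset_ground hx) hex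

theorem IsSPReducible.isQuasiSeriesParallel [Finite α] (h : IsSPReducible M) :
    IsQuasiSeriesParallel M := by
  have hfin : ∀ M : Matroid α, M.Finite := fun M => ⟨M.E.toFinite⟩
  induction h with
  | empty => intro e he; simp at he
  | loop he _ ih => exact ih.of_loop he
  | @coloop M e he _ ih =>
    have := ih.dual
    rw [dual_contract] at this
    simpa using (this.of_loop he).dual
  | parallel hne hC _ ih => exact ih.of_parallel hne hC
  | @series M e f hne hC _ ih =>
    have := ih.dual
    rw [dual_contract] at this
    simpa using (this.of_parallel hne hC).dual

/-- The construction of `N` is undone inside `M`: circuits and cocircuits of the summand on a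
separator are circuits and cocircuits of `M`, so each extension step of `N` read backwards is a
reduction step of `M`. -/
theorem IsSPReducible.of_isSeparator {N : Matroid α} (hN : IsSeriesParallel N)
    {M : Matroid α} {S : Set α} (hS : IsSeparator M S) (hMS : M ↾ S = N)
    (hM : IsSPReducible (M ＼ S)) : IsSPReducible M := by
  -- One parallel step inside the summand, leaving `M ＼ S` untouched; the series case applies it to
  -- the duals.
  have hpar : ∀ {M N : Matroid α} {S : Set α}, IsSeparator M S → M ↾ S = N → ∀ {e f}, e ≠ f →
      N.IsCircuit {e, f} → e ∈ S ∧ M.IsCircuit {e, f} ∧ (M ＼ {e}) ↾ (S \ {e}) = N ＼ {e} ∧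
      IsSeparator (M ＼ {e}) (S \ {e}) ∧ M ＼ {e} ＼ (S \ {e}) = M ＼ S := by
    rintro M N S hS rfl e f hne hC
    have heS : e ∈ S := hC.subset_ground (by simp)
    rw [restrict_isCircuit_iff hS.1] at hC
    refine ⟨heS, hC.1, ?_, ⟨?_, ?_⟩, ?_⟩
    · rw [delete_eq_restrict, delete_eq_restrict, restrict_ground_eq,
        restrict_restrict_eq _ sdiff_subset,
        restrict_restrict_eq _ (sdiff_subset_sdiff_left hS.1)]
    · exact sdiff_subset_sdiff_left hS.1
    · intro C hC
      rw [delete_isCircuit_iff, disjoint_singleton_right] at hC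
      exact (hS.2 C hC.1).imp (fun h => subset_sdiff_singleton h hC.2)
        (fun h => h.mono_right sdiff_subset)
    · rw [delete_delete]
      congr 1
      simp [heS]
  induction hN generalizing M S with
  | loop e =>
    have hSe : S = {e} := by rw [← restrict_ground_eq (M := M) (R := S), hMS, loopyOn_ground]
    subst hSe
    refine .loop (e := e) ?_ hM
    have h1 : (M ↾ {e}).IsLoop e := by rw [hMS, loopyOn_isLoop_iff]; rfl
    exact (restrict_isLoop_iff.1 h1).2.resolve_right fun h => h (hS.1 rfl)
  | coloop e =>
    have hSe : S = {e} := by rw [← restrict_ground_eq (M := M) (R := S), hMS, freeOn_ground]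
    subst hSe
    refine .coloop (e := e) ?_ (by rwa [hS.contract_eq_delete])
    have h1 : (M✶ ↾ {e}).IsLoop e := by
      rw [← hS.restrict_dual, hMS, freeOn_dual_eq, loopyOn_isLoop_iff]; rfl
    exact (restrict_isLoop_iff.1 h1).2.resolve_right fun h => h (hS.1 rfl)
  | parallel _ h ih =>
    obtain ⟨e, f, hne, hC, rfl⟩ := isParallelExtension_iff.1 h
    obtain ⟨-, h1, h2, h3, h4⟩ := hpar hS hMS hne hC
    exact .parallel hne h1 (ih h3 h2 (by rwa [h4]))
  | series _ h ih =>
    obtain ⟨e, f, hne, hC, h⟩ := isParallelExtension_iff.1 (isSeriesExtension_iff_dual.1 h)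
    obtain ⟨heS, h1, h2, h3, h4⟩ := hpar hS.dual (by rw [← hS.restrict_dual, hMS]) hne hC
    rw [← dual_contract] at h2 h3 h4
    have h5 : IsSeparator (M ／ {e}) (S \ {e}) := by simpa using h3.dual
    refine .series hne h1 (ih h5 ?_ ?_)
    · rw [← dual_inj, h5.restrict_dual, h2, h]
    · rw [← h5.contract_eq_delete, contract_contract, union_sdiff_cancel (by simpa using heS),
        hS.contract_eq_delete]
      exact hM

/-- Components are reduced away one at a time. -/
theorem IsQuasiSeriesParallel.isSPReducible [Finite α] (h : IsQuasiSeriesParallel M) :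
    IsSPReducible M := by
  have hfin : ∀ M : Matroid α, M.Finite := fun M => ⟨M.E.toFinite⟩
  induction hn : M.E.ncard using Nat.strong_induction_on generalizing M with
  | _ n ih =>
    subst hn
    rcases M.E.eq_empty_or_nonempty with h0 | ⟨e, he⟩
    · rw [ground_eq_empty_iff.1 h0]
      exact .empty
    have hS := component_isSeparator he
    refine .of_isSeparator (h e he) hS rfl (ih _ (ncard_lt_ncard ?_) ?_ rfl)
    · exact ⟨sdiff_subset, fun h' => (h' he).2 (mem_component_self M e)⟩
    · intro x hx
      have h1 := component_subset_of_isSeparator hS.compl hx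
      have h2 := h x hx.1
      rw [component_delete_of_notMem (disjoint_sdiff_left.mono_left h1), delete_eq_restrict,
        restrict_restrict_eq _ h1]
      exact h2

theorem isQuasiSeriesParallel_iff [Finite α] : IsQuasiSeriesParallel M ↔ IsSPReducible M :=
  ⟨fun h => h.isSPReducible, fun h => h.isQuasiSeriesParallel⟩

theorem isSeriesParallel_iff [Finite α] :
    IsSeriesParallel M ↔ IsSPReducible M ∧ ∃ e ∈ M.E, component M e = M.E := by
  constructor
  · intro h
    obtain ⟨⟨e, he⟩, h1⟩ := h.component_eq
    refine ⟨IsQuasiSeriesParallel.isSPReducible fun x hx => ?_, e, he, h1 e he⟩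
    rwa [h1 x hx, restrict_ground_eq_self]
  · rintro ⟨h, e, he, h1⟩
    have := h.isQuasiSeriesParallel e he
    rwa [h1, restrict_ground_eq_self] at this

end Components

/-! ### The bound on the number of elements, and the matroids attaining it. -/

section Tight

variable {α : Type*} {M : Matroid α} {e f : α} {S : Set α}

theorem IsSimple.restrict (h : IsSimple M) (hS : S ⊆ M.E) : IsSimple (M ↾ S) := by
  have := h.1
  refine ⟨(restrict_isRestriction M S hS).loopless, fun C hC => ?_⟩
  exact h.2 C ((restrict_isCircuit_iff hS).1 hC).1

theorem IsSimple.delete (h : IsSimple M) (X : Set α) : IsSimple (M ＼ X) :=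
  h.restrict sdiff_subset

theorem IsSimple.not_isCircuit_pair (h : IsSimple M) (hne : e ≠ f) : ¬ M.IsCircuit {e, f} :=
  fun hC => h.2 _ hC (encard_pair hne)

theorem isSimple_iff_pair :
    IsSimple M ↔ (∀ e, ¬ M.IsLoop e) ∧ ∀ e f, e ≠ f → ¬ M.IsCircuit {e, f} := by
  constructor
  · intro h
    have := h.1
    exact ⟨M.not_isLoop, fun e f hne => h.not_isCircuit_pair hne⟩
  · rintro ⟨h1, h2⟩
    refine ⟨loopless_iff_forall_not_isLoop.2 fun e _ => h1 e, fun C hC h => ?_⟩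
    obtain ⟨x, y, hxy, rfl⟩ := encard_eq_two.1 h
    exact h2 x y hxy hC

theorem toNat_eRank_delete_coloop [M.Finite] (he : M.IsColoop e) :
    (M ＼ {e}).eRank.toNat + 1 = M.eRank.toNat := by
  have h := toNat_eRk_add_eRank_contract M (singleton_subset_iff.2 he.mem_ground)
  rw [he.isNonloop.eRk_eq, contract_eq_delete_of_subset_coloops (singleton_subset_iff.2 he)] at h
  simp only [ENat.toNat_one] at h
  omega

/-- All of `K` except one element `f` can be deleted without loss of rank, and `f` is then a coloop.
-/
theorem toNat_eRank_delete_isCocircuit [M.Finite] {K : Set α} (hK : M.IsCocircuit K) :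
    (M ＼ K).eRank.toNat + 1 = M.eRank.toNat := by
  obtain ⟨f, hf⟩ := hK.nonempty
  have h1 := hK.delete_sdiff_isCocircuit (singleton_subset_iff.2 hf) (singleton_nonempty f)
  rw [singleton_isCocircuit] at h1
  have h2 := toNat_eRank_delete_coloop h1
  have h3 : M.Coindep (K \ {f}) := hK.isCircuit.sdiff_singleton_indep hf
  rw [delete_delete, sdiff_union_of_subset (singleton_subset_iff.2 hf)] at h2
  rw [h2, delete_eq_restrict, h3.compl_spanning.eRank_restrict]

theorem IsSeparator.toNat_eRank [M.Finite] (h : IsSeparator M S) :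
    (M ↾ S).eRank.toNat + (M ＼ S).eRank.toNat = M.eRank.toNat := by
  have h1 := toNat_eRk_add_eRank_contract M h.1
  rwa [h.contract_eq_delete] at h1

/-- A loop of `M ／ {e}` would be parallel to `e` in `M`. So the contraction has a parallel pair, and
this lifts to a circuit which must use `e`. -/
theorem exists_isCircuit_contract_of_not_simple (h : IsSimple M)
    (h' : ¬ IsSimple (M ／ {e})) :
    ∃ x y, x ≠ y ∧ x ≠ e ∧ y ≠ e ∧ M.IsCircuit {e, x, y} := by
  have := h.1
  have hnl : ∀ x, ¬ (M ／ {e}).IsLoop x := by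
    intro x hx
    rw [contract_isLoop_iff_mem_closure] at hx
    have hxn : M.IsNonloop x := isNonloop_of_loopless (M.mem_ground_of_mem_closure hx.1)
    refine h.not_isCircuit_pair hx.2 ?_
    rw [← hxn.closure_eq_closure_iff_isCircuit_of_ne hx.2]
    exact hxn.closure_eq_of_mem_closure hx.1
  rw [isSimple_iff_pair] at h'
  push Not at h'
  obtain ⟨x, y, hxy, hC⟩ := h' hnl
  have hxe : x ≠ e := (hC.subset_ground (by simp) : x ∈ M.E \ {e}).2
  have hye : y ≠ e := (hC.subset_ground (by simp) : y ∈ M.E \ {e}).2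
  refine ⟨x, y, hxy, hxe, hye, ?_⟩
  obtain ⟨C', hC', h1, h2⟩ := hC.exists_subset_isCircuit_of_contract
  have heC : e ∈ C' := by
    by_contra heC
    have : C' = {x, y} := Subset.antisymm (fun z hz => (h2 hz).resolve_right fun hze =>
      heC (hze ▸ hz)) h1
    exact h.not_isCircuit_pair hxy (this ▸ hC')
  have : C' = {e, x, y} := by
    refine Subset.antisymm (h2.trans ?_) (insert_subset heC h1)
    rw [union_singleton]
  exact this ▸ hC'

/-- Simplicity rules out loops and parallel pairs as the outermost step. Some circuit meets a series
pair in exactly `{e, f}`, and it has a further element since `M` is simple; hence the deletion of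
the pair is nonempty. -/
theorem IsSPReducible.cases_of_simple [M.Finite] (h : IsSPReducible M) (hs : IsSimple M)
    (hE : M.E.Nonempty) : (∃ e, M.IsColoop e ∧ IsSPReducible (M ＼ {e})) ∨
    ∃ e f, e ≠ f ∧ M.IsCocircuit {e, f} ∧ IsSPReducible (M ／ {e}) ∧
      IsSPReducible (M ＼ {e, f}) ∧ (M ＼ {e, f}).E.Nonempty := by
  have hM := h
  have hsp := isSimple_iff_pair.1 hs
  cases h with
  | empty => simp at hE
  | loop he _ => exact absurd he (hsp.1 _)
  | @coloop _ e he h =>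
    refine Or.inl ⟨_, he, ?_⟩
    rwa [← contract_eq_delete_of_subset_coloops (singleton_subset_iff.2 he)]
  | parallel hne hC _ => exact absurd hC (hsp.2 _ _ hne)
  | @series _ e f hne hC h =>
    refine Or.inr ⟨e, f, hne, hC, h, hM.delete (by simp), ?_⟩
    rw [nonempty_iff_ne_empty]
    intro h0
    obtain ⟨C, hC', hCK⟩ := exists_isCircuit_of_isCocircuit hC (e := e) (f := f)
      (by simp) (by simp) hne
    have : C = {e, f} := by
      rw [← hCK, inter_eq_left.2]
      exact hC'.subset_ground.trans (sdiff_eq_empty.1 h0)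
    exact hsp.2 e f hne (this ▸ hC')

theorem ncard_delete_pair [M.Finite] (hne : e ≠ f) (h : {e, f} ⊆ M.E) :
    (M ＼ {e, f}).E.ncard + 2 = M.E.ncard := by
  rw [delete_ground, ← ncard_sdiff_add_ncard_of_subset h M.ground_finite, ncard_pair hne]

theorem ncard_delete_singleton [M.Finite] (h : e ∈ M.E) :
    (M ＼ {e}).E.ncard + 1 = M.E.ncard :=
  ncard_sdiff_singleton_add_one h M.ground_finite

/-- A nonempty simple series-parallel reducible matroid of rank `r` has at most `2 r - 1` elements. -/
theorem IsSPReducible.ncard_add_one_le [M.Finite] (h : IsSPReducible M) (hs : IsSimple M)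
    (hE : M.E.Nonempty) : M.E.ncard + 1 ≤ 2 * M.eRank.toNat := by
  induction hn : M.E.ncard using Nat.strong_induction_on generalizing M with
  | _ n ih =>
    subst hn
    rcases h.cases_of_simple hs hE with ⟨e, he, h1⟩ | ⟨e, f, hne, hC, -, h1, h2⟩
    · have h3 := toNat_eRank_delete_coloop he
      have h4 := ncard_delete_singleton he.mem_ground
      rcases (M ＼ {e}).E.eq_empty_or_nonempty with h0 | h0
      · rw [h0, ncard_empty] at h4
        omega
      · have := ih _ (by omega) h1 (hs.delete _) h0 rfl
        omega
    -- Deleting the whole series pair costs two elements and one unit of rank, and keeps the matroid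
    -- simple, which contracting `e` need not do.
    · have h3 := toNat_eRank_delete_isCocircuit hC
      have h4 := ncard_delete_pair hne hC.subset_ground
      have := ih _ (by omega) h1 (hs.delete _) h2 rfl
      omega

/-- Simple series-parallel reducible matroids with the largest possible number of elements for
their rank. -/
structure IsTight (M : Matroid α) : Prop where
  simple : IsSimple M
  reducible : IsSPReducible M
  ncard_add_one : M.E.ncard + 1 = 2 * M.eRank.toNat

/-- Removing a coloop would break the bound, so there is a series pair `{e, f}`. If `M ／ {e}` were
simple it would have one element too many for its rank, so `e` lies in a triangle. A circuit cannot
meet `{e, f}` in `e` alone, so the triangle contains `f`. -/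
theorem IsTight.exists_triangle [M.Finite] (h : IsTight M) (h2 : 2 ≤ M.E.ncard) :
    ∃ e f g, e ≠ f ∧ g ≠ e ∧ g ≠ f ∧ M.IsCocircuit {e, f} ∧ M.IsCircuit {e, f, g} ∧
      IsTight (M ＼ {e, f}) := by
  have hE : M.E.Nonempty := nonempty_of_ncard_ne_zero (by omega)
  have hn := h.ncard_add_one
  rcases h.reducible.cases_of_simple h.simple hE with ⟨e, he, h1⟩ | ⟨e, f, hne, hC, h0, h1, h2⟩
  · have h3 := toNat_eRank_delete_coloop he
    have h4 := ncard_delete_singleton he.mem_ground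
    have := h1.ncard_add_one_le (h.simple.delete _) (nonempty_of_ncard_ne_zero (by omega))
    omega
  · have h3 := toNat_eRank_delete_isCocircuit hC
    have h4 := ncard_delete_pair hne hC.subset_ground
    have he : e ∈ M.E := hC.subset_ground (by simp)
    have := h.simple.1
    have hns : ¬ IsSimple (M ／ {e}) := by
      intro hs
      have h5 := h0.ncard_add_one_le hs ⟨f, hC.subset_ground (by simp), hne.symm⟩
      have h6 := toNat_eRk_add_eRank_contract M (singleton_subset_iff.2 he)
      rw [(isNonloop_of_loopless he).eRk_eq, ENat.toNat_one] at h6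
      have h7 := ncard_delete_singleton he
      rw [delete_ground, ← contract_ground] at h7
      omega
    obtain ⟨x, y, hxy, hxe, hye, hT⟩ := exists_isCircuit_contract_of_not_simple h.simple hns
    have hf : f = x ∨ f = y := by
      by_contra! hno
      apply hT.inter_isCocircuit_ne_singleton hC (e := e)
      ext z
      simp only [mem_inter_iff, mem_insert_iff, mem_singleton_iff]
      constructor
      · rintro ⟨h5, h6 | h6⟩
        · exact h6
        · subst h6
          simp [hne.symm, hno.1, hno.2] at h5
      · rintro rfl
        simp
    have ht : IsTight (M ＼ {e, f}) := ⟨h.simple.delete _, h1, by omega⟩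
    rcases hf with rfl | rfl
    · exact ⟨e, f, y, hne, hye, hxy.symm, hC, hT, ht⟩
    · exact ⟨e, f, x, hne, hxe, hxy, hC, by rwa [pair_comm x f] at hT, ht⟩

/-- The bound holds on both sides and the ranks add up, so a separator costs one more element;
equality forces it on each side. -/
theorem IsSeparator.ncard_add_two_le [M.Finite] (hS : IsSeparator M S) (h : IsSPReducible M)
    (hs : IsSimple M) (h1 : S.Nonempty) (h2 : (M.E \ S).Nonempty) :
    M.E.ncard + 2 ≤ 2 * M.eRank.toNat ∧ (M.E.ncard + 2 = 2 * M.eRank.toNat →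
      IsTight (M ↾ S) ∧ IsTight (M ＼ S)) := by
  have hr := hS.toNat_eRank
  have : (M ↾ S).Finite := restrict_finite (M.ground_finite.subset hS.1)
  have : (M ↾ (M.E \ S)).Finite := restrict_finite (M.ground_finite.subset sdiff_subset)
  have h3 := (h.restrict hS.1).ncard_add_one_le (hs.restrict hS.1) h1
  have h4 := (h.restrict sdiff_subset).ncard_add_one_le (hs.delete S) h2
  have h5 := ncard_sdiff_add_ncard_of_subset hS.1 M.ground_finite
  rw [restrict_ground_eq] at h3 h4
  have h6 : (M ↾ (M.E \ S)).eRank = (M ＼ S).eRank := rfl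
  rw [h6] at h4
  refine ⟨by omega, fun h7 => ⟨⟨hs.restrict hS.1, h.restrict hS.1, ?_⟩,
    ⟨hs.delete S, h.restrict sdiff_subset, ?_⟩⟩⟩
  · rw [restrict_ground_eq]
    omega
  · rw [delete_ground]
    omega

theorem IsTight.eq_of_isSeparator [M.Finite] (h : IsTight M) (hS : IsSeparator M S)
    (hS0 : S.Nonempty) : S = M.E := by
  by_contra hne
  have h2 : (M.E \ S).Nonempty := by
    rw [nonempty_iff_ne_empty, Ne, sdiff_eq_empty]
    exact fun h' => hne (hS.1.antisymm h')
  have := (hS.ncard_add_two_le h.reducible h.simple hS0 h2).1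
  have := h.ncard_add_one
  omega

theorem IsTight.ground_nonempty [M.Finite] (h : IsTight M) : M.E.Nonempty := by
  rw [nonempty_iff_ne_empty]
  intro h0
  have := h.ncard_add_one
  rw [h0, ncard_empty] at this
  omega

theorem IsTight.isSeriesParallel [Finite α] (h : IsTight M) : IsSeriesParallel M := by
  have : M.Finite := ⟨M.E.toFinite⟩
  obtain ⟨e, he⟩ := h.ground_nonempty
  exact isSeriesParallel_iff.2 ⟨h.reducible, e, he,
    h.eq_of_isSeparator (component_isSeparator he) ⟨e, mem_component_self M e⟩⟩

theorem isSeparator_disjointSum {M N : Matroid α} (h : Disjoint M.E N.E) :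
    IsSeparator (M.disjointSum N h) M.E ∧ (M.disjointSum N h) ↾ M.E = M ∧
      (M.disjointSum N h) ＼ M.E = N := by
  have h1 : (M.disjointSum N h) ↾ M.E = M := by
    refine ext_indep rfl fun I (hI : I ⊆ M.E) => ?_
    rw [restrict_indep_iff, disjointSum_indep_iff, and_iff_left hI, inter_eq_left.2 hI,
      (h.mono_left hI).inter_eq]
    simp [hI.trans subset_union_left]
  have h2 : (M.disjointSum N h) ＼ M.E = N := by
    refine ext_indep ?_ fun I hI => ?_
    · rw [delete_ground, disjointSum_ground_eq, union_sdiff_left, h.symm.sdiff_eq_left]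
    · rw [delete_ground, disjointSum_ground_eq, union_sdiff_left, h.symm.sdiff_eq_left] at hI
      have hd : Disjoint I M.E := (h.mono_right hI).symm
      rw [delete_indep_iff, disjointSum_indep_iff, inter_eq_left.2 hI, hd.inter_eq]
      simp [hI.trans subset_union_right, hd]
  refine ⟨⟨by simp, fun C hC => ?_⟩, h1, h2⟩
  by_contra! hno
  have hCE := hC.subset_ground
  rw [disjointSum_ground_eq] at hCE
  obtain ⟨x, hxC, hx⟩ := not_disjoint_iff.1 hno.2
  obtain ⟨y, hyC, hy⟩ := not_subset.1 hno.1
  have i1 : (M.disjointSum N h).Indep (C ∩ M.E) := hC.ssubset_indep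
    ⟨inter_subset_left, fun h' => hy (h' hyC).2⟩
  have i2 : (M.disjointSum N h).Indep (C ∩ N.E) := hC.ssubset_indep
    ⟨inter_subset_left, fun h' => h.le_bot ⟨hx, (h' hxC).2⟩⟩
  apply hC.not_indep
  rw [disjointSum_indep_iff] at i1 i2 ⊢
  refine ⟨?_, ?_, hCE⟩
  · have := i1.1
    rwa [inter_assoc, inter_self] at this
  · have := i2.2.1
    rwa [inter_assoc, inter_self] at this

theorem IsSeparator.indep_iff (h : IsSeparator M S) {I : Set α} :
    M.Indep I ↔ (M ↾ S).Indep (I ∩ S) ∧ (M ＼ S).Indep (I \ S) := by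
  rw [restrict_indep_iff, delete_indep_iff]
  simp only [inter_subset_right, and_true, disjoint_sdiff_left]
  refine ⟨fun hI => ⟨hI.subset inter_subset_left, hI.subset sdiff_subset⟩, fun ⟨h1, h2⟩ => ?_⟩
  have hI : I ⊆ M.E := by
    rw [← inter_union_sdiff I S]
    exact union_subset h1.subset_ground h2.subset_ground
  rw [indep_iff_forall_subset_not_isCircuit hI]
  intro C hC hC'
  rcases h.2 C hC' with h3 | h3
  · exact hC'.not_indep (h1.subset (subset_inter hC h3))
  · exact hC'.not_indep (h2.subset (subset_sdiff.2 ⟨hC, h3⟩))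

theorem IsSeparator.ext {N : Matroid α} (hM : IsSeparator M S) (hN : IsSeparator N S)
    (h1 : M ↾ S = N ↾ S) (h2 : M ＼ S = N ＼ S) : M = N := by
  refine ext_indep ?_ fun I _ => ?_
  · have := congr_arg Matroid.E h2
    rw [delete_ground, delete_ground] at this
    rw [← union_sdiff_cancel hM.1, this, union_sdiff_cancel hN.1]
  · rw [hM.indep_iff, hN.indep_iff, h1, h2]

/-- Converse to the equality case of `IsSeparator.ncard_add_two_le`. -/
theorem IsTight.disjointSum [Finite α] {M N : Matroid α} (h : Disjoint M.E N.E) (hM : IsTight M)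
    (hN : IsTight N) : IsSimple (M.disjointSum N h) ∧ IsSPReducible (M.disjointSum N h) ∧
      (M.disjointSum N h).E.ncard + 2 = 2 * (M.disjointSum N h).eRank.toNat := by
  have hfin : ∀ M : Matroid α, M.Finite := fun M => ⟨M.E.toFinite⟩
  obtain ⟨hS, h1, h2⟩ := isSeparator_disjointSum h
  refine ⟨isSimple_iff_pair.2 ?_, .of_isSeparator hM.isSeriesParallel hS h1
    (h2.symm ▸ hN.reducible), ?_⟩
  · have hC : ∀ C, (M.disjointSum N h).IsCircuit C → M.IsCircuit C ∨ N.IsCircuit C := by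
      intro C hC
      rcases hS.2 C hC with h3 | h3
      · left
        rw [← h1, restrict_isCircuit_iff hS.1]
        exact ⟨hC, h3⟩
      · right
        rw [← h2, delete_isCircuit_iff]
        exact ⟨hC, h3⟩
    have h3 := isSimple_iff_pair.1 hM.simple
    have h4 := isSimple_iff_pair.1 hN.simple
    refine ⟨fun e he => ?_, fun e f hne hef => ?_⟩
    · rw [← singleton_isCircuit] at he
      rcases hC _ he with h5 | h5
      · exact h3.1 e (singleton_isCircuit.1 h5)
      · exact h4.1 e (singleton_isCircuit.1 h5)
    · exact (hC _ hef).elim (h3.2 e f hne) (h4.2 e f hne)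
  · have hr := hS.toNat_eRank
    rw [h1, h2] at hr
    have := hM.ncard_add_one
    have := hN.ncard_add_one
    rw [disjointSum_ground_eq, ncard_union_eq h (toFinite _) (toFinite _)]
    omega

end Tight

/-! ### Pairings and rooted forests of triples. -/

section Hyperforests

variable {α : Type*} [DecidableEq α] {S V W K : Finset α} {H P : Finset (Finset α)} {s : α}

/-- `P` is a partition of `K` into pairs. -/
inductive IsPairing : Finset α → Finset (Finset α) → Prop
  | empty : IsPairing ∅ ∅
  | addPair {K : Finset α} {P : Finset (Finset α)} {e f : α} : IsPairing K P → e ∉ K → f ∉ K →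
      e ≠ f → IsPairing (insert e (insert f K)) (insert {e, f} P)

theorem IsPairing.subset (h : IsPairing K P) : ∀ p ∈ P, p ⊆ K := by
  induction h with
  | empty => simp
  | @addPair K P e f _ he hf hne ih =>
    intro p hp
    rcases Finset.mem_insert.1 hp with rfl | hp
    · intro x
      simp only [Finset.mem_insert, Finset.mem_singleton]
      tauto
    · exact (ih p hp).trans ((Finset.subset_insert _ _).trans (Finset.subset_insert _ _))

theorem IsPairing.exists_pair (h : IsPairing K P) {k : α} (hk : k ∈ K) :
    ∃ l ∈ K.erase k, ∃ Q, IsPairing ((K.erase k).erase l) Q ∧ P = insert {k, l} Q := by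
  induction h with
  | empty => simp at hk
  | @addPair K P e f hP he hf hne ih =>
    rcases Finset.mem_insert.1 hk with rfl | hk
    · refine ⟨f, by simp [hne.symm], P, ?_, rfl⟩
      rwa [Finset.erase_insert (by simp [hne, he]), Finset.erase_insert hf]
    rcases Finset.mem_insert.1 hk with rfl | hk
    · refine ⟨e, by simp [hne], P, ?_, by rw [Finset.pair_comm]⟩
      rwa [Finset.erase_right_comm, Finset.erase_insert (by simp [hne, he]), Finset.erase_insert hf]
    · obtain ⟨l, hl, Q, hQ, rfl⟩ := ih hk
      have hl' := Finset.mem_erase.1 hl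
      have h1 : e ≠ k := fun h => he (h ▸ hk)
      have h2 : f ≠ k := fun h => hf (h ▸ hk)
      have h3 : e ≠ l := fun h => he (h ▸ hl'.2)
      have h4 : f ≠ l := fun h => hf (h ▸ hl'.2)
      refine ⟨l, by simp [hl'.1, hl'.2], insert {e, f} Q, ?_, Finset.insert_comm _ _ _⟩
      have h5 := hQ.addPair (e := e) (f := f) (by simp [he]) (by simp [hf]) hne
      rwa [Finset.erase_insert_of_ne h1, Finset.erase_insert_of_ne h2,
        Finset.erase_insert_of_ne h3, Finset.erase_insert_of_ne h4]

open Classical in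
/-- The set of all partitions of `K` into pairs. -/
noncomputable def pairings (K : Finset α) : Finset (Finset (Finset α)) :=
  K.powerset.powerset.filter (IsPairing K)

theorem mem_pairings : P ∈ pairings K ↔ IsPairing K P := by
  classical
  simp only [pairings, Finset.mem_filter, Finset.mem_powerset, and_iff_right_iff_imp]
  exact fun h p hp => Finset.mem_powerset.2 (h.subset p hp)

/-- Pairings are sorted by the partner `l` of the fixed element `k`. -/
theorem card_pairings_eq_sum {k : α} (hk : k ∈ K) :
    (pairings K).card = ∑ l ∈ K.erase k, (pairings ((K.erase k).erase l)).card := by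
  rw [← Finset.card_sigma]
  symm
  have hkn : ∀ {l Q}, IsPairing ((K.erase k).erase l) Q → ∀ p ∈ Q, k ∉ p := fun h p hp hkp => by
    have := h.subset p hp hkp
    simp at this
  refine Finset.card_bij (fun x _ => insert {k, x.1} x.2) ?_ ?_ ?_
  · rintro ⟨l, Q⟩ hx
    simp only [Finset.mem_sigma, mem_pairings] at hx ⊢
    have hl := Finset.mem_erase.1 hx.1
    have := hx.2.addPair (e := k) (f := l) (by simp) (by simp) hl.1.symm
    rwa [Finset.insert_erase hx.1, Finset.insert_erase hk] at this
  · rintro ⟨l, Q⟩ hx ⟨l', Q'⟩ hx' h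
    simp only [Finset.mem_sigma, mem_pairings] at hx hx' h
    have h1 : ({k, l} : Finset α) = {k, l'} := by
      have : {k, l} ∈ insert {k, l'} Q' := h ▸ Finset.mem_insert_self _ _
      exact (Finset.mem_insert.1 this).resolve_right fun h' => hkn hx'.2 _ h' (by simp)
    have h2 : l = l' := by
      have h3 : l ∈ ({k, l'} : Finset α) := h1 ▸ (by simp)
      simp only [Finset.mem_insert, Finset.mem_singleton] at h3
      exact h3.resolve_left (Finset.mem_erase.1 hx.1).1
    subst h2
    have h4 : ∀ {Q}, IsPairing ((K.erase k).erase l) Q → (insert {k, l} Q).erase {k, l} = Q :=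
      fun hQ => Finset.erase_insert fun h' => hkn hQ _ h' (by simp)
    have : Q = Q' := by rw [← h4 hx.2, h, h4 hx'.2]
    rw [this]
  · intro P hP
    obtain ⟨l, hl, Q, hQ, rfl⟩ := (mem_pairings.1 hP).exists_pair hk
    exact ⟨⟨l, Q⟩, Finset.mem_sigma.2 ⟨hl, mem_pairings.2 hQ⟩, rfl⟩

theorem card_pairings (K : Finset α) :
    (pairings K).card = if Even K.card then Nat.doubleFactorial (K.card - 1) else 0 := by
  induction hn : K.card using Nat.strong_induction_on generalizing K with
  | _ n ih =>
    subst hn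
    rcases K.eq_empty_or_nonempty with rfl | ⟨k, hk⟩
    · have : pairings (∅ : Finset α) = {∅} := by
        ext P
        rw [mem_pairings, Finset.mem_singleton]
        constructor
        · intro h
          generalize hK : (∅ : Finset α) = K at h
          cases h with
          | empty => rfl
          | addPair => exact absurd hK.symm (Finset.insert_ne_empty _ _)
        · rintro rfl
          exact .empty
      rw [this]
      simp
    have hc := Finset.card_erase_add_one hk
    rw [card_pairings_eq_sum hk, Finset.sum_congr rfl (fun l hl => ih _ ?_ _ rfl)]
    · rcases (K.erase k).eq_empty_or_nonempty with h0 | ⟨l, hl⟩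
      · have : K.card = 1 := by rw [← hc, h0, Finset.card_empty]
        rw [h0, this]
        simp
      have hc' : ∀ l ∈ K.erase k, ((K.erase k).erase l).card = K.card - 2 := fun l hl => by
        have := Finset.card_erase_add_one hl
        omega
      rw [Finset.sum_congr rfl (fun l hl => by rw [hc' l hl]), Finset.sum_const, smul_eq_mul]
      have h2 := Finset.card_erase_add_one hl
      obtain ⟨c, hc2⟩ : ∃ c, K.card = c + 2 := ⟨K.card - 2, by omega⟩
      have h3 : (K.erase k).card = c + 1 := by omega
      rw [hc2, h3]
      simp only [Nat.add_sub_cancel, Nat.even_add_one, not_not]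
      split_ifs with h
      -- For two elements, the truncated `0 - 1 = 0` and `0‼ = 1` stand in for `(-1)‼ = 1`.
      · rcases c with _ | c
        · rfl
        · rw [show c + 1 + 2 - 1 = c + 2 by omega, Nat.doubleFactorial_add_two]
          rfl
      · rfl
    · have := Finset.card_erase_add_one hl
      omega

/-- `H` is a set of triples that form a forest on the vertex set `V` such that every component
contains exactly one of the roots in `S`. -/
inductive IsForest (S : Finset α) : Finset α → Finset (Finset α) → Prop
  | roots : IsForest S S ∅
  | addTriple {V : Finset α} {H : Finset (Finset α)} {e f g : α} : IsForest S V H → g ∈ V → e ∉ V →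
      f ∉ V → e ≠ f → IsForest S (insert e (insert f V)) (insert {e, f, g} H)

theorem IsForest.roots_subset (h : IsForest S V H) : S ⊆ V := by
  induction h with
  | roots => exact Finset.Subset.refl _
  | addTriple _ _ _ _ _ ih => exact ih.trans ((Finset.subset_insert _ _).trans (Finset.subset_insert _ _))

theorem IsForest.subset (h : IsForest S V H) : ∀ t ∈ H, t ⊆ V := by
  induction h with
  | roots => simp
  | @addTriple V H e f g _ hg he hf hne ih =>
    intro t ht
    rcases Finset.mem_insert.1 ht with rfl | ht
    · intro x
      simp only [Finset.mem_insert, Finset.mem_singleton]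
      rintro (h | h | rfl)
      · exact Or.inl h
      · exact Or.inr (Or.inl h)
      · exact Or.inr (Or.inr hg)
    · exact (ih t ht).trans ((Finset.subset_insert _ _).trans (Finset.subset_insert _ _))

/-- The forest `H₀` is grown first and `H'` afterwards, starting from vertices already present; `hV`
ensures that its other vertices are new. -/
theorem IsForest.comp {W' V' : Finset α} {H₀ H' : Finset (Finset α)} (h₀ : IsForest S W H₀)
    (h : IsForest W' V' H') (hW : W' ⊆ W) (hV : V' ∩ W = W') :
    IsForest S (V' ∪ W) (H' ∪ H₀) := by
  induction h with
  | roots => rwa [Finset.union_eq_right.2 hW, Finset.empty_union]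
  | @addTriple V' H' e f g h hg he hf hne ih =>
    have hs := h.roots_subset
    have he' : e ∉ W := fun heW => he (hs (hV ▸ (by simp [heW])))
    have hf' : f ∉ W := fun hfW => hf (hs (hV ▸ (by simp [hfW])))
    have := ih ?_
    · rw [Finset.insert_union, Finset.insert_union, Finset.insert_union]
      exact this.addTriple (by simp [hg]) (by simp [he, he']) (by simp [hf, hf']) hne
    · rwa [Finset.insert_inter_of_notMem he', Finset.insert_inter_of_notMem hf'] at hV

theorem IsForest.union_roots {T : Finset α} (h : IsForest S V H) (hT : Disjoint V T) :
    IsForest (S ∪ T) (V ∪ T) H := by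
  have h1 := IsForest.comp (IsForest.roots (S := S ∪ T)) h Finset.subset_union_left ?_
  · rwa [Finset.union_empty, ← Finset.union_assoc, Finset.union_eq_left.2 h.roots_subset] at h1
  · rw [Finset.inter_union_distrib_left, Finset.disjoint_iff_inter_eq_empty.1 hT,
      Finset.union_empty, Finset.inter_eq_right.2 h.roots_subset]

/-- Tight matroids have no distinguished element, so being a tree must not depend on the root. If
the new root is `e` in the last triple `{e, f, g}`, start with that triple and attach the old tree,
itself rerooted at `g`. -/
theorem IsForest.reroot {x y : α} (h : IsForest {x} V H) (hy : y ∈ V) : IsForest {y} V H := by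
  induction h generalizing y with
  | roots => rw [Finset.mem_singleton.1 hy]; exact .roots
  | @addTriple V H e f g h hg he hf hne ih =>
    have key : ∀ {e f : α}, e ∉ V → f ∉ V → e ≠ f →
        IsForest {e} (insert e (insert f V)) (insert {e, f, g} H) := by
      intro e f he hf hne
      have hge : g ≠ e := fun h => he (h ▸ hg)
      have hgf : g ≠ f := fun h => hf (h ▸ hg)
      have h1 := (IsForest.roots (S := {e})).addTriple (e := f) (f := g) (g := e) (by simp)
        (by simp [hne.symm]) (by simp [hge]) hgf.symm
      have h2 := h1.comp (ih hg) (by simp) ?_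
      · convert h2 using 1
        · ext z
          simp only [Finset.mem_insert, Finset.mem_union, Finset.mem_singleton]
          constructor
          · tauto
          · rintro (h | h | rfl | h)
            · tauto
            · tauto
            · tauto
            · tauto
        · ext t
          have : ({e, f, g} : Finset α) = {f, g, e} := by ext z; simp; tauto
          simp only [Finset.mem_insert, Finset.mem_union, Finset.notMem_empty, or_false, this]
          tauto
      · ext z
        simp only [Finset.mem_inter, Finset.mem_insert, Finset.mem_singleton]
        constructor
        · rintro ⟨hz, rfl | rfl | rfl⟩
          · exact absurd hz hf
          · rfl
          · exact absurd hz he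
        · rintro rfl
          simp [hg]
    rcases Finset.mem_insert.1 hy with rfl | hy
    · exact key he hf hne
    rcases Finset.mem_insert.1 hy with rfl | hy
    · have := key hf he hne.symm
      rw [Finset.insert_comm] at this
      convert this using 2
      ext z; simp; tauto
    · exact (ih hy).addTriple hg he hf hne

theorem IsForest.star (hs : s ∈ S) (h : IsPairing K P) (hK : Disjoint K S) :
    IsForest S (S ∪ K) (P.image (insert s)) := by
  induction h with
  | empty => simpa using IsForest.roots
  | @addPair K P e f h he hf hne ih =>
    rw [Finset.disjoint_insert_left, Finset.disjoint_insert_left] at hK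
    have := (ih hK.2.2).addTriple (e := e) (f := f) (g := s) (by simp [hs]) (by simp [he, hK.1])
      (by simp [hf, hK.2.1]) hne
    rw [Finset.image_insert, Finset.union_insert, Finset.union_insert]
    convert this using 2
    ext z; simp; tauto

/-- With `IsForest.exists_erase_root`, this decomposes a forest at a root `s`: the triples through
`s` pair up a set `K` of nonroots, and the others form a forest in which `K` joins the remaining
roots. -/
theorem IsForest.of_erase_root (hs : s ∈ S) (hSV : S ⊆ V) (hK : K ⊆ V \ S) (hP : IsPairing K P)
    (h : IsForest (S.erase s ∪ K) (V.erase s) H) : IsForest S V (H ∪ P.image (insert s)) := by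
  have hK' : Disjoint K S := Finset.disjoint_of_subset_left hK Finset.sdiff_disjoint
  have h1 := (IsForest.star hs hP hK').comp h
    (Finset.union_subset_union_left (Finset.erase_subset _ _)) ?_
  · convert h1 using 1
    ext z
    simp only [Finset.mem_union, Finset.mem_erase]
    constructor
    · intro hz
      by_cases hzs : z = s
      · exact Or.inr (Or.inl (hzs ▸ hs))
      · exact Or.inl ⟨hzs, hz⟩
    · rintro (h | h | h)
      · exact h.2
      · exact hSV h
      · exact (Finset.mem_sdiff.1 (hK h)).1
  · ext z
    simp only [Finset.mem_union, Finset.mem_erase, Finset.mem_inter]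
    constructor
    · rintro ⟨h1, h2⟩
      tauto
    · rintro (h1 | h1)
      · exact ⟨⟨h1.1, hSV h1.2⟩, Or.inl h1.2⟩
      · have := Finset.mem_sdiff.1 (hK h1)
        exact ⟨⟨fun h => this.2 (h ▸ hs), this.1⟩, Or.inr h1⟩

/-- A triple `{e, f, g}` attached at `g = s` contributes the pair `{e, f}` and makes `e` and `f`
roots of what is left; attached elsewhere, it stays in the remaining forest. -/
theorem IsForest.exists_erase_root (hs : s ∈ S) (h : IsForest S V H) :
    ∃ K ⊆ V \ S, ∃ P H', IsPairing K P ∧ IsForest (S.erase s ∪ K) (V.erase s) H' ∧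
      H = H' ∪ P.image (insert s) := by
  induction h with
  | roots => exact ⟨∅, by simp, ∅, ∅, .empty, by simpa using .roots, by simp⟩
  | @addTriple V H e f g h hg he hf hne ih =>
    obtain ⟨K, hK, P, H', hP, hH', rfl⟩ := ih
    have hSV := h.roots_subset
    have hes : e ≠ s := fun h => he (hSV (h ▸ hs))
    have hfs : f ≠ s := fun h => hf (hSV (h ▸ hs))
    have heK : e ∉ K := fun h => he (Finset.mem_sdiff.1 (hK h)).1
    have hfK : f ∉ K := fun h => hf (Finset.mem_sdiff.1 (hK h)).1
    have hsub : V \ S ⊆ insert e (insert f V) \ S := Finset.sdiff_subset_sdiff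
      ((Finset.subset_insert _ _).trans (Finset.subset_insert _ _)) (Finset.Subset.refl _)
    rcases eq_or_ne g s with rfl | hgs
    · refine ⟨insert e (insert f K), ?_, insert {e, f} P, H', hP.addPair heK hfK hne, ?_, ?_⟩
      · intro z hz
        simp only [Finset.mem_insert] at hz
        rcases hz with rfl | rfl | hz
        · exact Finset.mem_sdiff.2 ⟨by simp, fun h => he (hSV h)⟩
        · exact Finset.mem_sdiff.2 ⟨by simp, fun h => hf (hSV h)⟩
        · exact hsub (hK hz)
      · have := hH'.union_roots (T := {e, f}) (by simp [he, hf])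
        convert this using 1
        · ext z; simp
        · ext z
          simp only [Finset.mem_erase, Finset.mem_insert, Finset.mem_union, Finset.mem_singleton]
          constructor
          · tauto
          · rintro (h | rfl | rfl)
            · tauto
            · tauto
            · tauto
      · rw [Finset.image_insert, Finset.union_insert]
        congr 1
        ext z; simp; tauto
    · refine ⟨K, hK.trans hsub, P, insert {e, f, g} H', hP, ?_, ?_⟩
      · rw [Finset.erase_insert_of_ne hes, Finset.erase_insert_of_ne hfs]
        exact hH'.addTriple (by simp [hg, hgs]) (by simp [he]) (by simp [hf]) hne
      · rw [Finset.insert_union]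

open Classical in
/-- The set of all forests of triples on `V` with roots `S`. -/
noncomputable def forests (S V : Finset α) : Finset (Finset (Finset α)) :=
  V.powerset.powerset.filter (IsForest S V)

theorem mem_forests : H ∈ forests S V ↔ IsForest S V H := by
  classical
  simp only [forests, Finset.mem_filter, Finset.mem_powerset, and_iff_right_iff_imp]
  exact fun h p hp => Finset.mem_powerset.2 (h.subset p hp)

theorem IsPairing.biUnion_eq (h : IsPairing K P) : P.biUnion id = K := by
  induction h with
  | empty => rfl
  | @addPair K P e f _ _ _ _ ih =>
    rw [Finset.biUnion_insert, ih]
    ext z; simp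

theorem card_forests_eq_sum (hs : s ∈ S) (hSV : S ⊆ V) : (forests S V).card =
    ∑ K ∈ (V \ S).powerset, (pairings K).card * (forests (S.erase s ∪ K) (V.erase s)).card := by
  simp_rw [← Finset.card_product]
  rw [← Finset.card_sigma]
  symm
  have hsH : ∀ {K H}, IsForest (S.erase s ∪ K) (V.erase s) H → ∀ t ∈ H, s ∉ t :=
    fun h t ht hst => by simpa using h.subset t ht hst
  have hsP : ∀ {K P}, K ⊆ V \ S → IsPairing K P → ∀ p ∈ P, s ∉ p := fun hK h p hp hsp =>
    (Finset.mem_sdiff.1 (hK (h.subset p hp hsp))).2 hs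
  -- The data are recovered from the forest: `H` as the triples without `s`, `P` as those through
  -- `s` with `s` removed. Then `K` is the union of `P`.
  have hfil : ∀ {K P H}, K ⊆ V \ S → IsPairing K P → IsForest (S.erase s ∪ K) (V.erase s) H →
      (H ∪ P.image (insert s)).filter (s ∉ ·) = H ∧
      ((H ∪ P.image (insert s)).filter (s ∈ ·)).image (Finset.erase · s) = P := by
    intro K P H hK hP hH
    constructor
    · ext t
      simp only [Finset.mem_filter, Finset.mem_union, Finset.mem_image]
      constructor
      · rintro ⟨h | ⟨p, hp, rfl⟩, h'⟩
        · exact h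
        · simp at h'
      · exact fun h => ⟨Or.inl h, hsH hH t h⟩
    · ext t
      simp only [Finset.mem_filter, Finset.mem_union, Finset.mem_image]
      constructor
      · rintro ⟨u, ⟨h | ⟨p, hp, rfl⟩, h'⟩, rfl⟩
        · exact absurd h' (hsH hH _ h)
        · rwa [Finset.erase_insert (hsP hK hP p hp)]
      · exact fun h => ⟨insert s t, ⟨Or.inr ⟨t, h, rfl⟩, by simp⟩,
          Finset.erase_insert (hsP hK hP t h)⟩
  refine Finset.card_bij (fun x _ => x.2.2 ∪ x.2.1.image (insert s)) ?_ ?_ ?_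
  · rintro ⟨K, P, H⟩ hx
    simp only [Finset.mem_sigma, Finset.mem_powerset, Finset.mem_product, mem_pairings,
      mem_forests] at hx ⊢
    exact .of_erase_root hs hSV hx.1 hx.2.1 hx.2.2
  · rintro ⟨K, P, H⟩ hx ⟨K', P', H'⟩ hx' h
    simp only [Finset.mem_sigma, Finset.mem_powerset, Finset.mem_product, mem_pairings,
      mem_forests] at hx hx' h
    have h1 := hfil hx.1 hx.2.1 hx.2.2
    have h2 := hfil hx'.1 hx'.2.1 hx'.2.2
    rw [h] at h1
    obtain rfl : H = H' := h1.1.symm.trans h2.1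
    obtain rfl : P = P' := h1.2.symm.trans h2.2
    obtain rfl : K = K' := by rw [← hx.2.1.biUnion_eq, hx'.2.1.biUnion_eq]
    rfl
  · intro H hH
    obtain ⟨K, hK, P, H', hP, hH', rfl⟩ := (mem_forests.1 hH).exists_erase_root hs
    exact ⟨⟨K, P, H'⟩, by simp [mem_pairings, mem_forests, hP, hH', hK], rfl⟩

theorem forests_empty_roots : forests (∅ : Finset α) V = if V = ∅ then {∅} else ∅ := by
  have h0 : ∀ {V : Finset α} {H}, IsForest ∅ V H → V = ∅ ∧ H = ∅ := by
    intro V H h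
    induction h with
    | roots => exact ⟨rfl, rfl⟩
    | addTriple _ hg _ _ _ ih => simp [ih.1] at hg
  ext H
  rw [mem_forests]
  split_ifs with h
  · subst h
    rw [Finset.mem_singleton]
    exact ⟨fun h => (h0 h).2, fun h => h ▸ .roots⟩
  · simp only [Finset.notMem_empty, iff_false]
    exact fun h' => h (h0 h').1

end Hyperforests

/-! ### The number of rooted forests of triples. -/

section ForestCount

/-- Both sides count the pairings of `2 j` points with `d` distinguished pairs; the proof compares
factorials through `(2 i - 1)‼ 2 ^ i i! = (2 i)!`. -/
theorem choose_mul_doubleFactorial (j d : ℕ) (hd : d ≤ j) :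
    Nat.choose (2 * j) (2 * d) * Nat.doubleFactorial (2 * d - 1) *
      Nat.doubleFactorial (2 * (j - d) - 1) = Nat.doubleFactorial (2 * j - 1) * Nat.choose j d := by
  have key : ∀ i, Nat.doubleFactorial (2 * i - 1) * (2 ^ i * i.factorial) = (2 * i).factorial := by
    intro i
    rcases i with _ | i
    · rfl
    · rw [← Nat.doubleFactorial_two_mul, mul_comm, show 2 * (i + 1) = 2 * i + 1 + 1 by ring,
        Nat.factorial_eq_mul_doubleFactorial]
      rfl
  have h1 := Nat.choose_mul_factorial_mul_factorial (show 2 * d ≤ 2 * j by omega)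
  have h2 := Nat.choose_mul_factorial_mul_factorial hd
  rw [show 2 * j - 2 * d = 2 * (j - d) by omega, ← key, ← key, ← key, ← h2] at h1
  have h3 : 2 ^ j = 2 ^ d * 2 ^ (j - d) := by rw [← pow_add, Nat.add_sub_cancel' hd]
  rw [h3] at h1
  have h4 : 0 < 2 ^ d * 2 ^ (j - d) * (d.factorial * (j - d).factorial) := by positivity
  refine Nat.eq_of_mul_eq_mul_right h4 ?_
  linear_combination h1

/-- The binomial theorem together with its derivative; the factor `x + 1` avoids the exponent `j -
1`. -/
theorem sum_choose_mul_add (j a x : ℕ) :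
    (x + 1) * ∑ d ∈ Finset.range (j + 1), Nat.choose j d * (a + 2 * d) * x ^ (j - d) =
      a * (x + 1) ^ (j + 1) + 2 * j * (x + 1) ^ j := by
  have h0 : ∑ d ∈ Finset.range (j + 1), Nat.choose j d * x ^ (j - d) = (x + 1) ^ j := by
    rw [add_comm x 1, add_pow]
    refine Finset.sum_congr rfl fun d _ => ?_
    rw [one_pow, one_mul, mul_comm, Nat.cast_id]
  have h1 : (x + 1) * ∑ d ∈ Finset.range (j + 1), d * Nat.choose j d * x ^ (j - d) =
      j * (x + 1) ^ j := by
    rcases j with _ | j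
    · simp
    · rw [Finset.sum_range_succ', pow_succ, add_comm x 1, add_pow]
      simp only [zero_mul, add_zero, one_pow, one_mul, Nat.cast_id]
      rw [mul_comm, ← mul_assoc, Finset.mul_sum]
      congr 1
      refine Finset.sum_congr rfl fun d _ => ?_
      rw [mul_comm (d + 1), ← Nat.add_one_mul_choose_eq, Nat.add_sub_add_right]
      ring
  calc _ = (x + 1) * (a * ∑ d ∈ Finset.range (j + 1), Nat.choose j d * x ^ (j - d) +
        2 * ∑ d ∈ Finset.range (j + 1), d * Nat.choose j d * x ^ (j - d)) := by
        rw [Finset.mul_sum (a := a), Finset.mul_sum (a := 2), ← Finset.sum_add_distrib]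
        congr 1
        refine Finset.sum_congr rfl fun d _ => ?_
        ring
    _ = _ := by
      rw [h0]
      linear_combination 2 * h1

theorem sum_range_of_odd_eq_zero (j : ℕ) (u : ℕ → ℕ) (hu : ∀ i, ¬ Even i → u i = 0) :
    ∑ i ∈ Finset.range (2 * j + 1), u i = ∑ d ∈ Finset.range (j + 1), u (2 * d) := by
  induction j with
  | zero => simp
  | succ j ih =>
    rw [show 2 * (j + 1) + 1 = 2 * j + 1 + 1 + 1 by ring, Finset.sum_range_succ,
      Finset.sum_range_succ, ih, hu (2 * j + 1) (by simp), add_zero, Finset.sum_range_succ _ (j + 1)]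
    rfl

variable {α : Type*} [DecidableEq α]

/-- An analogue of Cayley's formula for rooted forests. The factor `V.card` on the left avoids the
exponent `j - 1`. Induction on the number of vertices by deleting a root and summing over the set
`K` of its neighbours. -/
theorem card_forests (S V : Finset α) (hSV : S ⊆ V) (j : ℕ) (hj : V.card = S.card + 2 * j) :
    V.card * (forests S V).card = S.card * V.card ^ j * Nat.doubleFactorial (2 * j - 1) := by
  induction hn : V.card using Nat.strong_induction_on generalizing S V j with
  | _ n ih =>
    subst hn
    rcases S.eq_empty_or_nonempty with rfl | ⟨s, hs⟩
    · rw [forests_empty_roots]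
      split_ifs with h
      · simp [h]
      · simp
    have hsV := hSV hs
    have hV := Finset.card_erase_add_one hsV
    have hS := Finset.card_erase_add_one hs
    set x := (V.erase s).card with hx
    set m := (S.erase s).card with hm
    have hrec := card_forests_eq_sum hs hSV
    -- The induction hypothesis gives the smaller counts only up to the factor `x`, which is
    -- cancelled at the end, so a single vertex is treated apart.
    rcases Nat.eq_zero_or_pos x with hx0 | hx0
    · have h1 : V = {s} := by
        rw [← Finset.insert_erase hsV, Finset.card_eq_zero.1 hx0]
        rfl
      have h2 : S = {s} := Finset.Subset.antisymm (h1 ▸ hSV) (by simpa using hs)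
      have hj0 : j = 0 := by omega
      subst h1 h2 hj0
      have : (pairings (∅ : Finset α)).card = 1 := by rw [card_pairings]; rfl
      rw [hrec]
      simp [this, forests_empty_roots]
    have hcard : (V \ S).card = 2 * j := by
      rw [Finset.card_sdiff_of_subset hSV]
      omega
    have h1 : x * (forests S V).card = ∑ d ∈ Finset.range (j + 1),
        Nat.doubleFactorial (2 * j - 1) * (Nat.choose j d * (m + 2 * d) * x ^ (j - d)) := by
      rw [hrec, Finset.mul_sum]
      -- The summand depends only on the size of `K`, and it vanishes for odd sizes since `K` has to
      -- be paired up.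
      let u : ℕ → ℕ := fun i => if Even i then Nat.doubleFactorial (i - 1) *
        ((m + i) * x ^ (j - i / 2) * Nat.doubleFactorial (2 * (j - i / 2) - 1)) else 0
      have h2 : ∀ K ∈ (V \ S).powerset,
          x * ((pairings K).card * (forests (S.erase s ∪ K) (V.erase s)).card) =
          u K.card := by
        intro K hK
        rw [Finset.mem_powerset] at hK
        rw [card_pairings]
        simp only [u]
        split_ifs with he
        · obtain ⟨d, hd⟩ := he
          have h3 := Finset.card_le_card hK
          have h4 : (S.erase s ∪ K).card = m + K.card := by
            rw [Finset.card_union_of_disjoint]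
            exact Finset.disjoint_of_subset_left (Finset.erase_subset _ _)
              (Finset.disjoint_of_subset_right hK Finset.disjoint_sdiff)
          have h5 := ih x (by omega) (S.erase s ∪ K) (V.erase s) ?_ (j - d) ?_ rfl
          · rw [h4] at h5
            rw [show K.card / 2 = d by omega, ← h5]
            ring
          · refine Finset.union_subset (Finset.erase_subset_erase _ hSV) fun z hz => ?_
            have := Finset.mem_sdiff.1 (hK hz)
            exact Finset.mem_erase.2 ⟨fun h => this.2 (h ▸ hs), this.1⟩
          · rw [h4]
            omega
        · simp
      rw [Finset.sum_congr rfl h2, Finset.sum_powerset_apply_card u, hcard,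
        sum_range_of_odd_eq_zero]
      · refine Finset.sum_congr rfl fun d hd => ?_
        have hd' : d ≤ j := by simpa [Nat.lt_succ_iff] using hd
        simp only [u]
        rw [if_pos (by simp), Nat.mul_div_cancel_left _ (by norm_num), smul_eq_mul]
        have h6 := choose_mul_doubleFactorial j d hd'
        linear_combination (m + 2 * d) * x ^ (j - d) * h6
      · intro i hi
        simp only [u]
        rw [if_neg hi, smul_zero]
    rw [← Finset.mul_sum] at h1
    have h7 := sum_choose_mul_add j m x
    rw [← hV, ← hS]
    refine Nat.eq_of_mul_eq_mul_left hx0 ?_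
    -- With this, `m (x + 1) + 2 j` factors as `x (m + 1)`, which closes the recurrence.
    have h8 : x = m + 2 * j := by omega
    calc x * ((x + 1) * (forests S V).card) = (x + 1) * (x * (forests S V).card) := by ring
      _ = Nat.doubleFactorial (2 * j - 1) * (m * (x + 1) ^ (j + 1) + 2 * j * (x + 1) ^ j) := by
        rw [h1, ← h7]
        ring
      _ = x * ((m + 1) * (x + 1) ^ j * Nat.doubleFactorial (2 * j - 1)) := by
        rw [pow_succ]
        have : m * (x + 1) + 2 * j = x * (m + 1) := by rw [h8]; ring
        linear_combination (x + 1) ^ j * Nat.doubleFactorial (2 * j - 1) * this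

end ForestCount

/-! ### Tight matroids as trees of triangles. -/

section TriangleTrees

variable {α : Type*} {M : Matroid α} {e f g : α}

/-- Deleting `f` turns its series partner `e` into a coloop, for which contraction and deletion
agree. -/
theorem contract_delete_of_isCocircuit_pair (hne : e ≠ f) (hK : M.IsCocircuit {e, f}) :
    M ／ {e} ＼ {f} = M ＼ {e, f} := by
  rw [contract_delete_comm _ (by simpa using hne), contract_eq_delete_of_subset_coloops,
    delete_delete, union_comm, singleton_union]
  have h := hK.delete_sdiff_isCocircuit (X := {e}) (by simp) (by simp)
  rwa [pair_sdiff_left hne, singleton_isCocircuit, isColoop_iff_mem_coloops,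
    ← singleton_subset_iff] at h

theorem mem_iff_of_isCocircuit_pair (hK : M.IsCocircuit {e, f}) {C : Set α}
    (hC : M.IsCircuit C) : e ∈ C ↔ f ∈ C := by
  have H : ∀ {e f : α}, M.IsCocircuit {e, f} → e ∈ C → f ∈ C := by
    intro e f hK he
    by_contra hf
    apply hC.inter_isCocircuit_ne_singleton hK (e := e)
    ext z
    simp only [mem_inter_iff, mem_insert_iff, mem_singleton_iff]
    constructor
    · rintro ⟨h, rfl | rfl⟩
      · rfl
      · exact absurd h hf
    · rintro rfl
      exact ⟨he, Or.inl rfl⟩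
  exact ⟨H hK, H (by rwa [pair_comm])⟩

/-- The extension is the pullback of `M` along the map that sends `f` to `g` and fixes everything
else. -/
theorem exists_parallel_extension (hg : M.IsNonloop g) (hf : f ∉ M.E) :
    ∃ N : Matroid α, N.E = insert f M.E ∧ N.IsCircuit {f, g} ∧ N ＼ {f} = M := by
  classical
  have hgf : g ≠ f := fun h => hf (h ▸ hg.mem_ground)
  let u := Function.update id f g
  have huf : u f = g := Function.update_self _ _ _
  have hu : ∀ x, x ≠ f → u x = x := fun x hx => Function.update_of_ne hx _ _
  refine ⟨M.comapOn (insert f M.E) u, rfl, ?_, ?_⟩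
  · rw [isCircuit_iff_dep_forall_sdiff_singleton_indep, dep_iff]
    refine ⟨⟨?_, ?_⟩, ?_⟩
    · rw [comapOn_indep_iff]
      rintro ⟨-, h, -⟩
      exact hgf (h (by simp) (by simp) ((hu g hgf).trans huf.symm))
    · simp [insert_subset_iff, hg.mem_ground]
    · rintro x (rfl | rfl)
      · rw [pair_sdiff_left hgf.symm, comapOn_indep_iff]
        simp [hu g hgf, hg, hg.mem_ground]
      · rw [pair_sdiff_right hgf.symm, comapOn_indep_iff]
        simp [huf, hg]
  · refine ext_indep ?_ fun I hI => ?_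
    · simp [hf]
    · rw [delete_ground, comapOn_ground_eq, insert_sdiff_self_of_notMem hf] at hI
      have hfI : f ∉ I := fun h => hf (hI h)
      have hid : EqOn u id I := fun x hx => hu x fun h => hfI (h ▸ hx)
      rw [delete_indep_iff, comapOn_indep_iff, hid.image_eq, image_id, hid.injOn_iff]
      simp [hfI, injOn_id, hI.trans (subset_insert _ _)]

theorem exists_series_extension (hg : g ∈ M.E) (hg' : ¬ M.IsColoop g) (hf : f ∉ M.E) :
    ∃ N : Matroid α, N.E = insert f M.E ∧ N.IsCocircuit {f, g} ∧ N ／ {f} = M := by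
  obtain ⟨N, h1, h2, h3⟩ := exists_parallel_extension (M := M✶)
    (isNonloop_of_not_isLoop hg hg') hf
  refine ⟨N✶, h1, ?_, ?_⟩
  · rwa [dual_isCocircuit_iff]
  · rw [← dual_inj, dual_contract, dual_dual, h3]

/-- First `f` is placed parallel to `g`, then `e` in series with `f`. The circuit `{f, g}` lifts to
the triangle because every circuit containing `f` also contains `e`. -/
theorem exists_triangle_extension (hg : M.IsNonloop g) (he : e ∉ M.E) (hf : f ∉ M.E)
    (hne : e ≠ f) : ∃ N : Matroid α, N.E = insert e (insert f M.E) ∧ N.IsCocircuit {e, f} ∧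
      N.IsCircuit {e, f, g} ∧ N ＼ {e, f} = M := by
  obtain ⟨N₁, h1, h2, h3⟩ := exists_parallel_extension hg hf
  obtain ⟨N, h4, h5, h6⟩ := exists_series_extension (M := N₁) (g := f) (f := e) (by simp [h1])
    (fun h => h.notMem_isCircuit h2 (by simp)) (by simp [h1, he, hne])
  refine ⟨N, by rw [h4, h1], h5, ?_, ?_⟩
  · rw [← h6] at h2
    obtain ⟨C, hC, h7, h8⟩ := h2.exists_subset_isCircuit_of_contract
    have h9 := (mem_iff_of_isCocircuit_pair h5 hC).2 (h7 (by simp))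
    have : C = {e, f, g} := by
      refine Subset.antisymm ?_ (insert_subset h9 h7)
      rwa [union_singleton] at h8
    exact this ▸ hC
  · rw [← contract_delete_of_isCocircuit_pair hne h5, h6, h3]

/-- The induction step for `IsTriangleTree.mem_of_isCircuit`. Eliminating `e` between `C` and the
triangle gives a circuit without `e`, hence without the series partner `f`, so the closure
hypothesis on `M ＼ {e, f}` applies to it. -/
theorem isCircuit_closed_of_triangle {X C T : Set α} (hK : M.IsCocircuit {e, f})
    (hT : M.IsCircuit T) (hTe : T = {e, f, g}) (hge : g ≠ e) (hgf : g ≠ f)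
    (hX : e ∈ X → f ∈ X → g ∈ X) (hX' : f ∈ X → g ∈ X → e ∈ X)
    (hcl : ∀ C, (M ＼ {e, f}).IsCircuit C → ∀ z ∈ C, C \ {z} ⊆ X → z ∈ X)
    (hC : M.IsCircuit C) (heC : e ∈ C) {z : α} (hz : z ∈ C) (hzf : z ≠ f) (hCX : C \ {z} ⊆ X) :
    z ∈ X := by
  subst hTe
  have hmem : ∀ C, M.IsCircuit C → e ∉ C → (M ＼ {e, f}).IsCircuit C := by
    intro C hC heC
    have hfC : f ∉ C := fun h => heC ((mem_iff_of_isCocircuit_pair hK hC).2 h)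
    simp [delete_isCircuit_iff, hC, heC, hfC]
  have hfC := (mem_iff_of_isCocircuit_pair hK hC).1 heC
  have hfX : f ∈ X := hCX ⟨hfC, hzf.symm⟩
  have hel : ∀ C', M.IsCircuit C' → C' ⊆ (C ∪ {e, f, g}) \ {e} → ∀ w ∈ C',
      (∀ y ∈ C, y ≠ e → y ≠ f → y ≠ w → y ∈ X) → (g ≠ w → g ∈ X) → w ∈ X := by
    intro C' hC' hs w hw h1 h2
    have heC' : e ∉ C' := fun h => (hs h).2 rfl
    have hfC' : f ∉ C' := fun h => heC' ((mem_iff_of_isCocircuit_pair hK hC').2 h)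
    refine hcl C' (hmem C' hC' heC') w hw fun y hy => ?_
    have hye : y ≠ e := fun h => heC' (h ▸ hy.1)
    have hyf : y ≠ f := fun h => hfC' (h ▸ hy.1)
    rcases (hs hy.1).1 with h | h | h | h
    · exact h1 y h hye hyf hy.2
    · exact absurd h hye
    · exact absurd h hyf
    · subst h
      exact h2 hy.2
  rcases eq_or_ne z e with rfl | hze
  · refine hX' hfX ?_
    by_cases hgC : g ∈ C
    · exact hCX ⟨hgC, hge⟩
    obtain ⟨C', hs, hC', hgC'⟩ := hT.strong_elimination hC (e := z) (f := g) (by simp) heC (by simp)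
      hgC
    rw [union_comm] at hs
    exact hel C' hC' hs g hgC' (fun y hy h1 _ _ => hCX ⟨hy, h1⟩) (fun h => absurd rfl h)
  · have hgX := hX (hCX ⟨heC, hze.symm⟩) hfX
    rcases eq_or_ne z g with rfl | hzg
    · exact hgX
    obtain ⟨C', hs, hC', hzC'⟩ := hC.strong_elimination hT (e := e) (f := z) heC (by simp) hz
      (by simp [hze, hzf, hzg])
    exact hel C' hC' hs z hzC' (fun y hy _ _ h => hCX ⟨hy, h⟩) (fun _ => hgX)

variable [DecidableEq α] {V : Finset α} {H : Finset (Finset α)}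

/-- `M` is the matroid on `V` built from a single coloop by attaching the triangles in `H`. -/
inductive IsTriangleTree : Finset α → Finset (Finset α) → Matroid α → Prop
  | coloop (x : α) : IsTriangleTree {x} ∅ (freeOn {x})
  | addTriangle {V : Finset α} {H : Finset (Finset α)} {M : Matroid α} {e f g : α} :
      IsTriangleTree V H (M ＼ {e, f}) → g ∈ V → e ∉ V → f ∉ V → e ≠ f → {e, f} ⊆ M.E →
      M.IsCocircuit {e, f} → M.IsCircuit {e, f, g} →
      IsTriangleTree (insert e (insert f V)) (insert {e, f, g} H) M

theorem IsTriangleTree.ground_eq (h : IsTriangleTree V H M) : M.E = V := by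
  induction h with
  | coloop => simp
  | @addTriangle V H M e f g _ _ _ _ _ hs _ _ ih =>
    rw [Finset.coe_insert, Finset.coe_insert, ← ih, delete_ground]
    rw [show insert e (insert f (M.E \ {e, f})) = {e, f} ∪ M.E \ {e, f} by rw [insert_union, singleton_union],
      union_sdiff_cancel hs]

theorem IsTriangleTree.exists_isForest (h : IsTriangleTree V H M) :
    ∃ x ∈ V, IsForest {x} V H := by
  induction h with
  | coloop x => exact ⟨x, by simp, .roots⟩
  | addTriangle _ hg he hf hne _ _ _ ih =>
    obtain ⟨x, hx, h⟩ := ih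
    exact ⟨x, by simp [hx], h.addTriple hg he hf hne⟩

theorem IsTriangleTree.isForest (h : IsTriangleTree V H M) {x : α} (hx : x ∈ V) :
    IsForest {x} V H := by
  obtain ⟨y, _, h'⟩ := h.exists_isForest
  exact h'.reroot hx

/-- A circuit through `e` contains `f`, so one with at most two elements would lie properly inside
the triangle. For reducibility, contracting `e` makes `f` parallel to `g`, and deleting `f` then
gives back the smaller tree. -/
theorem IsTriangleTree.isTight [Finite α] (h : IsTriangleTree V H M) : IsTight M := by
  have hfin : ∀ M : Matroid α, M.Finite := fun M => ⟨M.E.toFinite⟩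
  induction h with
  | coloop x =>
    refine ⟨isSimple_iff_pair.2 ⟨fun e => by simp, fun e f hne hC => ?_⟩, ?_, ?_⟩
    · have h1 : e = x := hC.subset_ground (by simp)
      have h2 : f = x := hC.subset_ground (by simp)
      exact hne (h1.trans h2.symm)
    · refine .coloop (e := x) ?_ ?_
      · rw [← dual_isLoop_iff_isColoop, freeOn_dual_eq, loopyOn_isLoop_iff]
        rfl
      · have : (freeOn {x} ／ {x}) = emptyOn α := by
          rw [← ground_eq_empty_iff]
          simp
        rw [this]
        exact .empty
    · simp [eRank_freeOn]
  | @addTriangle V H M e f g _ hg he hf hne hs hK hT ih =>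
    have hge : g ≠ e := fun h => he (h ▸ hg)
    have hgf : g ≠ f := fun h => hf (h ▸ hg)
    have hsp := isSimple_iff_pair.1 ih.simple
    have hmem : ∀ C, M.IsCircuit C → e ∉ C → (M ＼ {e, f}).IsCircuit C := by
      intro C hC heC
      have hfC : f ∉ C := fun h => heC ((mem_iff_of_isCocircuit_pair hK hC).2 h)
      simp [delete_isCircuit_iff, hC, heC, hfC]
    refine ⟨isSimple_iff_pair.2 ⟨fun x hx => ?_, fun x y hxy hC => ?_⟩, ?_, ?_⟩
    · rw [← singleton_isCircuit] at hx
      by_cases hex : e = x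
      · have := (mem_iff_of_isCocircuit_pair hK hx).1 hex
        exact hne (hex.trans this.symm)
      · exact hsp.1 x (singleton_isCircuit.1 (hmem _ hx hex))
    · by_cases hexy : e ∈ ({x, y} : Set α)
      · have hfxy := (mem_iff_of_isCocircuit_pair hK hC).1 hexy
        have h1 : ({x, y} : Set α) ⊆ {e, f} := by
          rcases hexy with rfl | rfl <;> rcases hfxy with rfl | rfl <;> simp_all [pair_comm]
        refine hT.not_ssubset hC ⟨fun z hz => ?_, fun h => ?_⟩
        · rcases h1 hz with h | h <;> simp_all
        · rcases h1 (h (by simp : g ∈ ({e, f, g} : Set α))) with h | h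
          · exact hge h
          · exact hgf h
      · exact hsp.2 x y hxy (hmem _ hC hexy)
    · refine .series hne hK (.parallel (e := f) (f := g) hgf.symm ?_ ?_)
      · have := hT.contractElem_isCircuit (e := e) ⟨e, by simp, f, by simp, hne⟩ (by simp)
        rwa [insert_sdiff_self_of_notMem (by simp [hne, hge.symm])] at this
      · rw [contract_delete_of_isCocircuit_pair hne hK]
        exact ih.reducible
    · have h1 := toNat_eRank_delete_isCocircuit hK
      have h2 := ncard_delete_pair hne hs
      have := ih.ncard_add_one
      omega

/-- The triangles generate the whole closure operator: circuits avoiding the last series pair fall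
under induction, the others are shortened with the last triangle. -/
theorem IsTriangleTree.mem_of_isCircuit (h : IsTriangleTree V H M) {X : Set α}
    (hX : ∀ t ∈ H, ∀ z ∈ t, (∀ y ∈ t, y ≠ z → y ∈ X) → z ∈ X) :
    ∀ C, M.IsCircuit C → ∀ z ∈ C, C \ {z} ⊆ X → z ∈ X := by
  induction h with
  | coloop x =>
    intro C hC
    exact absurd (freeOn_indep hC.subset_ground) hC.not_indep
  | @addTriangle V H M e f g _ hg he hf hne hs hK hT ih =>
    have hge : g ≠ e := fun h => he (h ▸ hg)
    have hgf : g ≠ f := fun h => hf (h ▸ hg)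
    have ih' := ih fun t ht => hX t (Finset.mem_insert_of_mem ht)
    have hX3 := hX _ (Finset.mem_insert_self _ _)
    simp only [Finset.mem_insert, Finset.mem_singleton, forall_eq_or_imp, forall_eq] at hX3
    intro C hC z hz hCX
    by_cases heC : e ∈ C
    -- `isCircuit_closed_of_triangle` excludes `z = f`, a case recovered by exchanging `e` and `f`.
    · by_cases hzf : z = f
      · refine isCircuit_closed_of_triangle (e := f) (f := e) (g := g) (by rwa [pair_comm]) hT
          (by rw [insert_comm]) hgf hge (fun h1 h2 => ?_) (fun h1 h2 => ?_) ?_ hC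
          ((mem_iff_of_isCocircuit_pair hK hC).1 heC) hz (hzf ▸ hne.symm) hCX
        · exact hX3.2.2 ⟨fun _ => h2, fun _ => h1, fun h => absurd rfl h⟩
        · exact hX3.2.1 ⟨fun _ => h1, fun h => absurd rfl h, fun _ => h2⟩
        · rwa [pair_comm]
      · refine isCircuit_closed_of_triangle hK hT rfl hge hgf (fun h1 h2 => ?_) (fun h1 h2 => ?_) ih'
          hC heC hz hzf hCX
        · exact hX3.2.2 ⟨fun _ => h1, fun _ => h2, fun h => absurd rfl h⟩
        · exact hX3.1 ⟨fun h => absurd rfl h, fun _ => h1, fun _ => h2⟩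
    · refine ih' C ?_ z hz hCX
      have hfC : f ∉ C := fun h => heC ((mem_iff_of_isCocircuit_pair hK hC).2 h)
      simp [delete_isCircuit_iff, hC, heC, hfC]

/-- Thus the tree can be read off from the matroid. A second triangle `{e, f, h}` would, by
elimination with `{e, f, g}`, give a circuit inside `{g, h}`, against simplicity. -/
theorem IsTriangleTree.mem_iff [Finite α] (h : IsTriangleTree V H M) (t : Finset α) :
    t ∈ H ↔ t.card = 3 ∧ M.IsCircuit t := by
  induction h generalizing t with
  | coloop x =>
    simp only [Finset.notMem_empty, false_iff, not_and]
    exact fun _ hC => hC.not_indep (freeOn_indep hC.subset_ground)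
  | @addTriangle V H M e f g hM hg he hf hne hs hK hT ih =>
    have hge : g ≠ e := fun h => he (h ▸ hg)
    have hgf : g ≠ f := fun h => hf (h ▸ hg)
    rw [Finset.mem_insert, ih, delete_isCircuit_iff]
    constructor
    · rintro (rfl | h)
      · refine ⟨Finset.card_eq_three.2 ⟨e, f, g, hne, hge.symm, hgf.symm, rfl⟩, ?_⟩
        simpa using hT
      · exact ⟨h.1, h.2.1⟩
    · rintro ⟨h3, hC⟩
      by_cases het : e ∈ t
      · left
        have hft : f ∈ t := (mem_iff_of_isCocircuit_pair hK hC).1 het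
        by_contra hne'
        have hgt : g ∉ t := by
          intro hgt
          refine hne' (Finset.eq_of_subset_of_card_le ?_ ?_).symm
          · simp [Finset.insert_subset_iff, het, hft, hgt]
          · rw [h3, Finset.card_eq_three.2 ⟨e, f, g, hne, hge.symm, hgf.symm, rfl⟩]
        obtain ⟨C, hCs, hC', hgC⟩ := hT.strong_elimination hC (e := e) (f := g) (by simp) het
          (by simp) hgt
        have heC : e ∉ C := fun h => (hCs h).2 rfl
        have hfC : f ∉ C := fun h => heC ((mem_iff_of_isCocircuit_pair hK hC').2 h)
        have hCd : (M ＼ {e, f}).IsCircuit C := by simp [delete_isCircuit_iff, hC', heC, hfC]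
        obtain ⟨h, hh⟩ : ∃ h, (t.erase e).erase f = {h} := by
          rw [← Finset.card_eq_one, Finset.card_erase_of_mem (by simp [hft, hne.symm]),
            Finset.card_erase_of_mem het, h3]
        have hCg : C ⊆ {g, h} := by
          intro z hz
          have hze : z ≠ e := fun h => heC (h ▸ hz)
          have hzf : z ≠ f := fun h => hfC (h ▸ hz)
          rcases (hCs hz).1 with (h' | h' | h') | h'
          · exact absurd h' hze
          · exact absurd h' hzf
          · exact Or.inl h'
          · right
            have : z ∈ (t.erase e).erase f := by
              simp only [Finset.mem_erase]
              exact ⟨hzf, hze, h'⟩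
            rw [hh] at this
            simpa using this
        have hsp := isSimple_iff_pair.1 hM.isTight.simple
        by_cases hhC : h ∈ C
        · have : C = {g, h} := hCg.antisymm (by simp [insert_subset_iff, hgC, hhC])
          have hgh : g ≠ h := by
            rintro rfl
            have : g ∈ (t.erase e).erase f := by simp [hh]
            simp only [Finset.mem_erase] at this
            exact hgt this.2.2
          exact hsp.2 g h hgh (this ▸ hCd)
        · have : C = {g} := Subset.antisymm (fun z hz => (hCg hz).resolve_right
            fun h' => hhC (h' ▸ hz)) (by simpa using hgC)
          exact hsp.1 g (singleton_isCircuit.1 (this ▸ hCd))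
      · right
        have hft : f ∉ t := fun h => het ((mem_iff_of_isCocircuit_pair hK hC).2 h)
        exact ⟨h3, hC, by simp [het, hft]⟩

/-- Flats are the sets closed under circuits, and triangles suffice to test this. The right-hand
side does not mention `M`, which yields uniqueness. -/
theorem IsTriangleTree.isFlat_iff [Finite α] (h : IsTriangleTree V H M) {X : Set α} :
    M.IsFlat X ↔ X ⊆ V ∧ ∀ t ∈ H, ∀ z ∈ t, (∀ y ∈ t, y ≠ z → y ∈ X) → z ∈ X := by
  rw [← h.ground_eq]
  constructor
  · intro hX
    refine ⟨hX.subset_ground, fun t ht z hz hy => ?_⟩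
    have hC := ((h.mem_iff t).1 ht).2
    rw [← hX.closure]
    refine M.closure_subset_closure ?_ (hC.mem_closure_sdiff_singleton_of_mem hz)
    exact fun y hy' => hy y hy'.1 hy'.2
  · rintro ⟨hXE, hX⟩
    rw [isFlat_iff_closure_eq]
    refine Subset.antisymm (fun z hz => ?_) (M.subset_closure X)
    by_contra hzX
    obtain ⟨C, hCs, hC, hzC⟩ := exists_isCircuit_of_mem_closure hz hzX
    exact hzX (h.mem_of_isCircuit hX C hC z hzC (by simpa using hCs))

theorem IsTriangleTree.unique [Finite α] {N : Matroid α} (hM : IsTriangleTree V H M)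
    (hN : IsTriangleTree V H N) : M = N := by
  refine ext_closure fun X => ?_
  rw [closure_def, closure_def]
  simp only [hM.isFlat_iff, hN.isFlat_iff, hM.ground_eq, hN.ground_eq]

theorem IsForest.exists_isTriangleTree [Finite α] {x : α} (h : IsForest {x} V H) :
    ∃ M, IsTriangleTree V H M := by
  induction h with
  | roots => exact ⟨_, .coloop x⟩
  | @addTriple V H e f g _ hg he hf hne ih =>
    obtain ⟨M, hM⟩ := ih
    have hE := hM.ground_eq
    have := hM.isTight.simple.1
    obtain ⟨N, h1, h2, h3, h4⟩ := exists_triangle_extension (M := M) (e := e) (f := f) (g := g)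
      (isNonloop_of_loopless (by simpa [hE] using hg)) (by simpa [hE] using he)
      (by simpa [hE] using hf) hne
    refine ⟨N, .addTriangle (h4.symm ▸ hM) hg he hf hne ?_ h2 h3⟩
    simp [h1, insert_subset_iff]

theorem IsTight.exists_isTriangleTree [Finite α] (h : IsTight M) (hV : M.E = V) :
    ∃ H, IsTriangleTree V H M := by
  have hfin : ∀ M : Matroid α, M.Finite := fun M => ⟨M.E.toFinite⟩
  induction hn : V.card using Nat.strong_induction_on generalizing V M with
  | _ n ih =>
    subst hn
    have hc : M.E.ncard = V.card := by rw [hV, ncard_coe_finset]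
    by_cases h2 : 2 ≤ V.card
    · obtain ⟨e, f, g, hne, hge, hgf, hK, hT, ht⟩ := h.exists_triangle (by omega)
      have he : e ∈ V := by simpa [hV] using hK.subset_ground (by simp : e ∈ ({e, f} : Set α))
      have hf : f ∈ V := by simpa [hV] using hK.subset_ground (by simp : f ∈ ({e, f} : Set α))
      have hg : g ∈ V := by simpa [hV] using hT.subset_ground (by simp : g ∈ ({e, f, g} : Set α))
      have h3 : (M ＼ {e, f}).E = ((V.erase e).erase f : Finset α) := by
        ext z
        simp only [delete_ground, hV, mem_sdiff, mem_insert_iff, mem_singleton_iff,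
          Finset.mem_coe, Finset.mem_erase]
        tauto
      have h4 : ((V.erase e).erase f).card < V.card :=
        Finset.card_lt_card (((Finset.erase_subset _ _)).trans_ssubset (Finset.erase_ssubset he))
      obtain ⟨H, hH⟩ := ih _ h4 ht h3 rfl
      have h5 := hH.addTriangle (g := g) (by simp [hg, hge, hgf]) (by simp) (by simp) hne
        hK.subset_ground hK hT
      rw [Finset.insert_erase (by simp [hf, hne.symm]), Finset.insert_erase he] at h5
      exact ⟨_, h5⟩
    · obtain ⟨x, hx⟩ := h.ground_nonempty
      have hx' : x ∈ V := by simpa [hV] using hx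
      have : V = {x} := by
        obtain ⟨y, hy⟩ := Finset.card_eq_one.1
          (by have := Finset.card_pos.2 ⟨x, hx'⟩; omega : V.card = 1)
        rw [hy, Finset.mem_singleton] at hx'
        rw [hy, hx']
      subst this
      refine ⟨∅, ?_⟩
      have hM : M = freeOn {x} := by
        have := h.simple.1
        exact eq_freeOn_iff.2 ⟨by simpa using hV, indep_singleton.2 (isNonloop_of_loopless hx)⟩
      exact hM ▸ .coloop x

/-- The number of tight matroids on a ground set is the number of triple trees on that set. -/
theorem ncard_isTight [Finite α] {x : α} (hx : x ∈ V) :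
    {M : Matroid α | M.E = V ∧ IsTight M}.ncard = (forests {x} V).card := by
  classical
  let u : Matroid α → Finset (Finset α) :=
    fun M => V.powerset.filter fun t => t.card = 3 ∧ M.IsCircuit t
  have hu : ∀ {M H}, IsTriangleTree V H M → u M = H := by
    intro M H h
    ext t
    rw [Finset.mem_filter, h.mem_iff, and_iff_right_iff_imp, Finset.mem_powerset]
    intro h'
    have := h'.2.subset_ground
    rwa [h.ground_eq, Finset.coe_subset] at this
  have hex : ∀ {M : Matroid α}, M.E = V → IsTight M → IsTriangleTree V (u M) M := by
    intro M hE hM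
    obtain ⟨H, hH⟩ := hM.exists_isTriangleTree hE
    rwa [hu hH]
  rw [← ncard_coe_finset, ← InjOn.ncard_image (f := u)]
  · congr 1
    ext H
    simp only [mem_image, Finset.mem_coe, mem_forests, Set.mem_ofPred_eq]
    constructor
    · rintro ⟨M, ⟨hE, hM⟩, rfl⟩
      exact (hex hE hM).isForest hx
    · intro h
      obtain ⟨M, hM⟩ := h.exists_isTriangleTree
      exact ⟨M, ⟨hM.ground_eq, hM.isTight⟩, hu hM⟩
  · rintro M ⟨hE, hM⟩ N ⟨hE', hN⟩ h
    have h1 := hex hE hM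
    rw [h] at h1
    exact h1.unique (hex hE' hN)

end TriangleTrees

/-! ### Counting the disconnected matroids. -/

section TwoComponents

variable {α : Type*} {M : Matroid α} {S : Set α}

instance [Finite α] : Finite (Matroid α) :=
  Finite.of_injective (fun M : Matroid α => (M.E, {I | M.Indep I})) fun M N h => by
    rw [Prod.mk.injEq] at h
    exact ext_indep h.1 fun I _ => Set.ext_iff.1 h.2 I

/-- The tight matroids on a given ground set. -/
def tightMatroids (S : Set α) : Set (Matroid α) := {M | M.E = S ∧ IsTight M}

theorem ncard_tightMatroids [Finite α] (V : Finset α) (j : ℕ) (hV : V.card = 2 * j + 1) :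
    V.card * (tightMatroids (V : Set α)).ncard = V.card ^ j * Nat.doubleFactorial (2 * j - 1) := by
  classical
  obtain ⟨x, hx⟩ := Finset.card_pos.1 (by omega : 0 < V.card)
  rw [tightMatroids, ncard_isTight hx, card_forests {x} V (by simpa using hx) j (by simp; omega)]
  simp

theorem tightMatroids_eq_empty (V : Finset α) (hV : Even V.card) :
    tightMatroids (V : Set α) = ∅ := by
  rw [eq_empty_iff_forall_notMem]
  rintro M ⟨hE, hM⟩
  have := hM.ncard_add_one
  rw [hE, ncard_coe_finset] at this
  obtain ⟨c, hc⟩ := hV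
  omega

/-- `S` and its complement are separators of `M`, with tight restrictions. -/
structure IsTightSplit (M : Matroid α) (S : Set α) : Prop where
  ground : M.E = univ
  sep : IsSeparator M S
  left : IsTight (M ↾ S)
  right : IsTight (M ＼ S)

/-- `M` is the direct sum of its two restrictions, which can be chosen independently. -/
theorem ncard_isTightSplit (S : Set α) :
    {M : Matroid α | IsTightSplit M S}.ncard
      = (tightMatroids S).ncard * (tightMatroids Sᶜ).ncard := by
  rw [← ncard_prod]
  have hinj : InjOn (fun M : Matroid α => (M ↾ S, M ＼ S)) {M | IsTightSplit M S} := by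
    intro M hM N hN h
    simp only [Prod.mk.injEq] at h
    exact hM.sep.ext hN.sep h.1 h.2
  rw [← hinj.ncard_image]
  congr 1
  ext ⟨N₁, N₂⟩
  simp only [mem_image, mem_prod, tightMatroids, Set.mem_ofPred_eq, Prod.mk.injEq]
  constructor
  · rintro ⟨M, hM, rfl, rfl⟩
    exact ⟨⟨rfl, hM.left⟩, by rw [delete_ground, hM.ground, compl_eq_univ_sdiff], hM.right⟩
  · rintro ⟨⟨h1, h2⟩, h3, h4⟩
    have hd : Disjoint N₁.E N₂.E := by
      rw [h1, h3]
      exact disjoint_compl_right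
    obtain ⟨hs, hl, hr⟩ := isSeparator_disjointSum hd
    rw [h1] at hs hl hr
    refine ⟨_, ⟨?_, hs, hl.symm ▸ h2, hr.symm ▸ h4⟩, hl, hr⟩
    simp [h1, h3]

theorem IsTightSplit.compl (h : IsTightSplit M S) : IsTightSplit M Sᶜ := by
  have h1 : M.E \ S = Sᶜ := by rw [h.ground, compl_eq_univ_sdiff]
  refine ⟨h.ground, h1 ▸ h.sep.compl, ?_, ?_⟩
  · rw [← h1]
    exact h.right
  · have : M ＼ Sᶜ = M ↾ S := by
      rw [delete_eq_restrict, h.ground, sdiff_compl, univ_inter]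
    exact this ▸ h.left

theorem IsTightSplit.component_eq [Finite α] (h : IsTightSplit M S) {e : α} (he : e ∈ S) :
    component M e = S := by
  have hfin : M.Finite := ⟨M.E.toFinite⟩
  have heE := h.sep.1 he
  have hsub := component_subset_of_isSeparator h.sep he
  have hfin' : (M ↾ S).Finite := ⟨(M ↾ S).E.toFinite⟩
  refine h.left.eq_of_isSeparator ⟨hsub, fun C hC => ?_⟩ ⟨e, mem_component_self M e⟩
  exact (component_isSeparator heE).2 C ((restrict_isCircuit_iff h.sep.1).1 hC).1

/-- The matroids on the whole type, simple and series-parallel reducible, of rank just above half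
the number of elements. -/
structure IsNearTight (M : Matroid α) : Prop where
  ground : M.E = univ
  simple : IsSimple M
  reducible : IsSPReducible M
  ncard_add_two : M.E.ncard + 2 = 2 * M.eRank.toNat

theorem IsTightSplit.isNearTight [Finite α] (h : IsTightSplit M S) :
    IsNearTight M ∧ ¬ IsSeriesParallel M := by
  have hfin : ∀ N : Matroid α, N.Finite := fun N => ⟨N.E.toFinite⟩
  have hd : Disjoint (M ↾ S).E (M ＼ S).E := disjoint_sdiff_right
  have heq : M = (M ↾ S).disjointSum (M ＼ S) hd := by
    obtain ⟨hs, hl, hr⟩ := isSeparator_disjointSum hd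
    exact h.sep.ext hs hl.symm hr.symm
  have hds := h.left.disjointSum hd h.right
  rw [← heq] at hds
  refine ⟨⟨h.ground, hds.1, hds.2.1, hds.2.2⟩, fun hsp => ?_⟩
  obtain ⟨-, e, he, hce⟩ := isSeriesParallel_iff.1 hsp
  obtain ⟨a, ha⟩ := h.left.ground_nonempty
  obtain ⟨b, hb⟩ := h.right.ground_nonempty
  have h1 : component M a = component M e :=
    component_eq_of_mem he (hce ▸ h.sep.1 ha)
  rw [h.component_eq ha, hce] at h1
  exact hb.2 (h1 ▸ hb.1)

/-- A proper component and its complement attain the bound by the equality case of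
`IsSeparator.ncard_add_two_le`. Conversely, the side of a split that contains `e` is tight, hence
connected, hence the component of `e`. -/
theorem IsNearTight.ncard_isTightSplit [Finite α] (h : IsNearTight M) (hM : ¬ IsSeriesParallel M) :
    {S : Set α | IsTightSplit M S}.ncard = 2 := by
  have hfin : ∀ N : Matroid α, N.Finite := fun N => ⟨N.E.toFinite⟩
  have hne : M.E.Nonempty := by
    by_contra h0
    rw [not_nonempty_iff_eq_empty] at h0
    have h1 := M.eRank_le_encard_ground
    have h2 := h.ncard_add_two
    rw [h0, encard_empty, nonpos_iff_eq_zero] at h1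
    simp [h1, h0] at h2
  obtain ⟨e, he⟩ := hne
  have hsep := component_isSeparator he
  have hne : component M e ≠ M.E := fun h' => hM (isSeriesParallel_iff.2 ⟨h.reducible, e, he, h'⟩)
  have hce : (M.E \ component M e).Nonempty := by
    rw [nonempty_iff_ne_empty, Ne, sdiff_eq_empty]
    exact fun h' => hne (hsep.1.antisymm h')
  obtain ⟨hl, hr⟩ := (hsep.ncard_add_two_le h.reducible h.simple ⟨e, mem_component_self M e⟩ hce).2
    h.ncard_add_two
  have hsplit : IsTightSplit M (component M e) := ⟨h.ground, hsep, hl, hr⟩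
  have : {S : Set α | IsTightSplit M S} = {component M e, (component M e)ᶜ} := by
    ext S
    rw [Set.mem_ofPred_eq, mem_insert_iff, mem_singleton_iff]
    constructor
    · intro hS
      by_cases heS : e ∈ S
      · exact Or.inl (hS.component_eq heS).symm
      · right
        rw [hS.compl.component_eq heS, compl_compl]
    · rintro (rfl | rfl)
      · exact hsplit
      · exact hsplit.compl
  rw [this, ncard_pair]
  intro h'
  have : e ∈ (component M e)ᶜ := h' ▸ mem_component_self M e
  exact this (mem_component_self M e)

/-- Double counting of the pairs of a matroid and a set splitting it; a component and its complement
both occur, whence the factor two. -/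
theorem two_mul_ncard_isNearTight [Fintype α] :
    2 * {M : Matroid α | IsNearTight M ∧ ¬ IsSeriesParallel M}.ncard
      = ∑ S : Finset α,
        (tightMatroids (S : Set α)).ncard * (tightMatroids (S : Set α)ᶜ).ncard := by
  classical
  have := Fintype.ofFinite (Matroid α)
  simp_rw [← ncard_isTightSplit, ncard_eq_toFinset_card']
  simp only [Set.toFinset_ofPred]
  have := Finset.sum_card_bipartiteAbove_eq_sum_card_bipartiteBelow
    (s := (Finset.univ : Finset (Finset α))) (t := (Finset.univ : Finset (Matroid α)))
    (fun (S : Finset α) M => IsTightSplit M (S : Set α))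
  simp only [Finset.bipartiteAbove, Finset.bipartiteBelow] at this
  rw [this, Finset.card_filter, Finset.mul_sum]
  refine Finset.sum_congr rfl fun M _ => ?_
  split_ifs with h
  · rw [mul_one, ← h.1.ncard_isTightSplit h.2, ncard_eq_toFinset_card']
    refine (Finset.card_bij (fun (S : Finset α) _ => (S : Set α)) ?_ ?_ ?_).symm
    · intro S hS
      simpa using hS
    · intro S _ T _ h
      simpa using h
    · intro S hS
      exact ⟨S.toFinset, by simpa using hS, by simp⟩
  · symm
    rw [mul_zero, Finset.card_eq_zero, Finset.filter_eq_empty_iff]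
    exact fun S _ hS => h hS.isNearTight

/-- An integer exponent is needed since `j - 1 = -1` for a single element. -/
theorem cast_ncard_tightMatroids [Finite α] (V : Finset α) (j : ℕ) (hV : V.card = 2 * j + 1) :
    ((tightMatroids (V : Set α)).ncard : ℚ)
      = Nat.doubleFactorial (2 * j - 1) * (2 * (j : ℚ) + 1) ^ ((j : ℤ) - 1) := by
  have h := congrArg (Nat.cast (R := ℚ)) (ncard_tightMatroids V j hV)
  rw [hV] at h
  push_cast at h
  have h0 : (2 * (j : ℚ) + 1) ≠ 0 := by positivity
  rw [zpow_sub_one₀ h0, zpow_natCast]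
  field_simp
  linarith

theorem sum_range_odd {R : Type*} [AddCommMonoid R] (f : ℕ → R) (hf : ∀ a, f (2 * a) = 0) (k : ℕ) :
    ∑ m ∈ Finset.range (2 * k + 1), f m = ∑ a ∈ Finset.range k, f (2 * a + 1) := by
  induction k with
  | zero => simpa using hf 0
  | succ k ih =>
    rw [Finset.sum_range_succ _ k, ← ih, show 2 * (k + 1) + 1 = 2 * k + 1 + 1 + 1 by ring,
      Finset.sum_range_succ, Finset.sum_range_succ, show 2 * k + 1 + 1 = 2 * (k + 1) by ring,
      hf (k + 1), add_zero]

theorem cast_two_mul_ncard_isNearTight (k : ℕ) :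
    2 * ({M : Matroid (Fin (2 * k)) | IsNearTight M ∧ ¬ IsSeriesParallel M}.ncard : ℚ)
      = ∑ a ∈ Finset.range k, (Nat.choose (2 * k) (2 * a + 1) : ℚ)
          * (Nat.doubleFactorial (2 * a - 1) : ℚ)
          * (Nat.doubleFactorial (2 * k - 2 * a - 3) : ℚ)
          * (2 * (a : ℚ) + 1) ^ ((a : ℤ) - 1)
          * (2 * (k : ℚ) - 2 * (a : ℚ) - 1) ^ ((k : ℤ) - (a : ℤ) - 2) := by
  classical
  let g : ℕ → ℚ := fun c => if Odd c then
    Nat.doubleFactorial (2 * (c / 2) - 1) * (2 * ((c / 2 : ℕ) : ℚ) + 1) ^ (((c / 2 : ℕ) : ℤ) - 1)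
    else 0
  have hg : ∀ V : Finset (Fin (2 * k)),
      ((tightMatroids (V : Set (Fin (2 * k)))).ncard : ℚ) = g V.card := by
    intro V
    rcases Nat.even_or_odd V.card with h | h
    · simp [g, tightMatroids_eq_empty V h, Nat.not_odd_iff_even.2 h]
    · obtain ⟨j, hj⟩ := h
      have h2 : (2 * j + 1) / 2 = j := by omega
      have h3 : Odd (2 * j + 1) := ⟨j, rfl⟩
      rw [cast_ncard_tightMatroids V j hj, hj]
      simp only [g, h2, if_pos h3]
  have h := congrArg (Nat.cast (R := ℚ)) (two_mul_ncard_isNearTight (α := Fin (2 * k)))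
  push_cast at h
  rw [h]
  have h1 : ∀ V : Finset (Fin (2 * k)), ((tightMatroids (V : Set (Fin (2 * k)))).ncard : ℚ)
      * (tightMatroids (V : Set (Fin (2 * k)))ᶜ).ncard = g V.card * g (2 * k - V.card) := by
    intro V
    rw [← Finset.coe_compl, hg, hg, Finset.card_compl, Fintype.card_fin]
  simp_rw [h1]
  rw [← Finset.powerset_univ, Finset.sum_powerset_apply_card (fun c => g c * g (2 * k - c)),
    Finset.card_univ, Fintype.card_fin, sum_range_odd]
  · refine Finset.sum_congr rfl fun a ha => ?_
    rw [Finset.mem_range] at ha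
    -- The two sides of the split have `2 a + 1` and `2 b + 1` elements.
    obtain ⟨b, rfl⟩ : ∃ b, k = a + b + 1 := ⟨k - a - 1, by omega⟩
    have h2 : 2 * (a + b + 1) - (2 * a + 1) = 2 * b + 1 := by omega
    have h3 : ∀ a, (2 * a + 1) / 2 = a := by omega
    have h4 : ∀ a, Odd (2 * a + 1) := fun a => ⟨a, rfl⟩
    -- For `b = 0` both sides truncate to `0`, and `0‼ = 1` agrees with the convention `(-1)‼ = 1`.
    have h5 : 2 * (a + b + 1) - 2 * a - 3 = 2 * b - 1 := by omega
    have h6 : (2 * ((a + b + 1 : ℕ) : ℚ) - 2 * (a : ℚ) - 1) = 2 * b + 1 := by push_cast; ring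
    have h7 : (((a + b + 1 : ℕ) : ℤ) - (a : ℤ) - 2) = b - 1 := by push_cast; ring
    simp only [g, h2, h3, if_pos (h4 _), h5, h6, h7, nsmul_eq_mul]
    ring
  · intro a
    simp [g]

theorem eRank_eq_natCast_iff [M.Finite] (r : ℕ) : M.eRank = (r : ℕ∞) ↔ M.eRank.toNat = r := by
  have := M.eRank_ne_top_iff.2 inferInstance
  generalize M.eRank = x at *
  lift x to ℕ using this
  simp

theorem ncard_simpleQuasiSP_eq (k : ℕ) :
    (simpleQuasiSP (2 * k) (k + 1)).ncard = E k +
      {M : Matroid (Fin (2 * k)) | IsNearTight M ∧ ¬ IsSeriesParallel M}.ncard := by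
  rw [E, ← ncard_union_eq]
  · congr 1
    ext M
    simp only [simpleQuasiSP, simpleSP, mem_union, Set.mem_ofPred_eq, isQuasiSeriesParallel_iff,
      eRank_eq_natCast_iff]
    constructor
    · rintro ⟨h1, h2, h3, h4⟩
      by_cases h : IsSeriesParallel M
      · exact Or.inl ⟨h1, h2, h3, h⟩
      · refine Or.inr ⟨⟨h1, h3, h4, ?_⟩, h⟩
        rw [h1, h2, ncard_univ, Nat.card_fin]
        ring
    · rintro (⟨h1, h2, h3, h4⟩ | ⟨⟨h1, h2, h3, h4⟩, -⟩)
      · exact ⟨h1, h2, h3, (isSeriesParallel_iff.1 h4).1⟩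
      · rw [h1, ncard_univ, Nat.card_fin] at h4
        exact ⟨h1, by omega, h2, h3⟩
  · exact disjoint_left.2 fun M h1 h2 => h2.2 h1.2.2.2

end TwoComponents

/-! ### Arbitrary reducible matroids from simple ones. -/

section Simplification

variable {α β : Type*} {M : Matroid α} {N : Matroid β} {e f : α} {S : Set α} {T : Set β}

/-- The simple series-parallel reducible matroids of a given rank and ground set. -/
def simpleReducible (S : Set α) (r : ℕ) : Set (Matroid α) :=
  {M | M.E = S ∧ M.eRank = (r : ℕ∞) ∧ IsSimple M ∧ IsSPReducible M}

theorem IsSPReducible.of_map {g : α → β} {hg : InjOn g M.E} (h : IsSPReducible (M.map g hg)) :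
    IsSPReducible M := by
  rcases isEmpty_or_nonempty α with hα | hα
  · rw [ground_eq_empty_iff.1 (eq_empty_of_isEmpty M.E)]
    exact .empty
  have hinv : LeftInvOn (Function.invFunOn g M.E) g M.E := hg.leftInvOn_invFunOn
  have hinj : InjOn (Function.invFunOn g M.E) (M.map g hg).E := by
    rintro _ ⟨a, ha, rfl⟩ _ ⟨b, hb, rfl⟩ h
    rw [hinv ha, hinv hb] at h
    rw [h]
  have := h.map _ hinj
  convert this
  refine ext_indep ?_ fun I hI => ?_
  · rw [map_ground, map_ground, hinv.image_image]
  · rw [map_indep_iff]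
    constructor
    · intro h
      exact ⟨_, ⟨I, h, rfl⟩, (hinv.mono hI).image_image.symm⟩
    · rintro ⟨_, ⟨J, hJ, rfl⟩, rfl⟩
      rwa [(hinv.mono hJ.subset_ground).image_image]

theorem IsSimple.map (h : IsSimple M) (g : α → β) (hg : InjOn g M.E) :
    IsSimple (M.map g hg) := by
  rw [isSimple_iff_pair] at h ⊢
  constructor
  · intro e he
    obtain ⟨a, ha, rfl⟩ := he.mem_ground
    exact h.1 a ((map_isLoop_iff ha).1 he)
  · intro e f hef hC
    obtain ⟨a, ha, rfl⟩ := hC.subset_ground (by simp : e ∈ ({e, f} : Set β))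
    obtain ⟨b, hb, rfl⟩ := hC.subset_ground (by simp : f ∈ ({g a, f} : Set β))
    have hab : a ≠ b := fun h => hef (congrArg g h)
    have hind : M.Indep {a, b} := by
      by_contra hdep
      have hdep : M.Dep {a, b} := ⟨hdep, by simp [insert_subset_iff, ha, hb]⟩
      have ha' := isNonloop_of_not_isLoop ha (h.1 a)
      have hb' := isNonloop_of_not_isLoop hb (h.1 b)
      exact h.2 a b hab ((ha'.closure_eq_closure_iff_isCircuit_of_ne hab).1
        ((ha'.closure_eq_closure_iff_eq_or_dep hb').2 (Or.inr hdep.not_indep)))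
    refine hC.not_indep ?_
    rw [← image_pair]
    exact hind.map g hg

theorem IsSimple.of_map {g : α → β} {hg : InjOn g M.E} (h : IsSimple (M.map g hg)) :
    IsSimple M := by
  rw [isSimple_iff_pair] at h ⊢
  refine ⟨fun e he => h.1 _ ((map_isLoop_iff he.mem_ground).2 he), fun e f hef hC => ?_⟩
  have hE := hC.subset_ground
  refine h.2 (g e) (g f) (fun h' => hef (hg (hE (by simp)) (hE (by simp)) h')) ?_
  rw [← image_pair]
  exact isCircuit_map hg hC

theorem ncard_simpleReducible_image (g : α → β) (hg : InjOn g S) (r : ℕ) :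
    (simpleReducible (g '' S) r).ncard = (simpleReducible S r).ncard := by
  classical
  have hinj : InjOn (fun M => if h : InjOn g M.E then M.map g h else emptyOn β)
      (simpleReducible S r) := by
    rintro M ⟨rfl, -⟩ N ⟨hN, -⟩ h
    have hg' : InjOn g N.E := hN ▸ hg
    simp only [dif_pos hg, dif_pos hg'] at h
    refine ext_indep hN.symm fun I hI => ?_
    rw [← map_image_indep_iff (hf := hg) hI, h, map_image_indep_iff (hN ▸ hI)]
  rw [← hinj.ncard_image]
  congr 1
  ext N
  constructor
  · rintro ⟨hE, h1, h2, h3⟩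
    have hg' : InjOn g (N.comapOn S g).E := by rwa [comapOn_ground_eq]
    have hmap : (N.comapOn S g).map g hg' = N := by
      refine ext_indep (by simp [hE]) fun I hI => ?_
      rw [map_indep_iff]
      constructor
      · rintro ⟨J, hJ, rfl⟩
        exact (comapOn_indep_iff.1 hJ).1
      · intro h
        obtain ⟨J, hJ, rfl⟩ := subset_image_iff.1 hI
        exact ⟨J, comapOn_indep_iff.2 ⟨h, hg.mono hJ, hJ⟩, rfl⟩
    rw [← hmap] at h1 h2 h3
    refine ⟨N.comapOn S g, ⟨rfl, ?_, h2.of_map, h3.of_map⟩, ?_⟩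
    · rwa [eRank_map] at h1
    · simp only [dif_pos hg']
      exact hmap
  · rintro ⟨M, ⟨rfl, h1, h2, h3⟩, rfl⟩
    simp only [dif_pos hg]
    exact ⟨rfl, by rw [eRank_map, h1], h2.map g hg, h3.map g hg⟩

theorem ncard_simpleReducible_eq [Finite α] (S : Set α) (r : ℕ) :
    (simpleReducible S r).ncard = (simpleQuasiSP S.ncard r).ncard := by
  have h1 : simpleQuasiSP S.ncard r = simpleReducible univ r := by
    ext M
    simp only [simpleQuasiSP, simpleReducible, Set.mem_ofPred_eq, isQuasiSeriesParallel_iff]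
  let u := (Finite.equivFinOfCardEq (Nat.card_coe_set_eq S)).symm
  have h2 : S = (fun i => (u i : α)) '' univ := by
    rw [image_univ]
    ext a
    constructor
    · intro ha
      exact ⟨u.symm ⟨a, ha⟩, by simp⟩
    · rintro ⟨i, rfl⟩
      exact (u i).2
  rw [h1]
  conv_lhs => rw [h2]
  exact ncard_simpleReducible_image _ (fun i _ j _ h => u.injective (Subtype.ext h)) r

/-- If two sets on which `g` is injective have the same image under `g`, and the fibers of `g` are
made of parallel elements, then independence of one set implies that of the other. -/
theorem Indep.of_image_eq [M.Finite] {g : α → β}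
    (hg : ∀ a b, g a = g b → M.closure {a} = M.closure {b}) {I J : Set α} (hI : M.Indep I)
    (hJE : J ⊆ M.E) (hgI : InjOn g I) (hgJ : InjOn g J) (h : g '' I = g '' J) : M.Indep J := by
  have hsub : ∀ {I J : Set α}, I ⊆ M.E → g '' I = g '' J → M.closure I ⊆ M.closure J := by
    intro I J hI h
    refine closure_subset_closure_of_subset_closure fun a ha => ?_
    obtain ⟨b, hb, hab⟩ : g a ∈ g '' J := h ▸ mem_image_of_mem g ha
    have h1 : a ∈ M.closure {b} := (hg _ _ hab) ▸ M.mem_closure_self a (hI ha)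
    exact M.closure_subset_closure (singleton_subset_iff.2 hb) h1
  have hcl : M.closure I = M.closure J := (hsub hI.subset_ground h).antisymm (hsub hJE h.symm)
  -- Equal closures give equal ranks, and both sets have the size of their common image, so `J` has
  -- full rank.
  rw [indep_iff_eRk_eq_encard_of_finite (M.ground_finite.subset hJE), ← eRk_closure_eq, ← hcl,
    eRk_closure_eq, hI.eRk_eq_encard, ← hgI.encard_image, h, hgJ.encard_image]

/-- Two elements are related if they are parallel, and `none` is related to the loops. -/
def parallelSetoid (M : Matroid α) : Setoid (Option α) :=
  Setoid.ker fun o => o.elim (M.closure ∅) fun a => M.closure {a}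

/-- The class of an element with respect to a setoid on `Option α`. -/
def classMap (s : Setoid (Option α)) (a : α) : Quotient s := Quotient.mk s (some a)

variable {s : Setoid (Option α)} {L : Matroid (Quotient s)}

theorem classMap_eq_iff {a b : α} : classMap s a = classMap s b ↔ s (some a) (some b) :=
  Quotient.eq

theorem classMap_eq_none_iff {a : α} : classMap s a = Quotient.mk s none ↔ s (some a) none :=
  Quotient.eq

theorem classMap_out {q : Quotient s} (hq : q ≠ Quotient.mk s none) :
    ∃ a, q.out = some a ∧ classMap s a = q := by
  cases h : q.out with
  | none => exact absurd (by rw [← h, Quotient.out_eq]) hq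
  | some a => exact ⟨a, rfl, by rw [classMap, ← h, Quotient.out_eq]⟩

/-- A set of representatives for the classes other than that of `none`. -/
def representatives (s : Setoid (Option α)) : Set α :=
  {a | (classMap s a).out = some a ∧ classMap s a ≠ Quotient.mk s none}

theorem injOn_representatives : InjOn (classMap s) (representatives s) := by
  intro a ha b hb h
  have := ha.1
  rw [h, hb.1] at this
  exact (Option.some_injective _ this).symm

theorem injOn_restrict_ground (M : Matroid α) :
    InjOn (classMap s) (M ↾ representatives s).E := by
  rw [restrict_ground_eq]
  exact injOn_representatives

theorem exists_representative {q : Quotient s} (hq : q ≠ Quotient.mk s none) :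
    ∃ a ∈ representatives s, classMap s a = q := by
  obtain ⟨a, h1, h2⟩ := classMap_out hq
  exact ⟨a, ⟨by rw [h2, h1], by rwa [h2]⟩, h2⟩

theorem image_representatives {J : Set (Quotient s)} (hJ : J ⊆ {Quotient.mk s none}ᶜ) :
    ∃ I ⊆ representatives s, classMap s '' I = J := by
  refine ⟨representatives s ∩ classMap s ⁻¹' J, inter_subset_left, ?_⟩
  rw [image_inter_preimage, inter_eq_right]
  intro q hq
  obtain ⟨a, ha, rfl⟩ := exists_representative (hJ hq)
  exact ⟨a, ha, rfl⟩

theorem IsSimple.indep_pair (h : IsSimple M) (he : e ∈ M.E) (hf : f ∈ M.E) : M.Indep {e, f} := by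
  rcases eq_or_ne e f with rfl | hne
  · have := h.1
    rw [pair_eq_singleton]
    exact indep_singleton.2 (isNonloop_of_loopless he)
  · rw [isSimple_iff_pair] at h
    by_contra hdep
    have he' := isNonloop_of_not_isLoop he (h.1 e)
    exact h.2 e f hne ((he'.closure_eq_closure_iff_isCircuit_of_ne hne).1
      ((he'.closure_eq_closure_iff_eq_or_dep (isNonloop_of_not_isLoop hf (h.1 f))).2 (Or.inr hdep)))

/-- The matroid on `α` whose simplification is `L`. -/
noncomputable def pullback (L : Matroid (Quotient s)) : Matroid α :=
  L.comapOn univ (classMap s)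

theorem pullback_indep_iff {I : Set α} :
    (pullback L).Indep I ↔ L.Indep (classMap s '' I) ∧ InjOn (classMap s) I := by
  simp [pullback]

theorem pullback_ground : (pullback L).E = univ := rfl

/-- Every set of classes in the ground set is the injective image of a set of representatives, so
the pullback records its independence. -/
theorem pullback_injOn {L' : Matroid (Quotient s)} (hL : L.E = {Quotient.mk s none}ᶜ)
    (hL' : L'.E = {Quotient.mk s none}ᶜ) (h : pullback L = pullback L') : L = L' := by
  refine ext_indep (hL.trans hL'.symm) fun J hJ => ?_
  obtain ⟨I, hI, rfl⟩ := image_representatives (hL ▸ hJ)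
  have h1 := pullback_indep_iff (L := L) (I := I)
  have h2 := pullback_indep_iff (L := L') (I := I)
  have h3 : InjOn (classMap s) I := injOn_representatives.mono hI
  simp only [h3, and_true] at h1 h2
  rw [← h1, h, h2]

theorem pullback_isLoop_iff (hL : L.E = {Quotient.mk s none}ᶜ) (hs : IsSimple L) {a : α} :
    (pullback L).IsLoop a ↔ classMap s a = Quotient.mk s none := by
  rw [← singleton_dep, ← not_indep_iff (by simp [pullback_ground]), pullback_indep_iff,
    image_singleton, not_and]
  simp only [injOn_singleton, not_true_eq_false, imp_false, indep_singleton]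
  have := hs.1
  constructor
  · intro h
    by_contra hne
    exact h (isNonloop_of_loopless (by rw [hL]; exact hne))
  · intro h hn
    have := hn.mem_ground
    rw [hL] at this
    exact this h

theorem pullback_closure_eq_iff (hL : L.E = {Quotient.mk s none}ᶜ) (hs : IsSimple L) {a b : α} :
    (pullback L).closure {a} = (pullback L).closure {b} ↔ classMap s a = classMap s b := by
  have hE : ∀ a, a ∈ (pullback L).E := fun a => mem_univ a
  by_cases ha : (pullback L).IsLoop a
  · rw [ha.closure, eq_comm, ← isLoop_iff_closure_eq_loops (hE b), pullback_isLoop_iff hL hs,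
      (pullback_isLoop_iff hL hs).1 ha, eq_comm]
  by_cases hb : (pullback L).IsLoop b
  · rw [hb.closure, ← isLoop_iff_closure_eq_loops (hE a), pullback_isLoop_iff hL hs,
      (pullback_isLoop_iff hL hs).1 hb]
  rw [(isNonloop_of_not_isLoop (hE a) ha).closure_eq_closure_iff_eq_or_dep
    (isNonloop_of_not_isLoop (hE b) hb), pullback_indep_iff]
  rw [pullback_isLoop_iff hL hs] at ha hb
  have h1 := hs.indep_pair (e := classMap s a) (f := classMap s b) (by rw [hL]; exact ha)
    (by rw [hL]; exact hb)
  rw [image_pair]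
  simp only [h1, true_and]
  constructor
  · rintro (rfl | h)
    · rfl
    · by_contra hne
      refine h ?_
      rintro x (rfl | rfl) y (rfl | rfl) hxy
      · rfl
      · exact absurd hxy hne
      · exact absurd hxy.symm hne
      · rfl
  · intro h
    by_contra! hcon
    exact hcon.1 (hcon.2 (by simp) (by simp) h)

/-- As `L` is simple on all classes except that of `none`, elements of the excluded class are loops
and those of different other classes are not parallel. -/
theorem parallelSetoid_pullback (hL : L.E = {Quotient.mk s none}ᶜ) (hs : IsSimple L) :
    parallelSetoid (pullback L) = s := by
  have hE : ∀ a, a ∈ (pullback L).E := fun a => mem_univ a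
  have h0 : ∀ a, (pullback L).closure {a} = (pullback L).closure ∅ ↔ s (some a) none := by
    intro a
    rw [← classMap_eq_none_iff, ← pullback_isLoop_iff hL hs, isLoop_iff_closure_eq_loops (hE a)]
    rfl
  ext o o'
  rw [parallelSetoid, Setoid.ker_def]
  rcases o with _ | a <;> rcases o' with _ | b
  · exact iff_of_true rfl (s.refl _)
  · exact eq_comm.trans ((h0 b).trans ⟨s.symm, s.symm⟩)
  · exact h0 a
  · exact (pullback_closure_eq_iff hL hs).trans classMap_eq_iff

theorem eRank_pullback (hL : L.E = {Quotient.mk s none}ᶜ) : (pullback L).eRank = L.eRank := by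
  obtain ⟨B, hB⟩ := (pullback L).exists_isBase
  have hsurj : SurjOn (classMap s) univ L.E := by
    intro q hq
    rw [hL] at hq
    obtain ⟨a, -, rfl⟩ := exists_representative hq
    exact ⟨a, mem_univ a, rfl⟩
  obtain ⟨h1, h2, -⟩ := (comapOn_isBase_iff_of_surjOn hsurj).1 hB
  rw [← hB.encard_eq_eRank, ← h1.encard_eq_eRank, h2.encard_image]

theorem map_restrict_pullback (hL : L.E = {Quotient.mk s none}ᶜ) :
    (pullback L ↾ representatives s).map (classMap s) (injOn_restrict_ground _) = L := by
  refine ext_indep ?_ fun J hJ => ?_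
  · rw [map_ground, restrict_ground_eq, hL]
    refine Subset.antisymm ?_ fun q hq => exists_representative hq
    rintro _ ⟨a, ha, rfl⟩
    exact ha.2
  · obtain ⟨I, hI, rfl⟩ := subset_image_iff.1 hJ
    rw [map_image_indep_iff hI, restrict_indep_iff, pullback_indep_iff]
    exact ⟨fun h => h.1.1, fun h => ⟨⟨h, injOn_representatives.mono hI⟩, hI⟩⟩

theorem isSPReducible_pullback [Finite α] (hL : L.E = {Quotient.mk s none}ᶜ) (hs : IsSimple L)
    (h : IsSPReducible L) : IsSPReducible (pullback L) := by
  have hfin : (pullback L).Finite := ⟨(pullback L).E.toFinite⟩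
  rw [← map_restrict_pullback hL] at h
  refine IsSPReducible.of_restrict (subset_univ _) h.of_map fun e he => ?_
  by_cases hn : classMap s e = Quotient.mk s none
  · exact Or.inl ((pullback_isLoop_iff hL hs).2 hn)
  · right
    obtain ⟨f, hf, hfe⟩ := exists_representative hn
    have hne : e ≠ f := fun h => he.2 (h ▸ hf)
    refine ⟨f, hf, ?_⟩
    rw [← (isNonloop_of_not_isLoop (mem_univ e)
      (mt (pullback_isLoop_iff hL hs).1 hn)).closure_eq_closure_iff_isCircuit_of_ne hne,
      pullback_closure_eq_iff hL hs, hfe]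

/-- Here `L` is the restriction of `M` to one representative of each parallel class, transported to
the classes. -/
theorem exists_pullback_eq [Finite α] (hE : M.E = univ) (h : IsSPReducible M) :
    ∃ L : Matroid (Quotient (parallelSetoid M)), L.E = {Quotient.mk _ none}ᶜ ∧ IsSimple L ∧
      IsSPReducible L ∧ pullback L = M := by
  have hfin : M.Finite := ⟨M.E.toFinite⟩
  set s := parallelSetoid M with hs
  have hcl : ∀ a b, classMap s a = classMap s b → M.closure {a} = M.closure {b} :=
    fun a b h => classMap_eq_iff.1 h
  have hloop : ∀ a, M.IsLoop a ↔ classMap s a = Quotient.mk s none := by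
    intro a
    rw [isLoop_iff_closure_eq_loops (hE ▸ mem_univ a), classMap_eq_none_iff]
    rfl
  have hR : representatives s ⊆ M.E := hE ▸ subset_univ _
  have hinj : ∀ I, M.Indep I → InjOn (classMap s) I := by
    intro I hI a ha b hb hab
    by_contra hne
    refine hI.notMem_closure_sdiff_of_mem ha ?_
    have h1 : a ∈ M.closure {b} := hcl a b hab ▸ M.mem_closure_self a (hE ▸ mem_univ a)
    exact M.closure_subset_closure (by simpa using ⟨hb, fun h => hne h.symm⟩) h1
  have hsimple : IsSimple (M ↾ representatives s) := by
    rw [isSimple_iff_pair]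
    constructor
    · intro a ha
      have haR : a ∈ representatives s := ha.mem_ground
      rw [restrict_isLoop_iff] at ha
      rcases ha.2 with h | h
      · exact haR.2 ((hloop a).1 h)
      · exact h (hR haR)
    · intro a b hab hC
      rw [restrict_isCircuit_iff hR] at hC
      have haR := hC.2 (by simp : a ∈ ({a, b} : Set α))
      have hbR := hC.2 (by simp : b ∈ ({a, b} : Set α))
      have ha : M.IsNonloop a := isNonloop_of_not_isLoop (hR haR) fun h => haR.2 ((hloop a).1 h)
      have := (ha.closure_eq_closure_iff_isCircuit_of_ne hab).2 hC.1
      exact hab (injOn_representatives haR hbR (classMap_eq_iff.2 this))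
  have hL : ((M ↾ representatives s).map (classMap s) (injOn_restrict_ground _)).E
      = {Quotient.mk s none}ᶜ := by
    rw [map_ground, restrict_ground_eq]
    refine Subset.antisymm ?_ fun q hq => exists_representative hq
    rintro _ ⟨a, ha, rfl⟩
    exact ha.2
  refine ⟨_, hL, hsimple.map _ _, (h.restrict hR).map _ _, ?_⟩
  refine ext_indep (by rw [pullback_ground, hE]) fun I _ => ?_
  rw [pullback_indep_iff, map_indep_iff]
  constructor
  · rintro ⟨⟨J, hJ, hIJ⟩, hI⟩
    rw [restrict_indep_iff] at hJ
    exact Indep.of_image_eq hcl hJ.1 (hE ▸ subset_univ _) (hinj J hJ.1) hI hIJ.symm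
  · intro hI
    refine ⟨?_, hinj I hI⟩
    obtain ⟨J, hJ, hJI⟩ := image_representatives (s := s) (J := classMap s '' I) (by
      rintro _ ⟨a, ha, rfl⟩ h
      exact (hI.isNonloop_of_mem ha).not_isLoop ((hloop a).2 h))
    refine ⟨J, restrict_indep_iff.2 ⟨?_, hJ⟩, hJI.symm⟩
    exact Indep.of_image_eq hcl hI (hE ▸ subset_univ _) (hinj I hI)
      (injOn_representatives.mono hJ) hJI.symm

/-- The series-parallel reducible matroids of a given rank on a whole type. -/
def reducible (α : Type*) (r : ℕ) : Set (Matroid α) :=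
  {M | M.E = univ ∧ M.eRank = (r : ℕ∞) ∧ IsSPReducible M}

/-- With loops and parallel classes prescribed, `pullback` is a bijection from the simple matroids
on the classes; the `- 1` discards the class of `none`. -/
theorem ncard_reducible_fiber [Finite α] (s : Setoid (Option α)) (r : ℕ) :
    {M ∈ reducible α r | parallelSetoid M = s}.ncard
      = (simpleQuasiSP (Nat.card (Quotient s) - 1) r).ncard := by
  have hcard : ({Quotient.mk s none}ᶜ : Set (Quotient s)).ncard = Nat.card (Quotient s) - 1 := by
    rw [ncard_compl, ncard_singleton]
  rw [← hcard, ← ncard_simpleReducible_eq]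
  have hinj : InjOn (pullback (s := s)) (simpleReducible {Quotient.mk s none}ᶜ r) :=
    fun L hL L' hL' h => pullback_injOn hL.1 hL'.1 h
  rw [← hinj.ncard_image]
  congr 1
  ext M
  constructor
  · rintro ⟨⟨h1, h2, h3⟩, rfl⟩
    obtain ⟨L, hL, hs, hr, h⟩ := exists_pullback_eq h1 h3
    refine ⟨L, ⟨hL, ?_, hs, hr⟩, h⟩
    rw [← eRank_pullback hL, h, h2]
  · rintro ⟨L, ⟨hL, h1, h2, h3⟩, rfl⟩
    exact ⟨⟨rfl, by rw [eRank_pullback hL, h1], isSPReducible_pullback hL h2 h3⟩,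
      parallelSetoid_pullback hL h2⟩

theorem ncard_reducible_eq_sum [Finite α] [Fintype (Setoid (Option α))] (r : ℕ) :
    (reducible α r).ncard
      = ∑ s : Setoid (Option α), (simpleQuasiSP (Nat.card (Quotient s) - 1) r).ncard := by
  classical
  have := Fintype.ofFinite (Matroid α)
  simp_rw [← ncard_reducible_fiber, ncard_eq_toFinset_card']
  rw [Finset.card_eq_sum_card_fiberwise (f := parallelSetoid) (t := Finset.univ)
    (fun _ _ => Finset.mem_coe.2 (Finset.mem_univ _))]
  refine Finset.sum_congr rfl fun s _ => congrArg Finset.card ?_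
  ext M
  simp

/-- Reducibility is self-dual and duality exchanges rank and corank. This is the source of
palindromicity. -/
theorem ncard_reducible_dual [Finite α] {r t : ℕ} (h : r + t = Nat.card α) :
    (reducible α r).ncard = (reducible α t).ncard := by
  have hinj : Function.Injective (fun M : Matroid α => M✶) := dual_injective
  rw [← ncard_image_of_injective _ hinj]
  congr 1
  have hfin : ∀ M : Matroid α, M.Finite := fun M => ⟨M.E.toFinite⟩
  have key : ∀ {r t : ℕ}, r + t = Nat.card α → ∀ M ∈ reducible α r, M✶ ∈ reducible α t := by
    rintro r t h M ⟨h1, h2, h3⟩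
    refine ⟨h1, ?_, h3.dual⟩
    have h4 := M.eRank_add_eRank_dual
    rw [h1, h2, encard_univ, ENat.card_eq_coe_natCard, ← h, Nat.cast_add] at h4
    exact WithTop.add_left_cancel (ENat.natCast_ne_top r) h4
  ext M
  constructor
  · rintro ⟨M, hM, rfl⟩
    exact key h M hM
  · intro hM
    exact ⟨M✶, key (by omega) M hM, dual_dual M⟩

end Simplification

/-! ### Kazhdan–Lusztig polynomials over partition lattices. -/

section PartitionLattice

open Polynomial

universe v w

variable {α : Type*} {V : Type v} {W : Type w} {M : Matroid α}

instance [Finite V] : Finite (Setoid V) :=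
  Finite.of_injective (fun s : Setoid V => s.r) fun _ _ h => Setoid.ext fun a b => by
    exact iff_of_eq (congrFun (congrFun h a) b)

/-- The polynomial with coefficients the numbers of simple quasi series-parallel matroids
on `m` elements. -/
noncomputable def simplePoly (m : ℕ) : ℤ[X] :=
  ∑ r ∈ Finset.range (m + 1), C ((simpleQuasiSP m r).ncard : ℤ) * X ^ (m - r)

theorem simpleQuasiSP_eq_empty {m r : ℕ} (h : m < r) : simpleQuasiSP m r = ∅ := by
  rw [eq_empty_iff_forall_notMem]
  rintro M ⟨h1, h2, -⟩
  have := M.eRank_le_encard_ground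
  rw [h1, h2, encard_univ, ENat.card_eq_coe_natCard, Nat.card_fin] at this
  exact absurd (Nat.cast_le.1 this) (by omega)

theorem simpleQuasiSP_eq_empty_of_le {m r : ℕ} (hm : 0 < m) (h : 2 * r ≤ m) :
    simpleQuasiSP m r = ∅ := by
  rw [eq_empty_iff_forall_notMem]
  rintro M ⟨h1, h2, h3, h4⟩
  have hfin : M.Finite := ⟨M.E.toFinite⟩
  have h5 := (isQuasiSeriesParallel_iff.1 h4).ncard_add_one_le h3
    (by rw [h1]; exact ⟨⟨0, hm⟩, mem_univ _⟩)
  rw [h1, h2, ncard_univ, Nat.card_fin, ENat.toNat_natCast] at h5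
  omega

theorem coeff_simplePoly {m i : ℕ} (hi : i ≤ m) :
    (simplePoly m).coeff i = (simpleQuasiSP m (m - i)).ncard := by
  rw [simplePoly, finsetSum_coeff, Finset.sum_eq_single (m - i)]
  · rw [coeff_C_mul, coeff_X_pow, if_pos (by omega), mul_one]
  · intro r hr hne
    rw [Finset.mem_range] at hr
    rw [coeff_C_mul, coeff_X_pow, if_neg (by omega), mul_zero]
  · intro h
    exact absurd (Finset.mem_range.2 (by omega)) h

/-- With `r = m - i`, the bound `m ≤ 2 r - 1` becomes `2 i < m`, the degree condition on
Kazhdan–Lusztig polynomials. -/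
theorem coeff_simplePoly_eq_zero {m i : ℕ} (hm : 0 < m) (hi : m ≤ 2 * i) :
    (simplePoly m).coeff i = 0 := by
  by_cases him : i ≤ m
  · rw [coeff_simplePoly him, simpleQuasiSP_eq_empty_of_le hm (by omega)]
    simp
  · rw [simplePoly, finsetSum_coeff]
    refine Finset.sum_eq_zero fun r _ => ?_
    rw [coeff_C_mul, coeff_X_pow, if_neg (by omega), mul_zero]

theorem simplePoly_zero : simplePoly 0 = 1 := by
  have : simpleQuasiSP 0 0 = {emptyOn (Fin 0)} := by
    ext M
    have hM : M = emptyOn (Fin 0) := ground_eq_empty_iff.1 (eq_empty_of_isEmpty M.E)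
    subst hM
    simp only [simpleQuasiSP, Set.mem_ofPred_eq, mem_singleton_iff, iff_true,
      isQuasiSeriesParallel_iff, isSimple_iff_pair]
    exact ⟨(eq_empty_of_isEmpty univ).symm, by simp,
      ⟨fun e => e.elim0, fun e => e.elim0⟩, .empty⟩
  simp [simplePoly, this]

/-- An equivalence of types induces an isomorphism of the lattices of setoids. -/
def setoidCongr (e : V ≃ W) : Setoid V ≃o Setoid W where
  toFun s := s.comap e.symm
  invFun s := s.comap e
  left_inv s := by ext; simp [Setoid.comap_rel]
  right_inv s := by ext; simp [Setoid.comap_rel]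
  map_rel_iff' {s t} := by
    constructor
    · intro h a b hab
      have h1 : s (e.symm (e a)) (e.symm (e b)) → t (e.symm (e a)) (e.symm (e b)) := @h (e a) (e b)
      simp only [Equiv.symm_apply_apply] at h1
      exact h1 hab
    · intro h a b hab
      exact h hab

theorem card_quotient_setoidCongr (e : V ≃ W) (s : Setoid V) :
    Nat.card (Quotient (setoidCongr e s)) = Nat.card (Quotient s) := by
  refine (Nat.card_congr (Quotient.congr e fun a b => ?_)).symm
  change s a b ↔ s (e.symm (e a)) (e.symm (e b))
  simp

/-- The sum over the partitions of a finite type that corresponds to the `Z`-polynomial. -/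
noncomputable def partitionPoly (V : Type v) [Fintype (Setoid V)] : ℤ[X] :=
  ∑ s : Setoid V, X ^ (Nat.card V - Nat.card (Quotient s)) * simplePoly (Nat.card (Quotient s) - 1)

theorem card_quotient_le [Finite V] (s : Setoid V) : Nat.card (Quotient s) ≤ Nat.card V :=
  Nat.card_le_card_of_surjective _ Quotient.mk_surjective

theorem card_quotient_pos [Finite V] [Nonempty V] (s : Setoid V) : 0 < Nat.card (Quotient s) :=
  have : Nonempty (Quotient s) := ⟨Quotient.mk s (Classical.arbitrary V)⟩
  Nat.card_pos

/-- One of the `m + 1` points plays the role of `none`, so partitions of `V` encode loops and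
parallel classes on `m` elements. With `b` blocks and rank `r`, the exponents add up to `(m + 1 - b)
+ (b - 1 - r) = m - r`. -/
theorem partitionPoly_eq [Finite V] [Fintype (Setoid V)] {m : ℕ} (hV : Nat.card V = m + 1) :
    partitionPoly V
      = ∑ r ∈ Finset.range (m + 1), C ((reducible (Fin m) r).ncard : ℤ) * X ^ (m - r) := by
  classical
  have := Fintype.ofFinite (Setoid (Option (Fin m)))
  have hne : Nonempty V := (Nat.card_pos_iff.1 (by omega)).1
  let e : V ≃ Option (Fin m) := (Finite.equivFinOfCardEq hV).trans (finSuccEquiv m)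
  have h : ∀ r, ((reducible (Fin m) r).ncard : ℤ)
      = ∑ s : Setoid V, ((simpleQuasiSP (Nat.card (Quotient s) - 1) r).ncard : ℤ) := by
    intro r
    rw [ncard_reducible_eq_sum, Nat.cast_sum]
    refine (Fintype.sum_equiv (setoidCongr e).toEquiv _ _ fun s => ?_).symm
    exact congrArg _ (by rw [← card_quotient_setoidCongr e s]; rfl)
  simp_rw [h, map_sum, Finset.sum_mul]
  rw [Finset.sum_comm, partitionPoly]
  refine Finset.sum_congr rfl fun s _ => ?_
  have h1 := card_quotient_le s
  have h2 := card_quotient_pos s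
  rw [simplePoly, Finset.mul_sum]
  have hsub : Finset.range (Nat.card (Quotient s) - 1 + 1) ⊆ Finset.range (m + 1) :=
    Finset.range_subset_range.2 (by omega)
  rw [← Finset.sum_subset hsub]
  · refine Finset.sum_congr rfl fun r hr => ?_
    rw [Finset.mem_range] at hr
    rw [mul_left_comm, ← pow_add]
    congr 2
    omega
  · intro r _ hr
    rw [Finset.mem_range] at hr
    rw [simpleQuasiSP_eq_empty (by omega)]
    simp

theorem coeff_partitionPoly_sub [Finite V] [Fintype (Setoid V)] {m i : ℕ}
    (hV : Nat.card V = m + 1) (hi : i ≤ m) :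
    (partitionPoly V).coeff (m - i) = (partitionPoly V).coeff i := by
  have key : ∀ i ≤ m, (partitionPoly V).coeff i = (reducible (Fin m) (m - i)).ncard := by
    intro i hi
    rw [partitionPoly_eq hV, finsetSum_coeff, Finset.sum_eq_single (m - i)]
    · rw [coeff_C_mul, coeff_X_pow, if_pos (by omega), mul_one]
    · intro r hr hne
      rw [Finset.mem_range] at hr
      rw [coeff_C_mul, coeff_X_pow, if_neg (by omega), mul_zero]
    · intro h
      exact absurd (Finset.mem_range.2 (by omega)) h
  rw [key i hi, key (m - i) (by omega), ncard_reducible_dual (t := m - i)]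
  rw [Nat.card_fin]
  omega

/-- A loopless finite matroid whose lattice of flats is the partition lattice of `V`. -/
structure IsPartitionMatroid (M : Matroid α) (V : Type v) : Prop where
  finite : M.Finite
  loopless : M.Loopless
  exists_iso : ∃ φ : {F // M.IsFlat F} ≃o Setoid V,
    ∀ F, (M.eRk F.1).toNat + Nat.card (Quotient (φ F)) = Nat.card V

theorem card_quotient_correspondence {r : Setoid V} (s : {s // r ≤ s}) :
    Nat.card (Quotient (Setoid.correspondence r s)) = Nat.card (Quotient s.1) := by
  let f : Quotient r → Quotient s.1 := Quotient.map id s.2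
  have hf : Function.Surjective f := by
    rintro ⟨a⟩
    exact ⟨Quotient.mk r a, rfl⟩
  have h : Setoid.correspondence r s = Setoid.ker f := by
    ext a b
    induction a using Quotient.ind
    induction b using Quotient.ind
    exact (Quotient.eq (r := s.1)).symm
  rw [h]
  exact Nat.card_congr (Setoid.quotientKerEquivOfSurjective f hf)

theorem isFlat_contract_iff {F G : Set α} (hF : F ⊆ M.E) :
    (M ／ F).IsFlat G ↔ M.IsFlat (G ∪ F) ∧ Disjoint G F := by
  rw [isFlat_iff_closure_eq, isFlat_iff_closure_eq, contract_closure_eq]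
  constructor
  · intro h
    have hd : Disjoint G F := by
      rw [← h]
      exact disjoint_sdiff_left
    refine ⟨?_, hd⟩
    have h1 : F ⊆ M.closure (G ∪ F) :=
      (M.subset_closure F).trans (M.closure_subset_closure subset_union_right)
    rw [← sdiff_union_of_subset h1, h]
  · rintro ⟨h, hd⟩
    rw [h, union_sdiff_right, hd.sdiff_eq_left]

theorem eRk_contract_toNat [M.Finite] {F G : Set α} (hF : F ⊆ M.E) (hG : G ⊆ M.E \ F) :
    ((M ／ F).eRk G).toNat + (M.eRk F).toNat = (M.eRk (G ∪ F)).toNat := by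
  have hfin : (M ／ F).Finite := ⟨M.ground_finite.subset sdiff_subset⟩
  have h1 := toNat_eRk_add_eRank_contract M hF
  have h2 := toNat_eRk_add_eRank_contract (M ／ F) hG
  have h3 := toNat_eRk_add_eRank_contract M (union_subset (hG.trans sdiff_subset) hF)
  rw [contract_contract, union_comm] at h2
  omega

/-- The flats of the contraction of a flat are the flats that contain it. -/
def flatsContractIso [M.Finite] (F : {F // M.IsFlat F}) :
    {G // (M ／ F.1).IsFlat G} ≃o {G : {G // M.IsFlat G} // F ≤ G} where
  toFun G := ⟨⟨G.1 ∪ F.1, ((isFlat_contract_iff F.2.subset_ground).1 G.2).1⟩, subset_union_right⟩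
  invFun G := ⟨G.1.1 \ F.1, (isFlat_contract_iff F.2.subset_ground).2
    ⟨by rw [sdiff_union_of_subset G.2]; exact G.1.2, disjoint_sdiff_left⟩⟩
  left_inv G := by
    have := ((isFlat_contract_iff F.2.subset_ground).1 G.2).2
    exact Subtype.ext (by simp [union_sdiff_right, this.sdiff_eq_left])
  right_inv G := Subtype.ext (Subtype.ext (sdiff_union_of_subset G.2))
  map_rel_iff' {G H} := by
    have := ((isFlat_contract_iff F.2.subset_ground).1 G.2).2
    constructor
    · intro h x hx
      exact (h (Or.inl hx)).resolve_right fun hxF => disjoint_left.1 this hx hxF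
    · intro h
      exact union_subset_union_left _ h

/-- The partitions above a given one are the partitions of its set of blocks, and flats of `M ／ F`
are the flats above `F`. So the class is stable under the contractions in the recursion. -/
theorem IsPartitionMatroid.contract [Finite V] (h : IsPartitionMatroid M V)
    (φ : {F // M.IsFlat F} ≃o Setoid V)
    (hφ : ∀ F, (M.eRk F.1).toNat + Nat.card (Quotient (φ F)) = Nat.card V)
    (F : {F // M.IsFlat F}) : IsPartitionMatroid (M ／ F.1) (Quotient (φ F)) := by
  have := h.finite
  let ψ : {G : {G // M.IsFlat G} // F ≤ G} ≃o {s // φ F ≤ s} :=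
    { toEquiv := φ.toEquiv.subtypeEquiv fun G => (φ.le_iff_le (x := F) (y := G)).symm
      map_rel_iff' := φ.le_iff_le }
  refine ⟨⟨M.ground_finite.subset sdiff_subset⟩, ?_,
    ((flatsContractIso F).trans ψ).trans (Setoid.correspondence (φ F)), fun G => ?_⟩
  · rw [loopless_iff, loops, contract_closure_eq, empty_union, F.2.closure, sdiff_self]
  · have h1 := hφ F
    have h2 := hφ ((flatsContractIso F) G).1
    have h3 := eRk_contract_toNat F.2.subset_ground G.2.subset_ground
    have h4 : Nat.card (Quotient ((((flatsContractIso F).trans ψ).trans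
        (Setoid.correspondence (φ F))) G)) = Nat.card (Quotient (φ ((flatsContractIso F) G).1)) :=
      card_quotient_correspondence (ψ (flatsContractIso F G))
    have h5 : (M.eRk ((flatsContractIso F) G).1.1) = M.eRk (G.1 ∪ F.1) := rfl
    rw [h4]
    rw [h5] at h2
    omega

/-- By induction, `zPoly M` and `partitionPoly V` have the same terms except at the empty flat,
where `klPoly M` stands against `simplePoly m`. Both complete the same `q` to a palindromic
polynomial and have degree less than `m / 2`, so they agree. -/
theorem IsPartitionMatroid.klPoly_eq [Finite V] {m : ℕ} (h : IsPartitionMatroid M V)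
    (hV : Nat.card V = m + 1) : klPoly M = simplePoly m := by
  classical
  induction m using Nat.strong_induction_on generalizing V M with
  | _ m ih =>
  have hfin := h.finite
  have hloop := h.loopless
  have hne : Nonempty V := (Nat.card_pos_iff.1 (by omega)).1
  obtain ⟨φ, hφ⟩ := h.exists_iso
  have hrk : M.eRank.toNat = m := by
    let T : {F // M.IsFlat F} := ⟨M.E, M.ground_isFlat⟩
    have hT : φ T = ⊤ := by
      refine top_unique ?_
      rw [← φ.apply_symm_apply ⊤, φ.le_iff_le]
      exact (φ.symm ⊤).2.subset_ground
    have h1 := hφ T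
    have h2 : Nat.card (Quotient (φ T)) = 1 := by
      exact Nat.card_eq_one_iff_unique.2 ⟨Quotient.subsingleton_iff.2 hT,
        ⟨Quotient.mk _ (Classical.arbitrary V)⟩⟩
    rw [h2, hV, show M.eRk T.1 = M.eRank from M.eRk_ground] at h1
    omega
  have hrk' : M.eRank = m := (eRank_eq_natCast_iff (M := M) m).2 hrk
  rcases Nat.eq_zero_or_pos m with rfl | hm
  · rw [simplePoly_zero, klPoly_of_eRank_eq_zero M (by simpa using hrk')]
  have h0 : M.eRank ≠ 0 := by
    rw [hrk']
    exact_mod_cast hm.ne'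
  obtain ⟨q, hp, hz, -, -⟩ := zPoly_eq M h0
  have := Fintype.ofFinite (Setoid V)
  have := Fintype.ofEquiv _ φ.symm.toEquiv
  let f : {F // M.IsFlat F} → ℤ[X] := fun F => X ^ (M.eRk F.1).toNat * klPoly (M ／ F.1)
  let g : {F // M.IsFlat F} → ℤ[X] := fun F =>
    X ^ (M.eRk F.1).toNat * simplePoly (Nat.card (Quotient (φ F)) - 1)
  have hf : zPoly M = ∑ F, f F := finsum_eq_sum_of_fintype _
  have hg : partitionPoly V = ∑ F, g F := by
    refine (Fintype.sum_equiv φ.toEquiv _ _ fun F => ?_).symm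
    have := hφ F
    simp only [g]
    congr 2
    change _ = Nat.card V - Nat.card (Quotient (φ F))
    omega
  let B : {F // M.IsFlat F} := ⟨∅, by
    have := M.isFlat_closure ∅
    rwa [← loops, M.loops_eq_empty] at this⟩
  have hB : (M.eRk B.1).toNat = 0 := by simp [B]
  have hfg : ∑ F, (g F - f F) = g B - f B := by
    refine Finset.sum_eq_single_of_mem B (Finset.mem_univ _) fun F _ hF => ?_
    have hrkF : (M.eRk F.1).toNat ≠ 0 := by
      have hFne : F.1 ≠ ∅ := fun h => hF (Subtype.ext h)
      rw [Ne, ENat.toNat_eq_zero, not_or]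
      refine ⟨?_, eRk_ne_top_iff.2 (M.isRkFinite_set _)⟩
      rw [eRk_eq_zero_iff F.2.subset_ground, M.loops_eq_empty, subset_empty_iff]
      exact hFne
    have h1 := hφ F
    have h2 := card_quotient_pos (φ F)
    have h3 := ih (Nat.card (Quotient (φ F)) - 1) (by omega) (h.contract φ hφ F) (by omega)
    simp only [f, g, h3, sub_self]
  have hfB : f B = klPoly M := by
    simp [f, B]
  have hgB : g B = simplePoly m := by
    have := hφ B
    simp only [g]
    rw [hB, pow_zero, one_mul]
    congr 1
    omega
  rw [Finset.sum_sub_distrib, ← hf, ← hg, hfB, hgB, hz] at hfg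
  have hpart : partitionPoly V = simplePoly m + q := by linear_combination hfg
  ext i
  rw [hp, hrk, coeff_palindromicCorrection]
  split_ifs with hi
  -- Palindromicity compares the coefficients at `i` and `m - i`; at `m - i` only `q` contributes.
  · have h1 := coeff_partitionPoly_sub hV (show i ≤ m by omega)
    rw [hpart, coeff_add, coeff_add, coeff_simplePoly_eq_zero hm (by omega)] at h1
    linarith
  · rw [coeff_simplePoly_eq_zero hm (by omega)]

end PartitionLattice

/-! ### Flats of the complete graph as partitions of its vertices. -/

section CompleteGraph

universe v

variable {V : Type v}

theorem reachable_sup_edge_iff {G : SimpleGraph V} {x y : V} (hxy : x ≠ y) {a b : V} :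
    (G ⊔ SimpleGraph.edge x y).Reachable a b ↔ G.Reachable a b ∨
      (G.Reachable a x ∧ G.Reachable y b) ∨ (G.Reachable a y ∧ G.Reachable x b) := by
  have hadj : (G ⊔ SimpleGraph.edge x y).Adj x y := by simp [SimpleGraph.edge_adj, hxy]
  have hle : G ≤ G ⊔ SimpleGraph.edge x y := le_sup_left
  constructor
  · rintro ⟨w⟩
    induction w with
    | nil => exact Or.inl (.refl _)
    | @cons a c b h _ ih =>
      rw [SimpleGraph.sup_adj, SimpleGraph.edge_adj] at h
      rcases h with h | ⟨⟨rfl, rfl⟩ | ⟨rfl, rfl⟩, -⟩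
      · have h := h.reachable
        rcases ih with ih | ih | ih
        · exact Or.inl (h.trans ih)
        · exact Or.inr (Or.inl ⟨h.trans ih.1, ih.2⟩)
        · exact Or.inr (Or.inr ⟨h.trans ih.1, ih.2⟩)
      · rcases ih with ih | ih | ih
        · exact Or.inr (Or.inl ⟨.refl _, ih⟩)
        · exact Or.inl (ih.1.symm.trans ih.2)
        · exact Or.inl ih.2
      · rcases ih with ih | ih | ih
        · exact Or.inr (Or.inr ⟨.refl _, ih⟩)
        · exact Or.inl ih.2
        · exact Or.inl (ih.1.symm.trans ih.2)
  · rintro (h | h | h)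
    · exact h.mono hle
    · exact ((h.1.mono hle).trans hadj.reachable).trans (h.2.mono hle)
    · exact ((h.1.mono hle).trans hadj.symm.reachable).trans (h.2.mono hle)

/-- The new edge merges the components of `x` and `y` and no others, so the map of components is
bijective away from that of `y`. -/
theorem card_quotient_sup_edge [Finite V] {G : SimpleGraph V} {x y : V} (h : ¬ G.Reachable x y) :
    Nat.card (Quotient (G ⊔ SimpleGraph.edge x y).reachableSetoid) + 1
      = Nat.card (Quotient G.reachableSetoid) := by
  have hxy : x ≠ y := by
    rintro rfl
    exact h (.refl _)
  have hle : ∀ a b, G.Reachable a b → (G ⊔ SimpleGraph.edge x y).Reachable a b :=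
    fun a b hab => hab.mono le_sup_left
  let f : Quotient G.reachableSetoid → Quotient (G ⊔ SimpleGraph.edge x y).reachableSetoid :=
    Quotient.map id hle
  let q : Quotient G.reachableSetoid := Quotient.mk _ y
  have hinj : InjOn f {q}ᶜ := by
    intro a ha b hb hab
    induction a using Quotient.ind
    induction b using Quotient.ind
    rename_i a b
    have ha' : ¬ G.Reachable a y := fun h => ha (Quotient.sound h)
    have hb' : ¬ G.Reachable b y := fun h => hb (Quotient.sound h)
    have hab' : (G ⊔ SimpleGraph.edge x y).Reachable a b := Quotient.exact hab
    rw [reachable_sup_edge_iff hxy] at hab'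
    refine Quotient.sound ?_
    rcases hab' with h | h | h
    · exact h
    · exact absurd h.2.symm hb'
    · exact absurd h.1 ha'
  have hsurj : f '' {q}ᶜ = univ := by
    refine eq_univ_of_forall fun c => ?_
    induction c using Quotient.ind
    rename_i a
    by_cases ha : G.Reachable a y
    · refine ⟨Quotient.mk _ x, fun hx => h (Quotient.exact hx), Quotient.sound ?_⟩
      exact (reachable_sup_edge_iff hxy).2 (Or.inr (Or.inl ⟨.refl _, ha.symm⟩))
    · exact ⟨Quotient.mk _ a, fun hx => ha (Quotient.exact hx), rfl⟩
  have h1 := hinj.ncard_image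
  rw [hsurj, ncard_univ] at h1
  rw [h1, ← ncard_singleton q, add_comm, ncard_add_ncard_compl]

theorem fromEdgeSet_insert (x y : V) (I : Set (Sym2 V)) :
    SimpleGraph.fromEdgeSet (insert s(x, y) I)
      = SimpleGraph.fromEdgeSet I ⊔ SimpleGraph.edge x y := by
  rw [SimpleGraph.edge, ← SimpleGraph.fromEdgeSet_union, Set.union_comm]
  rfl

/-- Each edge added to a forest joins two components. Applied to a basis of a flat, this gives the
rank condition in `IsPartitionMatroid`. -/
theorem ncard_add_card_quotient_of_isAcyclic [Finite V] {I : Set (Sym2 V)}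
    (hI : I ⊆ (⊤ : SimpleGraph V).edgeSet) (h : (SimpleGraph.fromEdgeSet I).IsAcyclic) :
    I.ncard + Nat.card (Quotient (SimpleGraph.fromEdgeSet I).reachableSetoid) = Nat.card V := by
  induction I, I.toFinite using Set.Finite.induction_on with
  | empty =>
    rw [ncard_empty, zero_add, SimpleGraph.fromEdgeSet_empty]
    refine (Nat.card_congr (Equiv.ofBijective (Quotient.mk _)
      ⟨fun a b hab => ?_, Quotient.mk_surjective⟩)).symm
    exact SimpleGraph.reachable_bot.1 (Quotient.exact hab)
  | @insert e I heI hfin ih =>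
    induction e with
    | _ x y =>
    have hxy : x ≠ y := by simpa using hI (mem_insert _ _)
    rw [fromEdgeSet_insert] at h ⊢
    have hnr : ¬ (SimpleGraph.fromEdgeSet I).Reachable x y := by
      intro hr
      rcases (SimpleGraph.isAcyclic_sup_fromEdgeSet_iff.1 h).2 hr with h' | h'
      · exact hxy h'
      · exact heI ((SimpleGraph.fromEdgeSet_adj _).1 h').1
    have h1 := ih ((subset_insert _ _).trans hI) (h.anti le_sup_left)
    have h2 := card_quotient_sup_edge hnr
    rw [ncard_insert_of_notMem heI hfin]
    omega

/-- The graph whose components are the classes of a setoid and are complete. -/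
def setoidGraph (s : Setoid V) : SimpleGraph V where
  Adj x y := x ≠ y ∧ s x y
  symm := ⟨fun _ _ h => ⟨h.1.symm, s.symm h.2⟩⟩
  loopless := ⟨fun _ h => h.1 rfl⟩

theorem setoidGraph_reachable_iff {s : Setoid V} {a b : V} :
    (setoidGraph s).Reachable a b ↔ s a b := by
  constructor
  · rintro ⟨w⟩
    induction w with
    | nil => exact s.refl _
    | cons h _ ih => exact s.trans h.2 ih
  · intro h
    rcases eq_or_ne a b with rfl | hne
    · exact .refl _
    · exact SimpleGraph.Adj.reachable (G := setoidGraph s) ⟨hne, h⟩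

variable [Finite V] {F I : Set (Sym2 V)} {x y : V}

theorem cycleMatroid_indep_iff {G : SimpleGraph V} :
    (cycleMatroid G).Indep I ↔ I ⊆ G.edgeSet ∧ (SimpleGraph.fromEdgeSet I).IsAcyclic :=
  Iff.rfl

theorem cycleMatroid_ground {G : SimpleGraph V} : (cycleMatroid G).E = G.edgeSet := rfl

/-- Adding an edge outside the forest closes a cycle exactly when its ends are already connected. -/
theorem mem_closure_iff_reachable_of_indep (hI : (cycleMatroid (⊤ : SimpleGraph V)).Indep I)
    (hxy : x ≠ y) : s(x, y) ∈ (cycleMatroid (⊤ : SimpleGraph V)).closure I ↔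
      (SimpleGraph.fromEdgeSet I).Reachable x y := by
  have hE : s(x, y) ∈ (⊤ : SimpleGraph V).edgeSet := by simpa using hxy
  by_cases h : s(x, y) ∈ I
  · refine iff_of_true ((cycleMatroid _).subset_closure I hI.subset_ground h) ?_
    exact SimpleGraph.Adj.reachable ((SimpleGraph.fromEdgeSet_adj _).2 ⟨h, hxy⟩)
  · rw [hI.mem_closure_iff_of_notMem h, ← not_indep_iff (insert_subset hE hI.subset_ground),
      cycleMatroid_indep_iff, fromEdgeSet_insert, SimpleGraph.isAcyclic_sup_fromEdgeSet_iff,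
      SimpleGraph.fromEdgeSet_adj]
    have h1 := (cycleMatroid_indep_iff.1 hI).2
    have h2 := insert_subset hE (cycleMatroid_indep_iff.1 hI).1
    simp only [h, hxy, h1, h2, true_and, false_and, or_self, imp_false, not_not]

theorem IsBasis.reachable_iff (h : (cycleMatroid (⊤ : SimpleGraph V)).IsBasis I F) {a b : V} :
    (SimpleGraph.fromEdgeSet I).Reachable a b ↔ (SimpleGraph.fromEdgeSet F).Reachable a b := by
  refine ⟨fun hab => hab.mono (SimpleGraph.fromEdgeSet_mono h.subset), ?_⟩
  rintro ⟨w⟩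
  induction w with
  | nil => exact .refl _
  | cons hadj _ ih =>
    rw [SimpleGraph.fromEdgeSet_adj] at hadj
    exact ((mem_closure_iff_reachable_of_indep h.indep hadj.2).1
      (h.subset_closure hadj.1)).trans ih

theorem mem_closure_iff_reachable (hF : F ⊆ (⊤ : SimpleGraph V).edgeSet) (hxy : x ≠ y) :
    s(x, y) ∈ (cycleMatroid (⊤ : SimpleGraph V)).closure F ↔
      (SimpleGraph.fromEdgeSet F).Reachable x y := by
  obtain ⟨I, hI⟩ := (cycleMatroid (⊤ : SimpleGraph V)).exists_isBasis F hF
  rw [← hI.closure_eq_closure, mem_closure_iff_reachable_of_indep hI.indep hxy,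
    IsBasis.reachable_iff hI]

theorem isFlat_setoidGraph (s : Setoid V) :
    (cycleMatroid (⊤ : SimpleGraph V)).IsFlat (setoidGraph s).edgeSet := by
  have hE : (setoidGraph s).edgeSet ⊆ (⊤ : SimpleGraph V).edgeSet :=
    SimpleGraph.edgeSet_mono le_top
  rw [isFlat_iff_closure_eq]
  refine Subset.antisymm (fun e he => ?_) ((cycleMatroid _).subset_closure _ hE)
  have heE := (cycleMatroid (⊤ : SimpleGraph V)).closure_subset_ground _ he
  induction e with
  | _ x y =>
  have hxy : x ≠ y := by simpa [cycleMatroid_ground] using heE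
  rw [mem_closure_iff_reachable hE hxy, SimpleGraph.fromEdgeSet_edgeSet,
    setoidGraph_reachable_iff] at he
  exact ⟨hxy, he⟩

/-- The flats of the cycle matroid of a complete graph correspond to the partitions of the
vertices. -/
def flatsIsoSetoid : {F // (cycleMatroid (⊤ : SimpleGraph V)).IsFlat F} ≃o Setoid V where
  toFun F := (SimpleGraph.fromEdgeSet F.1).reachableSetoid
  invFun s := ⟨(setoidGraph s).edgeSet, isFlat_setoidGraph s⟩
  left_inv F := by
    refine Subtype.ext (Set.ext fun e => ?_)
    induction e with
    | _ x y =>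
    by_cases hxy : x = y
    · refine iff_of_false (fun h => h.1 hxy) fun h => ?_
      have := F.2.subset_ground h
      simp [cycleMatroid_ground, hxy] at this
    · conv_rhs => rw [← F.2.closure, mem_closure_iff_reachable F.2.subset_ground hxy]
      exact and_iff_right hxy
  right_inv s := by
    ext a b
    change (SimpleGraph.fromEdgeSet (setoidGraph s).edgeSet).Reachable a b ↔ _
    rw [SimpleGraph.fromEdgeSet_edgeSet, setoidGraph_reachable_iff]
  map_rel_iff' {F F'} := by
    constructor
    · intro h e he
      have heE := F.2.subset_ground he
      induction e with
      | _ x y =>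
      have hxy : x ≠ y := by simpa [cycleMatroid_ground] using heE
      rw [← F'.2.closure, mem_closure_iff_reachable F'.2.subset_ground hxy]
      exact h (SimpleGraph.Adj.reachable ((SimpleGraph.fromEdgeSet_adj _).2 ⟨he, hxy⟩))
    · intro h a b hab
      exact SimpleGraph.Reachable.mono (SimpleGraph.fromEdgeSet_mono h) hab

theorem isPartitionMatroid_cycleMatroid :
    IsPartitionMatroid (cycleMatroid (⊤ : SimpleGraph V)) V := by
  refine ⟨⟨toFinite _⟩, ?_, flatsIsoSetoid, fun F => ?_⟩
  · rw [loopless_iff, eq_empty_iff_forall_notMem]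
    intro e he
    have heE := (cycleMatroid (⊤ : SimpleGraph V)).closure_subset_ground _ he
    induction e with
    | _ x y =>
    have hxy : x ≠ y := by simpa [cycleMatroid_ground] using heE
    rw [loops, mem_closure_iff_reachable (empty_subset _) hxy, SimpleGraph.fromEdgeSet_empty,
      SimpleGraph.reachable_bot] at he
    exact hxy he
  · obtain ⟨I, hI⟩ := (cycleMatroid (⊤ : SimpleGraph V)).exists_isBasis F.1 F.2.subset_ground
    have h := ncard_add_card_quotient_of_isAcyclic hI.indep.subset_ground
      (cycleMatroid_indep_iff.1 hI.indep).2
    rw [← hI.encard_eq_eRk, ← ncard_def, ← h]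
    congr 2
    have : flatsIsoSetoid F = (SimpleGraph.fromEdgeSet I).reachableSetoid :=
      Setoid.ext fun a b => (IsBasis.reachable_iff hI).symm
    rw [this]

theorem klPoly_braidMatroid (m : ℕ) : klPoly (braidMatroid (m + 1)) = simplePoly m :=
  isPartitionMatroid_cycleMatroid.klPoly_eq (by simp)

end CompleteGraph

end SPMatroid

/-! ### The count and the leading coefficient. -/

theorem mainTheorem5 (k : ℕ) :
    ((SPMatroid.simpleQuasiSP (2 * k) (k + 1)).ncard : ℚ) =
      (SPMatroid.E k : ℚ) + 1 / 2 * ∑ a ∈ Finset.range k,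
        (Nat.choose (2 * k) (2 * a + 1) : ℚ)
          * (Nat.doubleFactorial (2 * a - 1) : ℚ)
          * (Nat.doubleFactorial (2 * k - 2 * a - 3) : ℚ)
          * (2 * (a : ℚ) + 1) ^ ((a : ℤ) - 1)
          * (2 * (k : ℚ) - 2 * (a : ℚ) - 1) ^ ((k : ℤ) - (a : ℤ) - 2) ∧
    (1 ≤ k →
      (SPMatroid.klPoly (SPMatroid.braidMatroid (2 * k + 1))).natDegree = k - 1 ∧
      (SPMatroid.klPoly (SPMatroid.braidMatroid (2 * k + 1))).leadingCoeff =
        ((SPMatroid.simpleQuasiSP (2 * k) (k + 1)).ncard : ℤ)) := by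
  have hmain : ((SPMatroid.simpleQuasiSP (2 * k) (k + 1)).ncard : ℚ) =
      (SPMatroid.E k : ℚ) + 1 / 2 * ∑ a ∈ Finset.range k,
        (Nat.choose (2 * k) (2 * a + 1) : ℚ)
          * (Nat.doubleFactorial (2 * a - 1) : ℚ)
          * (Nat.doubleFactorial (2 * k - 2 * a - 3) : ℚ)
          * (2 * (a : ℚ) + 1) ^ ((a : ℤ) - 1)
          * (2 * (k : ℚ) - 2 * (a : ℚ) - 1) ^ ((k : ℤ) - (a : ℤ) - 2) := by
    rw [← SPMatroid.cast_two_mul_ncard_isNearTight, SPMatroid.ncard_simpleQuasiSP_eq]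
    push_cast
    ring
  refine ⟨hmain, fun hk => ?_⟩
  -- Positivity of the count pins the degree at exactly `k - 1`; for `k ≥ 1` the sum is nonempty and
  -- all its terms are positive.
  have hpos : (0 : ℚ) < (SPMatroid.simpleQuasiSP (2 * k) (k + 1)).ncard := by
    rw [hmain]
    refine add_pos_of_nonneg_of_pos (Nat.cast_nonneg _) (mul_pos one_half_pos ?_)
    refine Finset.sum_pos (fun a ha => ?_) ⟨0, Finset.mem_range.2 (by omega)⟩
    rw [Finset.mem_range] at ha
    have hak : (a : ℚ) + 1 ≤ k := by exact_mod_cast ha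
    have h1 : (0 : ℚ) < 2 * (k : ℚ) - 2 * (a : ℚ) - 1 := by linarith
    have h2 : 0 < Nat.choose (2 * k) (2 * a + 1) := Nat.choose_pos (by omega)
    have h3 := Nat.doubleFactorial_pos (2 * a - 1)
    have h4 := Nat.doubleFactorial_pos (2 * k - 2 * a - 3)
    positivity
  -- The coefficient at `k - 1` counts matroids of rank `2 k - (k - 1) = k + 1`.
  have hcoeff := SPMatroid.coeff_simplePoly (show k - 1 ≤ 2 * k by omega)
  rw [show 2 * k - (k - 1) = k + 1 by omega] at hcoeff
  have hdeg : (SPMatroid.simplePoly (2 * k)).natDegree = k - 1 := by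
    refine Polynomial.natDegree_eq_of_le_of_coeff_ne_zero ?_ ?_
    · refine Polynomial.natDegree_le_iff_coeff_eq_zero.2 fun i hi => ?_
      exact SPMatroid.coeff_simplePoly_eq_zero (by omega) (by omega)
    · rw [hcoeff]
      exact_mod_cast hpos.ne'
  rw [SPMatroid.klPoly_braidMatroid, Polynomial.leadingCoeff, hdeg, hcoeff]
  exact ⟨rfl, rfl⟩
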